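/- **Setting.** A ball $\mathcal S$ of radius $1$ with symmetric inertia tensor $J$ (a real $3\times3$ matrix, in the frame attached to the ball) rotates about its fixed center and touches, without sliding, $N\ge 0$ dynamically symmetric balls with fixed centers. Let $\rho_k>0$ be the radius and $D_k\in\mathbb R$ the central moment of inertia of the $k$-th peripheral ball, and $\gamma^k$ the unit vector, fixed in space, from the center of $\mathcal S$ to the $k$-th contact point. (No sign of $D_k$ is needed below, so that either sign convention for the reaction torques is covered.) Let $\alpha,\beta,\gamma$ be an orthonormal frame fixed in space. All vectors are written in the frame of the ball, so that each $\gamma^k$ is a combination of $\alpha,\beta,\gamma$ with constant coefficients. Put $$\mathcal I=J-\sum_{k=1}^N\frac{D_k}{\rho_k^2}\,\mathbf I,\qquad \Gamma=\sum_{k=1}^N\frac{D_k}{\rho_k^2}\,\gamma^k\otimes\gamma^k,\qquad K=(\mathcal I+\Gamma)\Omega .$$ The spherical support system is the L+R system $\dot K=K\times\Omega$, $\dot\Gamma=[\Gamma,\omega]$, where $\omega$ is the matrix of $v\mapsto\Omega\times v$; in terms of the frame, it is $$\dot K=K\times\Omega,\qquad \dot\alpha=\alpha\times\Omega,\quad\dot\beta=\beta\times\Omega,\quad\dot\gamma=\gamma\times\Omega.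 \tag{1}$$ Assume that the ball is dynamically nonsymmetric in the weak sense that $J$ is not a multiple of $\mathbf I$, and that $\det(\mathcal I+\Gamma)>0$ for all orthonormal frames $(\alpha,\beta,\gamma)$ (for example, that $\mathcal I+\Gamma$ is always positive definite). Let $U\subset\mathbb R^{12}$ be the open set of all $(\Omega,\alpha,\beta,\gamma)$, the frame not necessarily orthonormal, with $\det(\mathcal I+\Gamma)>0$, and let $P\subset U$ be the phase space, on which $\alpha,\beta,\gamma$ are orthonormal. **Theorem.** The spherical support system is integrable by the Euler–Jacobi theorem, and its generic invariant manifolds are two-dimensional tori. Precisely: 1. On $U$, (1) is equivalent to $\dot x=f(x)$ with $f(x)=\big((\mathcal I+\Gamma)^{-1}(\mathcal I\Omega\times\Omega),\ \alpha\times\Omega,\ \beta\times\Omega,\ \gamma\times\Omega\big)$. On every open interval, the solutions $(\Omega,\Gamma)$ of the L+R system for which $\Gamma(t_0)$ is the tensor of a given orthonormal frame are exactly those that come from a solution of (1) in $P$ starting at $t_0$ from that frame. 2. Omit any one of the four functions $(K,K),(K,\alpha),(K,\beta),(K,\gamma)$, and let $F_1,\dots,F_{10}$ be the other three, the energy $\frac12(\Omega,(\mathcal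 I+\Gamma)\Omega)$ and the six scalar products of $\alpha,\beta,\gamma$. For constants $c\in\mathbb R^4$, let $M_c\subset P$ be the common level set on which the three remaining functions and the energy have the values $c$ and the scalar products those of an orthonormal frame. Call $c$ regular if the Euler–Jacobi theorem applies on $M_c$, that is: $f$ is smooth on $U$ and has the invariant measure with smooth positive density $\mu=\sqrt{\det(\mathcal I+\Gamma)}$, $\operatorname{div}(\mu f)=0$; the $10=12-2$ functions $F_i$ are smooth first integrals on $U$; and $dF_1,\dots,dF_{10}$ are linearly independent at every point of $M_c$. Then almost every $c\in\mathbb R^4$ is regular, and the points of $P$ whose values are regular contain an open dense subset of $P$. 3. For every regular $c$, each connected component $L$ of $M_c$ is a two-dimensional torus, smoothly embedded in $\mathbb R^{12}$. Every solution of (1) in $U$ on an open interval that meets $L$ stays in $L$. In suitable angular coordinates on $L$, (1) reads $\dot\varphi=g(\varphi)$ with $g$ smooth, $2\pi$-periodic in each variable and nowhere zero, and it has an invariant measure $\Phi\,d\varphi_1d\varphi_2$ with smooth positive $2\pi$-periodic density $\Phi$, i.e. $\operatorname{div}(\Phi g)=0$. -/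

import Mathlib

open MeasureTheory
open scoped Matrix ContDiff

noncomputable section

/-! ### First integrals, invariant measures and the setting of the Euler-Jacobi theorem -/

section General

variable {E : Type*} [NormedAddCommGroup E] [NormedSpace ℝ E]

/-- `F` is a (smooth) first integral on `U` of the system `x' = f x`. -/
def IsFirstIntegralOn (U : Set E) (f : E → E) (F : E → ℝ) : Prop :=
  ContDiffOn ℝ ∞ F U ∧ ∀ x ∈ U, fderiv ℝ F x (f x) = 0

/-- The divergence of a vector field on a finite-dimensional space. -/
def divergence (f : E → E) (x : E) : ℝ :=
  LinearMap.trace ℝ E (fderiv ℝ f x : E →ₗ[ℝ] E)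

/-- The system `x' = f x` has on `U` the invariant measure `μ(x) dx` with smooth positive
density `μ`: the Liouville equation `div (μ f) = 0` holds. -/
def IsInvariantDensityOn (U : Set E) (f : E → E) (μ : E → ℝ) : Prop :=
  ContDiffOn ℝ ∞ μ U ∧ (∀ x ∈ U, 0 < μ x) ∧
    ∀ x ∈ U, divergence (fun y => μ y • f y) x = 0

/-- The common level set `M_c = {x ∈ U | F_i(x) = c_i for all i}`. -/
def levelSet {ι : Type*} (U : Set E) (F : ι → E → ℝ) (c : ι → ℝ) : Set E :=
  {x | x ∈ U ∧ ∀ i, F i x = c i}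

/-- The Euler-Jacobi theorem applies to the system `x' = f x`, `x ∈ U ⊆ ℝ^m`, on the level set
`M_c`: the system has an invariant measure with density `μ` and `m - 2` first integrals, and
these are independent at every point of `M_c`. -/
structure EulerJacobiOn {ι : Type*} [Fintype ι] (U : Set E) (f : E → E) (μ : E → ℝ)
    (F : ι → E → ℝ) (c : ι → ℝ) : Prop where
  isOpen : IsOpen U
  smooth : ContDiffOn ℝ ∞ f U
  density : IsInvariantDensityOn U f μ
  integrals : ∀ i, IsFirstIntegralOn U f (F i)
  card : Fintype.card ι + 2 = Module.finrank ℝ E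
  independent : ∀ x ∈ levelSet U F c, LinearIndependent ℝ fun i => fderiv ℝ (F i) x

/-- `φ` induces a diffeomorphism of the torus `ℝ² / (2πℤ)²` onto the subset `L`:
it is a smooth immersion with image `L` that identifies exactly the points which are congruent
modulo `(2πℤ)²`. -/
structure IsTorusParametrization (φ : (Fin 2 → ℝ) → E) (L : Set E) : Prop where
  smooth : ContDiff ℝ ∞ φ
  immersion : ∀ s, Function.Injective (fderiv ℝ φ s)
  range_eq : Set.range φ = L
  eq_iff : ∀ s t, φ s = φ t ↔ ∃ n : Fin 2 → ℤ, ∀ i, s i = t i + 2 * Real.pi * n i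

/-- `h` is `2π`-periodic in each of its two variables. -/
def IsBiperiodic {A : Type*} (h : (Fin 2 → ℝ) → A) : Prop :=
  ∀ (s : Fin 2 → ℝ) (n : Fin 2 → ℤ), h (fun i => s i + 2 * Real.pi * n i) = h s

/-- `L` is a two-dimensional torus, smoothly embedded in `E`, to which the vector field `f` is
tangent; on it `f` reads `φ' = g(φ)` in angular coordinates, has no zeros, and has an invariant
measure `Φ dφ₁ dφ₂` with smooth positive density. -/
def IsInvariantTorus (f : E → E) (L : Set E) : Prop :=
  ∃ (φ : (Fin 2 → ℝ) → E) (g : (Fin 2 → ℝ) → (Fin 2 → ℝ)) (Φ : (Fin 2 → ℝ) → ℝ),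
    IsTorusParametrization φ L ∧
    ContDiff ℝ ∞ g ∧ IsBiperiodic g ∧ (∀ s, g s ≠ 0) ∧
    (∀ s, fderiv ℝ φ s (g s) = f (φ s)) ∧
    IsBiperiodic Φ ∧ IsInvariantDensityOn Set.univ g Φ

end General

/-! ### The spherical support -/

/-- Vectors of `ℝ³`, written in the frame attached to the central ball. -/
abbrev Vec3 : Type := Fin 3 → ℝ

/-- Points `(Ω, (α, β, γ))`: the angular velocity and the three vectors of a frame fixed in
space, all written in the frame attached to the ball. -/
abbrev SupportState : Type := Vec3 × (Fin 3 → Vec3)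

/-- `α, β, γ` are orthonormal. -/
def IsOrthonormalFrame (e : Fin 3 → Vec3) : Prop :=
  ∀ i j, e i ⬝ᵥ e j = if i = j then 1 else 0

/-- The phase space: angular velocities and orthonormal frames. -/
def phaseSpace : Set SupportState := {x | IsOrthonormalFrame x.2}

/-- The matrix of `v ↦ Ω × v`. -/
def hatMatrix (Ω : Vec3) : Matrix (Fin 3) (Fin 3) ℝ :=
  !![0, -Ω 2, Ω 1; Ω 2, 0, -Ω 0; -Ω 1, Ω 0, 0]

/-- A ball of radius `1` with fixed center, in contact with `N` balls with fixed centers.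
`J` is the inertia tensor of the ball, `D k` and `ρ k` are the central moment of inertia and the
radius of the `k`-th peripheral ball, and `contact k` holds the coordinates, in the frame fixed in
space, of the unit vector from the center of the ball to the `k`-th point of contact.
No sign of `D k` is prescribed: reversing it reverses the sign of the reaction torques. -/
structure SphericalSupport (N : ℕ) where
  J : Matrix (Fin 3) (Fin 3) ℝ
  D : Fin N → ℝ
  ρ : Fin N → ℝ
  contact : Fin N → Fin 3 → ℝ
  J_symm : J.IsSymm
  ρ_pos : ∀ k, 0 < ρ k
  contact_unit : ∀ k, contact k ⬝ᵥ contact k = 1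

namespace SphericalSupport

variable {N : ℕ} (S : SphericalSupport N)

/-- The tensor `ℐ = J - ∑ (D_k / ρ_k²) 𝐈`, fixed in the body. -/
def inertia : Matrix (Fin 3) (Fin 3) ℝ :=
  S.J - (∑ k, S.D k / S.ρ k ^ 2) • (1 : Matrix (Fin 3) (Fin 3) ℝ)

/-- The unit vector `γ^k` in the body frame. -/
def contactVec (k : Fin N) (e : Fin 3 → Vec3) : Vec3 := ∑ i, S.contact k i • e i

/-- The tensor `Γ = ∑ (D_k / ρ_k²) γ^k ⊗ γ^k`, fixed in space. -/
def gammaTensor (e : Fin 3 → Vec3) : Matrix (Fin 3) (Fin 3) ℝ :=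
  ∑ k, (S.D k / S.ρ k ^ 2) • Matrix.vecMulVec (S.contactVec k e) (S.contactVec k e)

/-- The total inertia operator `ℐ + Γ`. -/
def totalInertia (e : Fin 3 → Vec3) : Matrix (Fin 3) (Fin 3) ℝ := S.inertia + S.gammaTensor e

/-- `K = (ℐ + Γ) Ω`. -/
def angMomentum (x : SupportState) : Vec3 := S.totalInertia x.2 *ᵥ x.1

/-- The functions `(K,K)`, `(K,α)`, `(K,β)`, `(K,γ)`, in this order. -/
def momentumIntegral (i : Fin 4) (x : SupportState) : ℝ :=
  Fin.cases (S.angMomentum x ⬝ᵥ S.angMomentum x) (fun j => S.angMomentum x ⬝ᵥ x.2 j) i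

/-- The kinetic energy `½ (Ω, (ℐ + Γ) Ω)`. -/
def energy (x : SupportState) : ℝ := (1 / 2) * (x.1 ⬝ᵥ S.angMomentum x)

/-- At time `t` the curve `x = (Ω, α, β, γ)` satisfies
`K' = K × Ω`, `α' = α × Ω`, `β' = β × Ω`, `γ' = γ × Ω`. -/
def IsMotionAt (x : ℝ → SupportState) (t : ℝ) : Prop :=
  DifferentiableAt ℝ (fun τ => (x τ).1) t ∧
  HasDerivAt (fun τ => S.angMomentum (x τ)) (S.angMomentum (x t) ⨯₃ (x t).1) t ∧
  ∀ i, HasDerivAt (fun τ => (x τ).2 i) ((x t).2 i ⨯₃ (x t).1) t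

/-- At time `t` the curve `(Ω, Γ)` satisfies the L+R system
`K' = K × Ω`, `Γ' = [Γ, ω]`, `K = (ℐ + Γ) Ω`, where `ω` is the matrix of `v ↦ Ω × v`. -/
def IsLRSolutionAt (Ω : ℝ → Vec3) (Γ : ℝ → Matrix (Fin 3) (Fin 3) ℝ) (t : ℝ) : Prop :=
  DifferentiableAt ℝ Ω t ∧
  HasDerivAt (fun τ => (S.inertia + Γ τ) *ᵥ Ω τ) (((S.inertia + Γ t) *ᵥ Ω t) ⨯₃ Ω t) t ∧
  ∀ i j, HasDerivAt (fun τ => Γ τ i j)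
    ((Γ t * hatMatrix (Ω t) - hatMatrix (Ω t) * Γ t) i j) t

/-- The vector field of the system, solved for `Ω'`. -/
def field (x : SupportState) : SupportState :=
  ((S.totalInertia x.2)⁻¹ *ᵥ ((S.inertia *ᵥ x.1) ⨯₃ x.1), fun i => x.2 i ⨯₃ x.1)

/-- The open set on which `det (ℐ + Γ)` is positive. -/
def domain : Set SupportState := {x | 0 < (S.totalInertia x.2).det}

/-- The density `√det (ℐ + Γ)`. -/
def density (x : SupportState) : ℝ := Real.sqrt (S.totalInertia x.2).det

/-- Indices of the ten first integrals: the six scalar products of the frame vectors, the energy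
(`none`), and the functions `(K,K)`, `(K,α)`, `(K,β)`, `(K,γ)` without the `j`-th. -/
abbrev IntegralIndex (j : Fin 4) : Type :=
  {p : Fin 3 × Fin 3 // p.1 ≤ p.2} ⊕ Option {i : Fin 4 // i ≠ j}

/-- The energy and three of the functions `(K,K)`, `(K,α)`, `(K,β)`, `(K,γ)`. -/
def dynamicIntegrals (j : Fin 4) (o : Option {i : Fin 4 // i ≠ j}) : SupportState → ℝ :=
  match o with
  | none => S.energy
  | some i => S.momentumIntegral i

/-- The ten first integrals. -/
def integrals (j : Fin 4) : IntegralIndex j → SupportState → ℝ :=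
  Sum.elim (fun p x => x.2 p.1.1 ⬝ᵥ x.2 p.1.2) (S.dynamicIntegrals j)

/-- The ten constants: the geometric integrals have the values of an orthonormal frame, the other
four have the values `c`. -/
def constants (j : Fin 4) (c : Option {i : Fin 4 // i ≠ j} → ℝ) : IntegralIndex j → ℝ :=
  Sum.elim (fun p => if p.1.1 = p.1.2 then 1 else 0) c

/-- The common level set of the ten integrals with constants `c`; it lies in the phase space. -/
def invariantLevel (j : Fin 4) (c : Option {i : Fin 4 // i ≠ j} → ℝ) : Set SupportState :=
  levelSet S.domain (S.integrals j) (constants j c)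

/-- The Euler-Jacobi theorem applies on the level set with constants `c`. -/
def EulerJacobiLevel (j : Fin 4) (c : Option {i : Fin 4 // i ≠ j} → ℝ) : Prop :=
  EulerJacobiOn S.domain S.field S.density (S.integrals j) (constants j c)

end SphericalSupport

end

open MeasureTheory
open scoped Matrix ContDiff

noncomputable section

/-! ### Derivatives of curves of matrices -/

/-! The frame is the matrix M whose rows are α, β, γ, so Γ = MᵀGM with a constant symmetric G,
`spaceTensor`. A carried frame satisfies M' = Mω. Hence Γ' = [Γ, ω], the components k of K in the
space frame are constant, and an L+R solution is recovered from a motion by carrying the initial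
frame along Ω (`isLRSolution_iff`). The density √det(ℐ + Γ) comes from a trace identity
(`isInvariantDensityOn_density`).

Regularity. At points of the phase space the only obstructions to independence of the ten
differentials are ℐΩ × Ω = 0 and, if (K, e_l) is left out, k_l = 0
(`linearIndependent_of_cross_ne_zero`; `cross_ne_zero_of_linearIndependent` is the half of the
converse that is needed). If ℐΩ = λΩ, then k = (G + λ)w with w the space components of Ω, so 2E = k
· (G + λ)⁻¹k: critical values lie on three quadratic graphs over k (`exists_critical_forms`). Such
graphs are null sets of constants. Their preimages have dense complement in the phase space, because
otherwise ℐ would commute with rotations in two planes and be scalar (`dense_two_energy_ne`).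

The tori. Positivity of det(ℐ + Γ) in all positions gives a number r such that (ℐ - r)⁻¹ + (Γ + r)⁻¹
is positive definite (`exists_isNormalForm`). Put T = (G + r)⁻¹ and let W be the space components of
(ℐ - r)Ω. Then Tk = w + TW, and c₀ = k · Tk - 2E equals Tk · W and is positive for Ω ≠ 0. For fixed
k and E this makes w a linear function of W, with the symmetric matrix c₀⁻¹ (Tk)(Tk)ᵀ - T.
Diagonalizing both sides, a state becomes an orthogonal O and a vector u with O(a ∘ u) = τ ∘ (Ou),
normalized by one linear equation on Ou (`IsCoupled`, `IsLevelForm.isCoupled`).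

With z = Ou, the squares u_i² and z_i² have equal moments of orders 0, 1, 2 at the nodes a_i and
τ_i. Up to scale they are barycentric coordinates of one point in two triangles inscribed in a
parabola. On a regular level no coupled u is an eigenvector, which forces the order of the nodes for
which the triangles meet in a quadrilateral (`exists_arranged`). The rational function ∑ u_i²/(Z -
a_i) - ∑ z_i²/(Z - τ_i) has a quadratic numerator, whose roots X ∈ [p, q] and Y ∈ [b, c] are
separating coordinates (`exists_quadSquares`). The substitution of sin² ψ and sin² φ unfolds the
quadrilateral through the zeros of four of the six coordinates. The signs of the other two and det O
are constant on components, and they determine O (`pairMatrix`). So a component is a torus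
(`exists_isCoupledTorus`).

The flow. Since M'Ω = 0, differentiation of O(a ∘ u) = τ ∘ (Ou) gives one linear relation between ψ'
and φ', and it separates as A₀(ψ) ψ' + A₁(φ) φ' = 0 (`IsArranged.flow_relation`). The velocity is
thus a nowhere vanishing multiple of (A₁(φ), -A₀(ψ)), which is divergence-free, and the factor gives
the invariant density (`exists_density`). -/

/-- Entrywise derivative of a curve of matrices. -/
def HasMatDerivAt {m n : Type*} (A : ℝ → Matrix m n ℝ) (A' : Matrix m n ℝ) (t : ℝ) : Prop :=
  ∀ i j, HasDerivAt (fun τ => A τ i j) (A' i j) t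

namespace HasMatDerivAt

variable {l m n : Type*} {t : ℝ}

lemma const (A : Matrix m n ℝ) : HasMatDerivAt (fun _ => A) 0 t :=
  fun _ _ => hasDerivAt_const _ _

lemma add {A B : ℝ → Matrix m n ℝ} {A' B' : Matrix m n ℝ} (hA : HasMatDerivAt A A' t)
    (hB : HasMatDerivAt B B' t) : HasMatDerivAt (fun τ => A τ + B τ) (A' + B') t :=
  fun i j => (hA i j).add (hB i j)

lemma transpose {A : ℝ → Matrix m n ℝ} {A' : Matrix m n ℝ} (hA : HasMatDerivAt A A' t) :
    HasMatDerivAt (fun τ => (A τ)ᵀ) A'ᵀ t :=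
  fun i j => hA j i

lemma mul [Fintype m] {A : ℝ → Matrix l m ℝ} {B : ℝ → Matrix m n ℝ} {A' : Matrix l m ℝ}
    {B' : Matrix m n ℝ} (hA : HasMatDerivAt A A' t) (hB : HasMatDerivAt B B' t) :
    HasMatDerivAt (fun τ => A τ * B τ) (A' * B t + A t * B') t := by
  intro i j
  simp only [Matrix.mul_apply, Matrix.add_apply, ← Finset.sum_add_distrib]
  exact HasDerivAt.fun_sum fun k _ => (hA i k).mul (hB k j)

lemma mulVec [Fintype n] [Finite m] {A : ℝ → Matrix m n ℝ} {v : ℝ → n → ℝ} {A' : Matrix m n ℝ}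
    {v' : n → ℝ} (hA : HasMatDerivAt A A' t) (hv : HasDerivAt v v' t) :
    HasDerivAt (fun τ => A τ *ᵥ v τ) (A' *ᵥ v t + A t *ᵥ v') t := by
  have := Fintype.ofFinite m
  rw [hasDerivAt_pi] at hv ⊢
  intro i
  simp only [Matrix.mulVec, dotProduct, Pi.add_apply, ← Finset.sum_add_distrib]
  exact HasDerivAt.fun_sum fun k _ => (hA i k).mul (hv k)

lemma eq_of_forall_eq_zero {A : ℝ → Matrix m n ℝ} {a b : ℝ}
    (hA : ∀ τ ∈ Set.Ioo a b, HasMatDerivAt A 0 τ) {r s : ℝ} (hr : r ∈ Set.Ioo a b)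
    (hs : s ∈ Set.Ioo a b) : A r = A s := by
  ext i j
  exact isOpen_Ioo.is_const_of_deriv_eq_zero isPreconnected_Ioo
    (fun τ hτ => (hA τ hτ i j).differentiableAt.differentiableWithinAt)
    (fun τ hτ => (hA τ hτ i j).deriv) hr hs

end HasMatDerivAt

lemma HasDerivAt.dotProduct' {n : Type*} [Fintype n] {u v : ℝ → n → ℝ} {u' v' : n → ℝ} {t : ℝ}
    (hu : HasDerivAt u u' t) (hv : HasDerivAt v v' t) :
    HasDerivAt (fun τ => u τ ⬝ᵥ v τ) (u' ⬝ᵥ v t + u t ⬝ᵥ v') t := by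
  rw [hasDerivAt_pi] at hu hv
  simp only [dotProduct, ← Finset.sum_add_distrib]
  exact HasDerivAt.fun_sum fun k _ => (hu k).mul (hv k)

/-! ### Frames as matrices -/

lemma isOrthonormalFrame_iff (e : Fin 3 → Vec3) :
    IsOrthonormalFrame e ↔ Matrix.of e * (Matrix.of e)ᵀ = 1 := by
  rw [← Matrix.ext_iff]
  simp only [Matrix.one_apply]
  rfl

lemma hatMatrix_mulVec (Ω v : Vec3) : hatMatrix Ω *ᵥ v = Ω ⨯₃ v := by
  ext i
  fin_cases i <;> simp [hatMatrix, Matrix.mulVec, dotProduct, Fin.sum_univ_three, cross_apply] <;> ring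

lemma transpose_hatMatrix (Ω : Vec3) : (hatMatrix Ω)ᵀ = -hatMatrix Ω := by
  ext i j
  fin_cases i <;> fin_cases j <;> simp [hatMatrix]

lemma vecMul_hatMatrix (Ω v : Vec3) : v ᵥ* hatMatrix Ω = v ⨯₃ Ω := by
  rw [← Matrix.mulVec_transpose, transpose_hatMatrix, Matrix.neg_mulVec, hatMatrix_mulVec,
    cross_anticomm]

lemma of_mul_hatMatrix (e : Fin 3 → Vec3) (Ω : Vec3) :
    Matrix.of e * hatMatrix Ω = Matrix.of fun i => e i ⨯₃ Ω := by
  ext i j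
  rw [Matrix.of_apply, ← vecMul_hatMatrix]
  rfl

lemma isOrthonormalFrame_transpose_mul {e : Fin 3 → Vec3} (h : IsOrthonormalFrame e) :
    (Matrix.of e)ᵀ * Matrix.of e = 1 :=
  mul_eq_one_comm.1 ((isOrthonormalFrame_iff e).1 h)

/-! ### The tensors and the equations of motion in matrix form -/

namespace SphericalSupport

variable {N : ℕ} (S : SphericalSupport N)

/-- The tensor `Γ` in the frame fixed in space. -/
def spaceTensor : Matrix (Fin 3) (Fin 3) ℝ :=
  ∑ k, (S.D k / S.ρ k ^ 2) • Matrix.vecMulVec (S.contact k) (S.contact k)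

lemma spaceTensor_transpose : S.spaceTensorᵀ = S.spaceTensor := by
  simp [spaceTensor, Matrix.transpose_sum, Matrix.transpose_vecMulVec]

lemma inertia_transpose : S.inertiaᵀ = S.inertia := by
  simp [inertia, S.J_symm.eq]

/-- The frame vectors are the rows of `Matrix.of e`, so its transpose turns space components into
body components. This congruence isolates the constant part of Γ and holds for frames that are not
orthonormal. -/
lemma gammaTensor_eq (e : Fin 3 → Vec3) :
    S.gammaTensor e = (Matrix.of e)ᵀ * S.spaceTensor * Matrix.of e := by
  have hc : ∀ k, S.contactVec k e = (Matrix.of e)ᵀ *ᵥ S.contact k := by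
    intro k
    ext i
    simp [contactVec, Matrix.mulVec, dotProduct, Finset.sum_apply, mul_comm]
  simp only [gammaTensor, spaceTensor, Finset.mul_sum, Finset.sum_mul, hc]
  refine Finset.sum_congr rfl fun k _ => ?_
  rw [Matrix.mul_smul, Matrix.smul_mul, Matrix.mul_vecMulVec, Matrix.vecMulVec_mul,
    ← Matrix.mulVec_transpose]

lemma gammaTensor_transpose (e : Fin 3 → Vec3) : (S.gammaTensor e)ᵀ = S.gammaTensor e := by
  simp [gammaTensor_eq, Matrix.transpose_mul, spaceTensor_transpose, Matrix.mul_assoc]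

lemma totalInertia_transpose (e : Fin 3 → Vec3) : (S.totalInertia e)ᵀ = S.totalInertia e := by
  simp [totalInertia, gammaTensor_transpose, inertia_transpose]

lemma hasMatDerivAt_gammaTensor {e : ℝ → Fin 3 → Vec3} {e' : Fin 3 → Vec3} {t : ℝ}
    (he : ∀ i, HasDerivAt (fun τ => e τ i) (e' i) t) :
    HasMatDerivAt (fun τ => S.gammaTensor (e τ))
      ((Matrix.of e')ᵀ * S.spaceTensor * Matrix.of (e t) +
        (Matrix.of (e t))ᵀ * S.spaceTensor * Matrix.of e') t := by
  have hM : HasMatDerivAt (fun τ => Matrix.of (e τ)) (Matrix.of e') t :=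
    fun i j => hasDerivAt_pi.1 (he i) j
  have := (hM.transpose.mul (HasMatDerivAt.const S.spaceTensor)).mul hM
  simp only [gammaTensor_eq]
  convert this using 1
  simp

/-- For rows carried by Ω the frame matrix M satisfies M' = Mω, and ωᵀ = -ω turns the product rule
for MᵀGM into a commutator. Orthonormality plays no role. -/
lemma hasMatDerivAt_gammaTensor_of_rotation {e : ℝ → Fin 3 → Vec3} {Ω : Vec3} {t : ℝ}
    (he : ∀ i, HasDerivAt (fun τ => e τ i) (e t i ⨯₃ Ω) t) :
    HasMatDerivAt (fun τ => S.gammaTensor (e τ))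
      (S.gammaTensor (e t) * hatMatrix Ω - hatMatrix Ω * S.gammaTensor (e t)) t := by
  have := S.hasMatDerivAt_gammaTensor he
  rw [← of_mul_hatMatrix, Matrix.transpose_mul, transpose_hatMatrix] at this
  convert this using 1
  rw [gammaTensor_eq]
  simp only [Matrix.mul_assoc, Matrix.neg_mul]
  abel

lemma hasDerivAt_angMomentum {x : ℝ → SupportState} {Ω' : Vec3} {e' : Fin 3 → Vec3} {t : ℝ}
    (hΩ : HasDerivAt (fun τ => (x τ).1) Ω' t)
    (he : ∀ i, HasDerivAt (fun τ => (x τ).2 i) (e' i) t) :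
    HasDerivAt (fun τ => S.angMomentum (x τ))
      (((Matrix.of e')ᵀ * S.spaceTensor * Matrix.of (x t).2 +
        (Matrix.of (x t).2)ᵀ * S.spaceTensor * Matrix.of e') *ᵥ (x t).1 +
        S.totalInertia (x t).2 *ᵥ Ω') t := by
  have hA := (HasMatDerivAt.const S.inertia (t := t)).add (S.hasMatDerivAt_gammaTensor he)
  have := hA.mulVec hΩ
  simpa [angMomentum, totalInertia] using this

lemma commutator_mulVec_self (A : Matrix (Fin 3) (Fin 3) ℝ) (Ω : Vec3) :
    (A * hatMatrix Ω - hatMatrix Ω * A) *ᵥ Ω = (A *ᵥ Ω) ⨯₃ Ω := by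
  rw [Matrix.sub_mulVec, ← Matrix.mulVec_mulVec, ← Matrix.mulVec_mulVec, hatMatrix_mulVec,
    hatMatrix_mulVec, cross_self, Matrix.mulVec_zero, zero_sub, cross_anticomm]

lemma hasDerivAt_angMomentum_of_rotation {x : ℝ → SupportState} {Ω' : Vec3} {t : ℝ}
    (hΩ : HasDerivAt (fun τ => (x τ).1) Ω' t)
    (he : ∀ i, HasDerivAt (fun τ => (x τ).2 i) ((x t).2 i ⨯₃ (x t).1) t) :
    HasDerivAt (fun τ => S.angMomentum (x τ))
      ((S.gammaTensor (x t).2 *ᵥ (x t).1) ⨯₃ (x t).1 + S.totalInertia (x t).2 *ᵥ Ω') t := by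
  have hA := (HasMatDerivAt.const S.inertia (t := t)).add
    (S.hasMatDerivAt_gammaTensor_of_rotation he)
  have := hA.mulVec hΩ
  rw [zero_add, commutator_mulVec_self] at this
  exact this

lemma angMomentum_eq (x : SupportState) :
    S.angMomentum x = S.inertia *ᵥ x.1 + S.gammaTensor x.2 *ᵥ x.1 := by
  rw [angMomentum, totalInertia, Matrix.add_mulVec]

lemma isUnit_det_of_mem_domain {x : SupportState} (hx : x ∈ S.domain) :
    IsUnit (S.totalInertia x.2).det :=
  (ne_of_gt hx).isUnit

lemma totalInertia_mulVec_field {x : SupportState} (hx : x ∈ S.domain) :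
    S.totalInertia x.2 *ᵥ (S.field x).1 = (S.inertia *ᵥ x.1) ⨯₃ x.1 := by
  rw [field, Matrix.mulVec_mulVec, Matrix.mul_nonsing_inv _ (S.isUnit_det_of_mem_domain hx),
    Matrix.one_mulVec]

/-- K' = Γ'Ω + (ℐ + Γ)Ω', and Γ'Ω = [Γ, ω]Ω = ΓΩ × Ω because ωΩ = 0. This cancels the same term of K
× Ω and leaves (ℐ + Γ)Ω' = ℐΩ × Ω. -/
theorem isMotionAt_iff (x : ℝ → SupportState) (t : ℝ) (hx : x t ∈ S.domain) :
    S.IsMotionAt x t ↔ HasDerivAt x (S.field (x t)) t := by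
  have hu := S.isUnit_det_of_mem_domain hx
  constructor
  · rintro ⟨h1, h2, h3⟩
    have hK := (S.hasDerivAt_angMomentum_of_rotation h1.hasDerivAt h3).unique h2
    rw [angMomentum_eq, map_add, LinearMap.add_apply, add_comm, add_left_inj] at hK
    have h4 : deriv (fun τ => (x τ).1) t = (S.field (x t)).1 := by
      rw [field, ← hK, Matrix.mulVec_mulVec, Matrix.nonsing_inv_mul _ hu, Matrix.one_mulVec]
    have h5 := h1.hasDerivAt
    rw [h4] at h5
    exact h5.prodMk (hasDerivAt_pi.2 h3)
  · intro h
    have h1 : HasDerivAt (fun τ => (x τ).1) (S.field (x t)).1 t :=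
      (ContinuousLinearMap.fst ℝ Vec3 (Fin 3 → Vec3)).hasFDerivAt.comp_hasDerivAt t h
    have h2 : HasDerivAt (fun τ => (x τ).2) (S.field (x t)).2 t :=
      (ContinuousLinearMap.snd ℝ Vec3 (Fin 3 → Vec3)).hasFDerivAt.comp_hasDerivAt t h
    have h3 := hasDerivAt_pi.1 h2
    refine ⟨h1.differentiableAt, ?_, h3⟩
    have hK := S.hasDerivAt_angMomentum_of_rotation h1 h3
    rw [S.totalInertia_mulVec_field hx] at hK
    rw [angMomentum_eq, map_add, LinearMap.add_apply, add_comm]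
    exact hK

end SphericalSupport

/-! ### Frames carried along by a given angular velocity -/

/-- On `(a, b)` the vectors `e` are fixed in space, for the angular velocity `Ω`. -/
def IsCarriedOn (Ω : ℝ → Vec3) (e : ℝ → Fin 3 → Vec3) (a b : ℝ) : Prop :=
  ∀ t ∈ Set.Ioo a b, ∀ i, HasDerivAt (fun τ => e τ i) (e t i ⨯₃ Ω t) t

namespace IsCarriedOn

variable {Ω : ℝ → Vec3} {e e₁ : ℝ → Fin 3 → Vec3} {a b : ℝ}

lemma mono (h : IsCarriedOn Ω e a b) {c d : ℝ} (hc : a ≤ c) (hd : d ≤ b) : IsCarriedOn Ω e c d :=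
  fun t ht => h t (Set.Ioo_subset_Ioo hc hd ht)

lemma hasMatDerivAt (h : IsCarriedOn Ω e a b) {t : ℝ} (ht : t ∈ Set.Ioo a b) :
    HasMatDerivAt (fun τ => Matrix.of (e τ)) (Matrix.of (e t) * hatMatrix (Ω t)) t := by
  intro i j
  rw [of_mul_hatMatrix]
  exact hasDerivAt_pi.1 (h t ht i) j

/-- The components of a tensor fixed in space, taken with respect to carried frames, are constant:
the terms with ω cancel in pairs. Λ = 1 gives conservation of scalar products, hence uniqueness of
carried frames; Λ = Γ recovers Γ from its initial value. -/
lemma mul_mul_transpose_eq (h : IsCarriedOn Ω e a b) (h₁ : IsCarriedOn Ω e₁ a b)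
    {Λ : ℝ → Matrix (Fin 3) (Fin 3) ℝ}
    (hΛ : ∀ t ∈ Set.Ioo a b,
      HasMatDerivAt Λ (Λ t * hatMatrix (Ω t) - hatMatrix (Ω t) * Λ t) t)
    {r s : ℝ} (hr : r ∈ Set.Ioo a b) (hs : s ∈ Set.Ioo a b) :
    Matrix.of (e r) * Λ r * (Matrix.of (e₁ r))ᵀ = Matrix.of (e s) * Λ s * (Matrix.of (e₁ s))ᵀ := by
  refine HasMatDerivAt.eq_of_forall_eq_zero
    (A := fun τ => Matrix.of (e τ) * Λ τ * (Matrix.of (e₁ τ))ᵀ) (fun τ hτ => ?_) hr hs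
  have := ((h.hasMatDerivAt hτ).mul (hΛ τ hτ)).mul (h₁.hasMatDerivAt hτ).transpose
  convert this using 1
  rw [Matrix.transpose_mul, transpose_hatMatrix]
  noncomm_ring

lemma mul_transpose_eq (h : IsCarriedOn Ω e a b) (h₁ : IsCarriedOn Ω e₁ a b)
    {r s : ℝ} (hr : r ∈ Set.Ioo a b) (hs : s ∈ Set.Ioo a b) :
    Matrix.of (e r) * (Matrix.of (e₁ r))ᵀ = Matrix.of (e s) * (Matrix.of (e₁ s))ᵀ := by
  have := h.mul_mul_transpose_eq h₁ (Λ := fun _ => 1)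
    (fun t _ => by simpa using HasMatDerivAt.const (1 : Matrix (Fin 3) (Fin 3) ℝ)) hr hs
  simpa using this

lemma isOrthonormalFrame (h : IsCarriedOn Ω e a b) {r s : ℝ} (hr : r ∈ Set.Ioo a b)
    (hs : s ∈ Set.Ioo a b) (ho : IsOrthonormalFrame (e r)) : IsOrthonormalFrame (e s) := by
  rw [isOrthonormalFrame_iff] at ho ⊢
  rw [← h.mul_transpose_eq h hr hs, ho]

lemma unique (h : IsCarriedOn Ω e a b) (h₁ : IsCarriedOn Ω e₁ a b) {r s : ℝ}
    (hr : r ∈ Set.Ioo a b) (hs : s ∈ Set.Ioo a b) (ho : IsOrthonormalFrame (e r))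
    (heq : e r = e₁ r) : e s = e₁ s := by
  have h1 := h.mul_transpose_eq h₁ hr hs
  rw [← heq, (isOrthonormalFrame_iff _).1 ho] at h1
  have h2 := isOrthonormalFrame_transpose_mul (h₁.isOrthonormalFrame hr hs (heq ▸ ho))
  have h3 : Matrix.of (e s) = Matrix.of (e₁ s) := by
    rw [← mul_one (Matrix.of (e s)), ← h2, ← Matrix.mul_assoc, ← h1, one_mul]
  exact h3

end IsCarriedOn

lemma norm_cross_le (v w : Vec3) : ‖v ⨯₃ w‖ ≤ 2 * ‖v‖ * ‖w‖ := by
  have hv := norm_le_pi_norm v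
  have hw := norm_le_pi_norm w
  have key : ∀ i j k l : Fin 3, ‖v i * w j - v k * w l‖ ≤ 2 * ‖v‖ * ‖w‖ := by
    intro i j k l
    calc ‖v i * w j - v k * w l‖ ≤ ‖v i * w j‖ + ‖v k * w l‖ := norm_sub_le _ _
      _ = ‖v i‖ * ‖w j‖ + ‖v k‖ * ‖w l‖ := by rw [norm_mul, norm_mul]
      _ ≤ ‖v‖ * ‖w‖ + ‖v‖ * ‖w‖ := by
        gcongr <;> first | exact hv _ | exact hw _
      _ = 2 * ‖v‖ * ‖w‖ := by ring
  rw [pi_norm_le_iff_of_nonneg (by positivity), cross_apply]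
  intro i
  fin_cases i <;> exact key _ _ _ _

/-- A bounded Lipschitz retraction of the space of triples of vectors to the triples of unit
vectors, which does not change the directions. -/
def normalizeFrame (e : Fin 3 → Vec3) : Fin 3 → Vec3 := fun i => (2 / (1 + e i ⬝ᵥ e i)) • e i

lemma dotProduct_self_nonneg' (v : Vec3) : 0 ≤ v ⬝ᵥ v :=
  Finset.sum_nonneg fun _ _ => mul_self_nonneg _

lemma norm_normalizeFrame_le (e : Fin 3 → Vec3) : ‖normalizeFrame e‖ ≤ 1 := by
  rw [pi_norm_le_iff_of_nonneg zero_le_one]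
  intro i
  rw [pi_norm_le_iff_of_nonneg zero_le_one]
  intro j
  have h0 := dotProduct_self_nonneg' (e i)
  have h1 : e i j * e i j ≤ e i ⬝ᵥ e i :=
    Finset.single_le_sum (f := fun j => e i j * e i j) (fun _ _ => mul_self_nonneg _)
      (Finset.mem_univ j)
  rw [normalizeFrame, Pi.smul_apply, smul_eq_mul, Real.norm_eq_abs, div_mul_eq_mul_div, abs_div,
    abs_of_pos (by linarith : 0 < 1 + e i ⬝ᵥ e i), div_le_one (by linarith), abs_le]
  constructor <;> nlinarith [sq_nonneg (e i j - 1), sq_nonneg (e i j + 1)]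

lemma contDiff_normalizeFrame : ContDiff ℝ 1 normalizeFrame := by
  refine contDiff_pi.2 fun i => ?_
  have h : ContDiff ℝ 1 fun e : Fin 3 → Vec3 => 2 / (1 + e i ⬝ᵥ e i) := by
    refine contDiff_const.fun_div ?_ fun e => ?_
    · simp only [dotProduct]
      fun_prop
    · have := dotProduct_self_nonneg' (e i)
      linarith
  exact h.smul (contDiff_apply ..)

/-- Picard–Lindelöf reaches the whole interval in one step if the field is bounded. The linear field
is therefore replaced by one that agrees with it on triples of unit vectors, and the solution is
shown never to leave these. -/
lemma exists_isCarriedOn_of_continuousOn {Ω : ℝ → Vec3} {c d t₀ : ℝ}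
    (hΩ : ContinuousOn Ω (Set.Icc c d)) (ht₀ : t₀ ∈ Set.Ioo c d) {e₀ : Fin 3 → Vec3}
    (he₀ : IsOrthonormalFrame e₀) : ∃ e, e t₀ = e₀ ∧ IsCarriedOn Ω e c d := by
  obtain ⟨C, hC⟩ := (isCompact_Icc (a := c) (b := d)).exists_bound_of_continuousOn hΩ
  have hC0 : 0 ≤ C := (norm_nonneg _).trans (hC t₀ (Set.Ioo_subset_Icc_self ht₀))
  let f : ℝ → (Fin 3 → Vec3) → (Fin 3 → Vec3) := fun t e i => normalizeFrame e i ⨯₃ Ω t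
  have hcross : ∀ t ∈ Set.Icc c d, ∀ e : Fin 3 → Vec3, ‖fun i => e i ⨯₃ Ω t‖ ≤ 2 * C * ‖e‖ := by
    intro t ht e
    rw [pi_norm_le_iff_of_nonneg (by positivity)]
    intro i
    calc ‖e i ⨯₃ Ω t‖ ≤ 2 * ‖e i‖ * ‖Ω t‖ := norm_cross_le _ _
      _ ≤ 2 * ‖e‖ * C := by gcongr; exacts [norm_le_pi_norm e i, hC t ht]
      _ = 2 * C * ‖e‖ := by ring
  -- A bound of the modified field; a solution moves at most `L * T` during the whole interval,
  -- which is the radius of the ball used below.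
  let L : NNReal := ⟨2 * C, by positivity⟩
  let T : NNReal := ⟨max (d - t₀) (t₀ - c), le_max_of_le_left (by linarith [ht₀.2])⟩
  obtain ⟨K, hK⟩ := LocallyLipschitzOn.exists_lipschitzOnWith_of_compact
    (isCompact_closedBall e₀ ((L * T : NNReal) : ℝ))
    (contDiff_normalizeFrame.locallyLipschitz.locallyLipschitzOn)
  have hPL : IsPicardLindelof f (⟨t₀, Set.Ioo_subset_Icc_self ht₀⟩ : Set.Icc c d) e₀
      (L * T) 0 L (L * K) := by
    refine ⟨fun t ht => ?_, fun e _ => ?_, fun t ht e _ => ?_, ?_⟩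
    · refine LipschitzOnWith.of_dist_le_mul fun x hx y hy => ?_
      have h1 := hcross t ht (normalizeFrame x - normalizeFrame y)
      have h2 := hK.dist_le_mul x hx y hy
      rw [dist_eq_norm] at h2 ⊢
      have h3 : f t x - f t y = fun i => (normalizeFrame x - normalizeFrame y) i ⨯₃ Ω t := by
        ext1 i
        simp [f, map_sub]
      rw [h3]
      calc _ ≤ 2 * C * ‖normalizeFrame x - normalizeFrame y‖ := h1
        _ ≤ 2 * C * (K * dist x y) := by gcongr
        _ = _ := by rw [NNReal.coe_mul]; change _ = 2 * C * K * _; ring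
    · refine continuousOn_pi.2 fun i => ?_
      exact (LinearMap.continuous_of_finiteDimensional
        (crossProduct (normalizeFrame e i))).comp_continuousOn hΩ
    · have h1 := hcross t ht (normalizeFrame e)
      have h2 := norm_normalizeFrame_le e
      change ‖f t e‖ ≤ 2 * C
      calc _ ≤ 2 * C * ‖normalizeFrame e‖ := h1
        _ ≤ 2 * C * 1 := by gcongr
        _ = _ := mul_one _
    · rw [NNReal.coe_zero, sub_zero, NNReal.coe_mul]
      rfl
  obtain ⟨e, he0, he⟩ := hPL.exists_eq_forall_mem_Icc_hasDerivWithinAt₀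
  have he' : ∀ t ∈ Set.Ioo c d, ∀ i,
      HasDerivAt (fun τ => e τ i) ((2 / (1 + e t i ⬝ᵥ e t i)) • (e t i ⨯₃ Ω t)) t := by
    intro t ht i
    have := hasDerivAt_pi.1 ((he t (Set.Ioo_subset_Icc_self ht)).hasDerivAt
      (Icc_mem_nhds ht.1 ht.2)) i
    simpa [f, normalizeFrame] using this
  -- The modified velocity of each vector is still orthogonal to it, so lengths stay 1 and the
  -- factor 2 / (1 + |e_i|²) is 1 along the solution.
  have hunit : ∀ t ∈ Set.Ioo c d, ∀ i, e t i ⬝ᵥ e t i = 1 := by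
    intro t ht i
    have hd : ∀ s ∈ Set.Ioo c d, HasDerivAt (fun τ => e τ i ⬝ᵥ e τ i) 0 s := by
      intro s hs
      convert (he' s hs i).dotProduct' (he' s hs i) using 1
      rw [smul_dotProduct, dotProduct_smul, dot_self_cross,
        dotProduct_comm (e s i ⨯₃ Ω s), dot_self_cross]
      simp
    have := isOpen_Ioo.is_const_of_deriv_eq_zero isPreconnected_Ioo
      (fun τ hτ => (hd τ hτ).differentiableAt.differentiableWithinAt)
      (fun τ hτ => (hd τ hτ).deriv) ht ht₀
    rw [this]
    have he0' : e t₀ = e₀ := he0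
    rw [he0']
    simpa using he₀ i i
  refine ⟨e, he0, fun t ht i => ?_⟩
  have := he' t ht i
  rw [hunit t ht i] at this
  norm_num at this
  exact this

/-- Ω may be unbounded near the ends, so solutions on compact subintervals around t₀ and t are
glued; uniqueness makes them agree on overlaps. -/
lemma exists_isCarriedOn {Ω : ℝ → Vec3} {a b t₀ : ℝ}
    (hΩ : ContinuousOn Ω (Set.Ioo a b)) (ht₀ : t₀ ∈ Set.Ioo a b) {e₀ : Fin 3 → Vec3}
    (he₀ : IsOrthonormalFrame e₀) : ∃ e, e t₀ = e₀ ∧ IsCarriedOn Ω e a b := by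
  -- Halfway from the ends of the interval to the nearer of t and t₀: [c t, d t] is compact in (a,
  -- b) and has both t and t₀ in its interior.
  let c : ℝ → ℝ := fun t => (a + min t t₀) / 2
  let d : ℝ → ℝ := fun t => (max t t₀ + b) / 2
  have hcd : ∀ t ∈ Set.Ioo a b, a < c t ∧ c t < t ∧ c t < t₀ ∧ t < d t ∧ t₀ < d t ∧ d t < b := by
    intro t ht
    have h1 := lt_min ht.1 ht₀.1
    have h2 := max_lt ht.2 ht₀.2
    have h3 := min_le_left t t₀
    have h4 := min_le_right t t₀
    have h5 := le_max_left t t₀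
    have h6 := le_max_right t t₀
    simp only [c, d]
    refine ⟨?_, ?_, ?_, ?_, ?_, ?_⟩ <;> linarith
  have hex : ∀ t : Set.Ioo a b, ∃ e, e t₀ = e₀ ∧ IsCarriedOn Ω e (c t) (d t) := by
    rintro ⟨t, ht⟩
    obtain ⟨h1, h2, h3, h4, h5, h6⟩ := hcd t ht
    exact exists_isCarriedOn_of_continuousOn (hΩ.mono (Set.Icc_subset_Ioo h1 h6)) ⟨h3, h5⟩ he₀
  choose ε hε0 hε using hex
  classical
  let e : ℝ → Fin 3 → Vec3 := fun t => if h : t ∈ Set.Ioo a b then ε ⟨t, h⟩ t else e₀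
  refine ⟨e, ?_, fun t ht i => ?_⟩
  · simp only [e, dif_pos ht₀, hε0]
  · obtain ⟨h1, h2, h3, h4, h5, h6⟩ := hcd t ht
    have heq : ∀ s ∈ Set.Ioo (c t) (d t), e s = ε ⟨t, ht⟩ s := by
      intro s hs
      have hs' : s ∈ Set.Ioo a b := ⟨h1.trans hs.1, hs.2.trans h6⟩
      obtain ⟨g1, g2, g3, g4, g5, g6⟩ := hcd s hs'
      simp only [e, dif_pos hs']
      have A := (hε ⟨s, hs'⟩).mono (le_max_right (c t) (c s)) (min_le_right (d t) (d s))
      have B := (hε ⟨t, ht⟩).mono (le_max_left (c t) (c s)) (min_le_left (d t) (d s))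
      refine A.unique B (r := t₀) ⟨max_lt h3 g3, lt_min h5 g5⟩ ⟨max_lt hs.1 g2, lt_min hs.2 g4⟩ ?_ ?_
      · rw [hε0]; exact he₀
      · rw [hε0, hε0]
    have := hε ⟨t, ht⟩ t ⟨h2, h4⟩ i
    rw [heq t ⟨h2, h4⟩]
    refine this.congr_of_eventuallyEq ?_
    filter_upwards [Ioo_mem_nhds h2 h4] with s hs
    rw [heq s hs]

/-! ### Equivalence of the L+R system with the system for the frame -/

namespace SphericalSupport

variable {N : ℕ} (S : SphericalSupport N)

/-- Given an L+R solution, carry e₀ along Ω. The matrix MΓMᵀ is constant and equals G at t₀, and M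
is orthogonal, so Γ is the tensor of the carried frame at all times. The other direction is
differentiation of Γ. -/
theorem isLRSolution_iff (a b t₀ : ℝ) (ht₀ : t₀ ∈ Set.Ioo a b) (Ω : ℝ → Vec3)
    (Γ : ℝ → Matrix (Fin 3) (Fin 3) ℝ) (e₀ : Fin 3 → Vec3) (he₀ : IsOrthonormalFrame e₀)
    (hΓ : Γ t₀ = S.gammaTensor e₀) :
    (∀ t ∈ Set.Ioo a b, S.IsLRSolutionAt Ω Γ t) ↔
      ∃ e : ℝ → Fin 3 → Vec3, e t₀ = e₀ ∧
        ∀ t ∈ Set.Ioo a b, IsOrthonormalFrame (e t) ∧ Γ t = S.gammaTensor (e t) ∧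
          S.IsMotionAt (fun τ => (Ω τ, e τ)) t := by
  constructor
  · intro h
    have hc : ContinuousOn Ω (Set.Ioo a b) :=
      fun t ht => (h t ht).1.continuousAt.continuousWithinAt
    obtain ⟨e, he0, he⟩ := exists_isCarriedOn hc ht₀ he₀
    have ho : ∀ t ∈ Set.Ioo a b, IsOrthonormalFrame (e t) :=
      fun t ht => he.isOrthonormalFrame ht₀ ht (he0 ▸ he₀)
    have hG : ∀ t ∈ Set.Ioo a b, Γ t = S.gammaTensor (e t) := by
      intro t ht
      have h1 := he.mul_mul_transpose_eq he (Λ := Γ) (fun t ht => (h t ht).2.2) ht ht₀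
      have h2 := isOrthonormalFrame_transpose_mul (ho t ht)
      have h3 := (isOrthonormalFrame_iff _).1 he₀
      rw [hΓ, he0, gammaTensor_eq] at h1
      have h4 : Matrix.of e₀ * ((Matrix.of e₀)ᵀ * S.spaceTensor * Matrix.of e₀) * (Matrix.of e₀)ᵀ
          = S.spaceTensor := by
        calc _ = (Matrix.of e₀ * (Matrix.of e₀)ᵀ) * S.spaceTensor *
              (Matrix.of e₀ * (Matrix.of e₀)ᵀ) := by simp only [Matrix.mul_assoc]
          _ = _ := by rw [h3, one_mul, mul_one]
      rw [h4] at h1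
      rw [gammaTensor_eq, ← h1]
      calc Γ t = 1 * Γ t * 1 := by simp
        _ = _ := by rw [← h2]; simp only [Matrix.mul_assoc]
    refine ⟨e, he0, fun t ht => ⟨ho t ht, hG t ht, (h t ht).1, ?_, he t ht⟩⟩
    have h1 := (h t ht).2.1
    rw [hG t ht] at h1
    refine h1.congr_of_eventuallyEq ?_
    filter_upwards [Ioo_mem_nhds ht.1 ht.2] with s hs
    rw [hG s hs]
    rfl
  · rintro ⟨e, -, he⟩ t ht
    obtain ⟨ho, hG, hΩ, hK, hM⟩ := he t ht
    have hev : ∀ᶠ s in nhds t, Γ s = S.gammaTensor (e s) := by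
      filter_upwards [Ioo_mem_nhds ht.1 ht.2] with s hs
      exact (he s hs).2.1
    refine ⟨hΩ, ?_, fun i j => ?_⟩
    · rw [hG]
      refine hK.congr_of_eventuallyEq ?_
      filter_upwards [hev] with s hs
      rw [hs]
      rfl
    · rw [hG]
      refine (S.hasMatDerivAt_gammaTensor_of_rotation hM i j).congr_of_eventuallyEq ?_
      filter_upwards [hev] with s hs
      rw [hs]

end SphericalSupport

/-! ### Traces and directional derivatives -/

/-- Writes L as the sum of its restrictions to the factors composed with the projections, and moves
each projection to the front by cyclicity of the trace. -/
lemma trace_prod_eq {V W : Type*} [AddCommGroup V] [Module ℝ V] [AddCommGroup W] [Module ℝ W]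
    [FiniteDimensional ℝ V] [FiniteDimensional ℝ W] (L : V × W →ₗ[ℝ] V × W) :
    LinearMap.trace ℝ (V × W) L =
      LinearMap.trace ℝ V (LinearMap.fst ℝ V W ∘ₗ L ∘ₗ LinearMap.inl ℝ V W) +
      LinearMap.trace ℝ W (LinearMap.snd ℝ V W ∘ₗ L ∘ₗ LinearMap.inr ℝ V W) := by
  have h : L = (L ∘ₗ LinearMap.inl ℝ V W) ∘ₗ LinearMap.fst ℝ V W +
      (L ∘ₗ LinearMap.inr ℝ V W) ∘ₗ LinearMap.snd ℝ V W := by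
    refine LinearMap.ext fun x => ?_
    simp only [LinearMap.add_apply, LinearMap.comp_apply, ← map_add]
    simp
  conv_lhs => rw [h]
  rw [map_add, LinearMap.trace_comp_comm', LinearMap.trace_comp_comm' (LinearMap.snd ℝ V W)]

lemma trace_pi_eq {ι V : Type*} [Fintype ι] [DecidableEq ι] [AddCommGroup V] [Module ℝ V]
    [FiniteDimensional ℝ V] (L : (ι → V) →ₗ[ℝ] (ι → V)) :
    LinearMap.trace ℝ (ι → V) L =
      ∑ i, LinearMap.trace ℝ V
        (LinearMap.proj i ∘ₗ L ∘ₗ LinearMap.single ℝ (fun _ : ι => V) i) := by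
  have h : L = ∑ i, (L ∘ₗ LinearMap.single ℝ (fun _ : ι => V) i) ∘ₗ LinearMap.proj i := by
    refine LinearMap.ext fun x => ?_
    rw [LinearMap.sum_apply]
    simp only [LinearMap.comp_apply, ← map_sum]
    congr 1
    ext i
    simp [Finset.sum_apply, Pi.single_apply]
  conv_lhs => rw [h]
  rw [map_sum]
  exact Finset.sum_congr rfl fun i _ => LinearMap.trace_comp_comm' _ _

lemma hasDerivAt_line {E : Type*} [NormedAddCommGroup E] [NormedSpace ℝ E] (x w : E) :
    HasDerivAt (fun s : ℝ => x + s • w) w 0 := by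
  simpa using ((hasDerivAt_id (0 : ℝ)).smul_const w).const_add x

lemma fderiv_eq_of_hasDerivAt {E F : Type*} [NormedAddCommGroup E] [NormedSpace ℝ E]
    [NormedAddCommGroup F] [NormedSpace ℝ F] {f : E → F} {x w : E} {y : F}
    (hf : DifferentiableAt ℝ f x) (h : HasDerivAt (fun s : ℝ => f (x + s • w)) y 0) :
    fderiv ℝ f x w = y := by
  have h1 : HasFDerivAt f (fderiv ℝ f x) (x + (0 : ℝ) • w) := by simpa using hf.hasFDerivAt
  exact (h1.comp_hasDerivAt (0 : ℝ) (hasDerivAt_line x w)).unique h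

lemma HasMatDerivAt.det {A : ℝ → Matrix (Fin 3) (Fin 3) ℝ} {A' : Matrix (Fin 3) (Fin 3) ℝ} {t : ℝ}
    (hA : HasMatDerivAt A A' t) :
    HasDerivAt (fun τ => (A τ).det) ((A t).adjugate * A').trace t := by
  have h := fun i j => hA i j
  have := ((((((((h 0 0).mul (h 1 1)).mul (h 2 2)).sub (((h 0 0).mul (h 1 2)).mul (h 2 1))).sub
    (((h 0 1).mul (h 1 0)).mul (h 2 2))).add (((h 0 1).mul (h 1 2)).mul (h 2 0))).add
    (((h 0 2).mul (h 1 0)).mul (h 2 1))).sub (((h 0 2).mul (h 1 1)).mul (h 2 0)))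
  refine (this.congr_deriv ?_).congr_of_eventuallyEq (Filter.Eventually.of_forall fun τ => ?_)
  · rw [Matrix.adjugate_fin_three, Matrix.trace_fin_three]
    simp [Matrix.mul_apply, Fin.sum_univ_three]
    ring
  · simp [Matrix.det_fin_three]

lemma trace_mul_hatMatrix {B : Matrix (Fin 3) (Fin 3) ℝ} (hB : Bᵀ = B) (v : Vec3) :
    (B * hatMatrix v).trace = 0 := by
  have h : (B * hatMatrix v).trace = -(B * hatMatrix v).trace := by
    conv_lhs => rw [← Matrix.trace_transpose, Matrix.transpose_mul, transpose_hatMatrix, hB,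
      Matrix.neg_mul, Matrix.trace_neg, Matrix.trace_mul_comm]
  linarith

lemma trace_hatMatrix (v : Vec3) : (hatMatrix v).trace = 0 := by
  simpa using trace_mul_hatMatrix (B := 1) (by simp) v

namespace SphericalSupport

variable {N : ℕ} (S : SphericalSupport N)

/-! ### Smoothness -/

lemma contDiff_totalInertia_apply (i j : Fin 3) :
    ContDiff ℝ ∞ fun x : SupportState => S.totalInertia x.2 i j := by
  simp only [totalInertia, gammaTensor_eq, Matrix.add_apply, Matrix.mul_apply,
    Matrix.transpose_apply, Matrix.of_apply]
  fun_prop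

lemma contDiff_det : ContDiff ℝ ∞ fun x : SupportState => (S.totalInertia x.2).det := by
  have := S.contDiff_totalInertia_apply
  simp only [Matrix.det_fin_three]
  fun_prop

lemma isOpen_domain : IsOpen S.domain :=
  isOpen_lt continuous_const S.contDiff_det.continuous

lemma contDiff_adjugate_apply (i j : Fin 3) :
    ContDiff ℝ ∞ fun x : SupportState => (S.totalInertia x.2).adjugate i j := by
  have := S.contDiff_totalInertia_apply
  simp only [Matrix.adjugate_fin_three]
  fin_cases i <;> fin_cases j <;> simp <;> fun_prop

lemma contDiff_angMomentum : ContDiff ℝ ∞ S.angMomentum := by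
  have := S.contDiff_totalInertia_apply
  refine contDiff_pi.2 fun i => ?_
  simp only [angMomentum, Matrix.mulVec, dotProduct]
  fun_prop

lemma contDiff_dotProduct {E n : Type*} [Fintype n] [NormedAddCommGroup E] [NormedSpace ℝ E]
    {f g : E → n → ℝ} (hf : ContDiff ℝ ∞ f) (hg : ContDiff ℝ ∞ g) :
    ContDiff ℝ ∞ fun x => f x ⬝ᵥ g x := by
  simp only [dotProduct]
  fun_prop

lemma contDiff_momentumIntegral (i : Fin 4) : ContDiff ℝ ∞ (S.momentumIntegral i) := by
  have h := S.contDiff_angMomentum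
  refine Fin.cases ?_ (fun l => ?_) i
  · exact contDiff_dotProduct h h
  · exact contDiff_dotProduct (f := S.angMomentum) (g := fun x => x.2 l) h (by fun_prop)

lemma contDiff_energy : ContDiff ℝ ∞ S.energy :=
  contDiff_const.mul (contDiff_dotProduct contDiff_fst S.contDiff_angMomentum)

lemma contDiff_dynamicIntegrals (j : Fin 4) (o : Option {i : Fin 4 // i ≠ j}) :
    ContDiff ℝ ∞ (S.dynamicIntegrals j o) := by
  cases o with
  | none => exact S.contDiff_energy
  | some i => exact S.contDiff_momentumIntegral i

lemma contDiff_integrals (j : Fin 4) (o : IntegralIndex j) : ContDiff ℝ ∞ (S.integrals j o) := by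
  cases o with
  | inl p =>
    exact contDiff_dotProduct (f := fun x : SupportState => x.2 p.1.1)
      (g := fun x : SupportState => x.2 p.1.2) (by fun_prop) (by fun_prop)
  | inr o => exact S.contDiff_dynamicIntegrals j o

lemma contDiff_cross {E : Type*} [NormedAddCommGroup E] [NormedSpace ℝ E]
    {f g : E → Vec3} (hf : ContDiff ℝ ∞ f) (hg : ContDiff ℝ ∞ g) :
    ContDiff ℝ ∞ fun x => f x ⨯₃ g x := by
  refine contDiff_pi.2 fun i => ?_
  simp only [cross_apply]
  fin_cases i <;> simp <;> fun_prop

lemma contDiff_mulVec {E : Type*} [NormedAddCommGroup E] [NormedSpace ℝ E]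
    (A : Matrix (Fin 3) (Fin 3) ℝ) {f : E → Vec3} (hf : ContDiff ℝ ∞ f) :
    ContDiff ℝ ∞ fun x => A *ᵥ f x := by
  refine contDiff_pi.2 fun i => ?_
  simp only [Matrix.mulVec, dotProduct]
  fun_prop

lemma contDiffOn_field : ContDiffOn ℝ ∞ S.field S.domain := by
  have h1 : ContDiff ℝ ∞ fun x : SupportState =>
      (S.totalInertia x.2).adjugate *ᵥ ((S.inertia *ᵥ x.1) ⨯₃ x.1) := by
    have h2 := contDiff_cross (contDiff_mulVec S.inertia (contDiff_fst (𝕜 := ℝ) (n := ∞)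
      (E := Vec3) (F := Fin 3 → Vec3))) contDiff_fst
    have h3 := S.contDiff_adjugate_apply
    refine contDiff_pi.2 fun i => ?_
    simp only [Matrix.mulVec, dotProduct] at h2 ⊢
    have h4 := fun j => contDiff_pi.1 h2 j
    exact ContDiff.sum fun j _ => (h3 i j).mul (h4 j)
  have h5 : ContDiffOn ℝ ∞ (fun x : SupportState => ((S.totalInertia x.2).det)⁻¹) S.domain :=
    S.contDiff_det.contDiffOn.inv fun _ hx => ne_of_gt hx
  refine ContDiffOn.prodMk ?_ ?_
  · refine (h5.smul h1.contDiffOn).congr fun x hx => ?_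
    simp [Matrix.inv_def, Matrix.smul_mulVec]
  · refine (contDiff_pi.2 fun i => ?_).contDiffOn
    exact contDiff_cross (f := fun x : SupportState => x.2 i) (by fun_prop) contDiff_fst

lemma differentiableAt_field {x : SupportState} (hx : x ∈ S.domain) :
    DifferentiableAt ℝ S.field x :=
  (S.contDiffOn_field.contDiffAt (S.isOpen_domain.mem_nhds hx)).differentiableAt (by simp)

lemma contDiffOn_density : ContDiffOn ℝ ∞ S.density S.domain :=
  S.contDiff_det.contDiffOn.sqrt fun _ hx => ne_of_gt hx

lemma density_pos {x : SupportState} (hx : x ∈ S.domain) : 0 < S.density x :=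
  Real.sqrt_pos.2 hx

/-! ### First integrals -/

lemma hasDerivAt_momentumIntegral_of_isMotionAt {x : ℝ → SupportState} {t : ℝ}
    (h : S.IsMotionAt x t) (i : Fin 4) :
    HasDerivAt (fun τ => S.momentumIntegral i (x τ)) 0 t := by
  obtain ⟨-, hK, he⟩ := h
  have key : ∀ u v w : Vec3, (u ⨯₃ w) ⬝ᵥ v + u ⬝ᵥ (v ⨯₃ w) = 0 := by
    intro u v w
    simp [cross_apply, dotProduct, Fin.sum_univ_three]
    ring
  refine Fin.cases ?_ (fun l => ?_) i
  · exact (hK.dotProduct' hK).congr_deriv (key _ _ _)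
  · exact (hK.dotProduct' (he l)).congr_deriv (key _ _ _)

lemma hasDerivAt_frame_of_isMotionAt {x : ℝ → SupportState} {t : ℝ}
    (h : S.IsMotionAt x t) (i l : Fin 3) :
    HasDerivAt (fun τ => (x τ).2 i ⬝ᵥ (x τ).2 l) 0 t := by
  have key : ∀ u v w : Vec3, (u ⨯₃ w) ⬝ᵥ v + u ⬝ᵥ (v ⨯₃ w) = 0 := by
    intro u v w
    simp [cross_apply, dotProduct, Fin.sum_univ_three]
    ring
  exact ((h.2.2 i).dotProduct' (h.2.2 l)).congr_deriv (key _ _ _)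

lemma mulVec_dotProduct_comm {A : Matrix (Fin 3) (Fin 3) ℝ} (hA : Aᵀ = A) (u v : Vec3) :
    (A *ᵥ u) ⬝ᵥ v = u ⬝ᵥ (A *ᵥ v) := by
  rw [Matrix.dotProduct_mulVec, ← Matrix.mulVec_transpose, hA]

lemma hasDerivAt_energy_of_isMotionAt {x : ℝ → SupportState} {t : ℝ} (hx : x t ∈ S.domain)
    (h : S.IsMotionAt x t) : HasDerivAt (fun τ => S.energy (x τ)) 0 t := by
  have h1 : HasDerivAt (fun τ => (x τ).1) (S.field (x t)).1 t :=
    (ContinuousLinearMap.fst ℝ Vec3 (Fin 3 → Vec3)).hasFDerivAt.comp_hasDerivAt t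
      ((S.isMotionAt_iff x t hx).1 h)
  refine ((h1.dotProduct' h.2.1).const_mul (1 / 2)).congr_deriv ?_
  rw [dot_cross_self, angMomentum, ← mulVec_dotProduct_comm (S.totalInertia_transpose _),
    S.totalInertia_mulVec_field hx, dotProduct_comm, dot_cross_self]
  simp

lemma hasDerivAt_integrals_of_isMotionAt {x : ℝ → SupportState} {t : ℝ} (hx : x t ∈ S.domain)
    (h : S.IsMotionAt x t) (j : Fin 4) (o : IntegralIndex j) :
    HasDerivAt (fun τ => S.integrals j o (x τ)) 0 t := by
  rcases o with p | _ | i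
  · exact S.hasDerivAt_frame_of_isMotionAt h _ _
  · exact S.hasDerivAt_energy_of_isMotionAt hx h
  · exact S.hasDerivAt_momentumIntegral_of_isMotionAt h _

lemma isFirstIntegralOn_integrals (j : Fin 4) (o : IntegralIndex j) :
    IsFirstIntegralOn S.domain S.field (S.integrals j o) := by
  refine ⟨(S.contDiff_integrals j o).contDiffOn, fun x hx => ?_⟩
  refine fderiv_eq_of_hasDerivAt
    ((S.contDiff_integrals j o).differentiable (by simp) x) ?_
  have h0 : x + (0 : ℝ) • S.field x = x := by simp
  -- No solution curve is needed: the conservation laws hold at a single time, and the straight line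
  -- with velocity f(x) satisfies the equations of motion at time 0.
  refine S.hasDerivAt_integrals_of_isMotionAt (x := fun s => x + s • S.field x)
    (by simpa using hx) ?_ j o
  rw [S.isMotionAt_iff _ _ (by simpa using hx)]
  simpa using hasDerivAt_line x (S.field x)

/-! ### The invariant measure -/

lemma fderiv_det_field {x : SupportState} :
    fderiv ℝ (fun x : SupportState => (S.totalInertia x.2).det) x (S.field x) =
      ((S.totalInertia x.2).adjugate *
        (S.gammaTensor x.2 * hatMatrix x.1 - hatMatrix x.1 * S.gammaTensor x.2)).trace := by
  refine fderiv_eq_of_hasDerivAt (S.contDiff_det.differentiable (by simp) x) ?_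
  have h1 : ∀ i, HasDerivAt (fun s : ℝ => (x + s • S.field x).2 i) (x.2 i ⨯₃ x.1) 0 := by
    intro i
    exact hasDerivAt_pi.1 ((ContinuousLinearMap.snd ℝ Vec3 (Fin 3 → Vec3)).hasFDerivAt.comp_hasDerivAt
      (0 : ℝ) (hasDerivAt_line x (S.field x))) i
  have h2 := (HasMatDerivAt.const S.inertia (t := 0)).add
    (S.hasMatDerivAt_gammaTensor_of_rotation
      (e := fun s : ℝ => (x + s • S.field x).2) (Ω := x.1) (t := 0) (by simpa using h1))
  have h3 := h2.det
  simp only [zero_smul, add_zero, zero_add] at h3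
  exact h3

/-- Each frame vector contributes the block -ω, of trace zero, so only the derivative of Ω' with
respect to Ω remains. -/
lemma divergence_field {x : SupportState} (hx : x ∈ S.domain) :
    divergence S.field x = ((S.totalInertia x.2)⁻¹ *
      (hatMatrix (S.inertia *ᵥ x.1) - hatMatrix x.1 * S.inertia)).trace := by
  have hd := S.differentiableAt_field hx
  have h1 : LinearMap.fst ℝ Vec3 (Fin 3 → Vec3) ∘ₗ (fderiv ℝ S.field x : _ →ₗ[ℝ] _) ∘ₗ
      LinearMap.inl ℝ Vec3 (Fin 3 → Vec3) = Matrix.toLin' ((S.totalInertia x.2)⁻¹ *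
      (hatMatrix (S.inertia *ᵥ x.1) - hatMatrix x.1 * S.inertia)) := by
    refine LinearMap.ext fun v => ?_
    have h := (ContinuousLinearMap.fst ℝ Vec3 (Fin 3 → Vec3)).hasFDerivAt.comp_hasDerivAt (0 : ℝ)
      ((show HasFDerivAt S.field _ (x + (0 : ℝ) • ((v, 0) : SupportState)) by
        simpa using hd.hasFDerivAt).comp_hasDerivAt (0 : ℝ) (hasDerivAt_line x (v, 0)))
    refine h.unique ?_
    have h2 : HasDerivAt (fun s : ℝ => (S.inertia *ᵥ (x.1 + s • v)) ⨯₃ (x.1 + s • v))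
        ((S.inertia *ᵥ x.1) ⨯₃ v + (S.inertia *ᵥ v) ⨯₃ x.1) 0 := by
      have h3 : (fun s : ℝ => (S.inertia *ᵥ (x.1 + s • v)) ⨯₃ (x.1 + s • v)) = fun s =>
          (S.inertia *ᵥ x.1) ⨯₃ x.1 + s • ((S.inertia *ᵥ x.1) ⨯₃ v + (S.inertia *ᵥ v) ⨯₃ x.1) +
            (s * s) • ((S.inertia *ᵥ v) ⨯₃ v) := by
        funext s
        simp only [Matrix.mulVec_add, Matrix.mulVec_smul, map_add, map_smul, LinearMap.add_apply,
          LinearMap.smul_apply]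
        module
      rw [h3]
      exact ((hasDerivAt_line ((S.inertia *ᵥ x.1) ⨯₃ x.1)
        ((S.inertia *ᵥ x.1) ⨯₃ v + (S.inertia *ᵥ v) ⨯₃ x.1)).fun_add
        (((hasDerivAt_id' (0 : ℝ)).fun_mul (hasDerivAt_id' (0 : ℝ))).smul_const
          ((S.inertia *ᵥ v) ⨯₃ v))).congr_deriv (by simp)
    have h4 := (HasMatDerivAt.const (S.totalInertia x.2)⁻¹ (t := 0)).mulVec h2
    rw [Matrix.zero_mulVec, zero_add] at h4
    refine (h4.congr_deriv ?_).congr_of_eventuallyEq (Filter.Eventually.of_forall fun s => ?_)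
    · rw [Matrix.toLin'_apply, ← Matrix.mulVec_mulVec, Matrix.sub_mulVec, hatMatrix_mulVec,
        ← Matrix.mulVec_mulVec, hatMatrix_mulVec, ← cross_anticomm x.1, sub_eq_add_neg]
    · simp [field]
  have h2 : ∀ i, LinearMap.proj i ∘ₗ (LinearMap.snd ℝ Vec3 (Fin 3 → Vec3) ∘ₗ
      (fderiv ℝ S.field x : _ →ₗ[ℝ] _) ∘ₗ LinearMap.inr ℝ Vec3 (Fin 3 → Vec3)) ∘ₗ
      LinearMap.single ℝ (fun _ : Fin 3 => Vec3) i = Matrix.toLin' (-hatMatrix x.1) := by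
    intro i
    refine LinearMap.ext fun v => ?_
    have h := hasDerivAt_pi.1 ((ContinuousLinearMap.snd ℝ Vec3 (Fin 3 → Vec3)).hasFDerivAt.comp_hasDerivAt (0 : ℝ)
      ((show HasFDerivAt S.field _ (x + (0 : ℝ) • ((0, Pi.single i v) : SupportState)) by
        simpa using hd.hasFDerivAt).comp_hasDerivAt (0 : ℝ) (hasDerivAt_line x (0, Pi.single i v)))) i
    refine h.unique ?_
    refine ((hasDerivAt_line (x.2 i ⨯₃ x.1) (v ⨯₃ x.1)).congr_deriv ?_).congr_of_eventuallyEq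
      (Filter.Eventually.of_forall fun s => ?_)
    · rw [Matrix.toLin'_apply, Matrix.neg_mulVec, hatMatrix_mulVec, cross_anticomm]
    · simp [field]
  rw [divergence, trace_prod_eq, h1, Matrix.trace_toLin'_eq, trace_pi_eq (V := Vec3)]
  simp only [h2, Matrix.trace_toLin'_eq, Matrix.trace_neg, trace_hatMatrix]
  simp

lemma divergence_smul {E : Type*} [NormedAddCommGroup E] [NormedSpace ℝ E] [FiniteDimensional ℝ E]
    {μ : E → ℝ} {f : E → E} {x : E} (hμ : DifferentiableAt ℝ μ x) (hf : DifferentiableAt ℝ f x) :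
    divergence (fun y => μ y • f y) x = μ x * divergence f x + fderiv ℝ μ x (f x) := by
  have h : fderiv ℝ (fun y => μ y • f y) x = μ x • fderiv ℝ f x + (fderiv ℝ μ x).smulRight (f x) :=
    (hμ.hasFDerivAt.smul hf.hasFDerivAt).fderiv
  rw [divergence, divergence, h, ContinuousLinearMap.toLinearMap_add, map_add,
    ContinuousLinearMap.toLinearMap_smul, map_smul, smul_eq_mul]
  congr 1
  exact LinearMap.trace_smulRight (R := ℝ) _ _

/-- Let B = (ℐ + Γ)⁻¹. As B is symmetric, tr(B · antisymmetric) = 0 and div f = -tr(Bωℐ). Half the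
derivative of log det along the flow is tr(B[Γ, ω])/2 = -tr(BωΓ). The two add up to -tr(Bω(ℐ + Γ)) =
-tr ω = 0. -/
lemma isInvariantDensityOn_density : IsInvariantDensityOn S.domain S.field S.density := by
  refine ⟨S.contDiffOn_density, fun x => S.density_pos, fun x hx => ?_⟩
  have hdet : 0 < (S.totalInertia x.2).det := hx
  have hd1 : DifferentiableAt ℝ (fun x : SupportState => (S.totalInertia x.2).det) x :=
    S.contDiff_det.differentiable (by simp) x
  have hs : HasFDerivAt S.density _ x := hd1.hasFDerivAt.sqrt hdet.ne'
  rw [divergence_smul hs.differentiableAt (S.differentiableAt_field hx), hs.fderiv,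
    S.divergence_field hx, smul_apply, S.fderiv_det_field, smul_eq_mul]
  have hadj : (S.totalInertia x.2).adjugate =
      (S.totalInertia x.2).det • (S.totalInertia x.2)⁻¹ := by
    rw [Matrix.inv_def, smul_smul, Ring.mul_inverse_cancel _ (S.isUnit_det_of_mem_domain hx), one_smul]
  have hAB : S.totalInertia x.2 * (S.totalInertia x.2)⁻¹ = 1 :=
    Matrix.mul_nonsing_inv _ (S.isUnit_det_of_mem_domain hx)
  have hB : ((S.totalInertia x.2)⁻¹)ᵀ = (S.totalInertia x.2)⁻¹ := by
    rw [Matrix.transpose_nonsing_inv, S.totalInertia_transpose]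
  have hA : S.totalInertia x.2 = S.inertia + S.gammaTensor x.2 := rfl
  rw [hadj]
  have hΓ := S.gammaTensor_transpose x.2
  have hμ : S.density x * S.density x = (S.totalInertia x.2).det := Real.mul_self_sqrt hdet.le
  have hμ' : √(S.totalInertia x.2).det = S.density x := rfl
  have hμ0 := S.density_pos hx
  rw [hμ']
  generalize hBB : (S.totalInertia x.2)⁻¹ = B at *
  generalize S.gammaTensor x.2 = Γ at *
  have e1 : (B * (hatMatrix (S.inertia *ᵥ x.1) - hatMatrix x.1 * S.inertia)).trace =
      -(B * hatMatrix x.1 * S.inertia).trace := by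
    rw [Matrix.mul_sub, Matrix.trace_sub, trace_mul_hatMatrix hB, zero_sub, Matrix.mul_assoc]
  have e2 : (B * (Γ * hatMatrix x.1)).trace = -(B * hatMatrix x.1 * Γ).trace := by
    rw [← Matrix.trace_transpose, Matrix.transpose_mul, Matrix.transpose_mul, hB, hΓ,
      transpose_hatMatrix, Matrix.neg_mul, Matrix.neg_mul, Matrix.trace_neg, Matrix.trace_mul_comm,
      Matrix.mul_assoc]
  have e3 : (B * hatMatrix x.1 * S.inertia).trace + (B * hatMatrix x.1 * Γ).trace = 0 := by
    rw [← Matrix.trace_add, ← Matrix.mul_add, ← hA, Matrix.mul_assoc, Matrix.trace_mul_comm,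
      Matrix.mul_assoc, hAB, Matrix.mul_one, trace_hatMatrix]
  rw [e1, Matrix.smul_mul, Matrix.trace_smul, Matrix.mul_sub, Matrix.trace_sub, e2, smul_eq_mul, ← hμ,
    ← Matrix.mul_assoc B (hatMatrix x.1) Γ]
  field_simp
  linear_combination (-2 * S.density x) * e3

end SphericalSupport

/-! ### Independence of the differentials of the ten integrals -/

lemma IsOrthonormalFrame.sum_dotProduct_smul {e : Fin 3 → Vec3} (he : IsOrthonormalFrame e)
    (v : Vec3) : ∑ l, (e l ⬝ᵥ v) • e l = v := by
  have h : (Matrix.of e)ᵀ *ᵥ (Matrix.of e *ᵥ v) = v := by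
    rw [Matrix.mulVec_mulVec, isOrthonormalFrame_transpose_mul he, Matrix.one_mulVec]
  conv_rhs => rw [← h]
  ext i
  simp only [Finset.sum_apply, Pi.smul_apply, smul_eq_mul, Matrix.mulVec, dotProduct,
    Matrix.transpose_apply, Matrix.of_apply]
  exact Finset.sum_congr rfl fun _ _ => mul_comm _ _

lemma IsOrthonormalFrame.sum_mul_dotProduct {e : Fin 3 → Vec3} (he : IsOrthonormalFrame e)
    (v u : Vec3) : ∑ l, (e l ⬝ᵥ v) * (e l ⬝ᵥ u) = v ⬝ᵥ u := by
  conv_rhs => rw [← he.sum_dotProduct_smul v, sum_dotProduct]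
  simp [smul_dotProduct]

namespace SphericalSupport

variable {N : ℕ} (S : SphericalSupport N)

/-- The derivative of `K` in the direction `v`. -/
def angMomentumDeriv (x v : SupportState) : Vec3 :=
  ((Matrix.of v.2)ᵀ * S.spaceTensor * Matrix.of x.2 +
    (Matrix.of x.2)ᵀ * S.spaceTensor * Matrix.of v.2) *ᵥ x.1 + S.totalInertia x.2 *ᵥ v.1

lemma hasDerivAt_line_fst (x v : SupportState) :
    HasDerivAt (fun s : ℝ => (x + s • v).1) v.1 0 :=
  (ContinuousLinearMap.fst ℝ Vec3 (Fin 3 → Vec3)).hasFDerivAt.comp_hasDerivAt (0 : ℝ)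
    (hasDerivAt_line x v)

lemma hasDerivAt_line_snd (x v : SupportState) (i : Fin 3) :
    HasDerivAt (fun s : ℝ => (x + s • v).2 i) (v.2 i) 0 :=
  hasDerivAt_pi.1 ((ContinuousLinearMap.snd ℝ Vec3 (Fin 3 → Vec3)).hasFDerivAt.comp_hasDerivAt
    (0 : ℝ) (hasDerivAt_line x v)) i

lemma hasDerivAt_line_angMomentum (x v : SupportState) :
    HasDerivAt (fun s : ℝ => S.angMomentum (x + s • v)) (S.angMomentumDeriv x v) 0 := by
  have := S.hasDerivAt_angMomentum (x := fun s : ℝ => x + s • v) (hasDerivAt_line_fst x v)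
    (hasDerivAt_line_snd x v)
  simpa [angMomentumDeriv] using this

lemma fderiv_momentumIntegral_zero (x v : SupportState) :
    fderiv ℝ (S.momentumIntegral 0) x v = 2 * (S.angMomentum x ⬝ᵥ S.angMomentumDeriv x v) := by
  refine fderiv_eq_of_hasDerivAt ((S.contDiff_momentumIntegral 0).differentiable (by simp) x) ?_
  have h := S.hasDerivAt_line_angMomentum x v
  refine (h.dotProduct' h).congr_deriv ?_
  rw [zero_smul, add_zero, dotProduct_comm]
  ring

lemma fderiv_momentumIntegral_succ (x v : SupportState) (l : Fin 3) :
    fderiv ℝ (S.momentumIntegral l.succ) x v =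
      x.2 l ⬝ᵥ S.angMomentumDeriv x v + v.2 l ⬝ᵥ S.angMomentum x := by
  refine fderiv_eq_of_hasDerivAt ((S.contDiff_momentumIntegral _).differentiable (by simp) x) ?_
  refine ((S.hasDerivAt_line_angMomentum x v).dotProduct' (hasDerivAt_line_snd x v l)).congr_deriv ?_
  rw [zero_smul, add_zero, dotProduct_comm, dotProduct_comm (v.2 l)]

lemma fderiv_frame (x v : SupportState) (i l : Fin 3) :
    fderiv ℝ (fun x : SupportState => x.2 i ⬝ᵥ x.2 l) x v = v.2 i ⬝ᵥ x.2 l + v.2 l ⬝ᵥ x.2 i := by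
  have hc : ContDiff ℝ ∞ fun x : SupportState => x.2 i ⬝ᵥ x.2 l :=
    contDiff_dotProduct (f := fun x : SupportState => x.2 i)
      (g := fun x : SupportState => x.2 l) (by fun_prop) (by fun_prop)
  refine fderiv_eq_of_hasDerivAt (hc.differentiable (by simp) x) ?_
  refine ((hasDerivAt_line_snd x v i).dotProduct' (hasDerivAt_line_snd x v l)).congr_deriv ?_
  rw [zero_smul, add_zero, dotProduct_comm (x.2 i)]

/-- The components of the angular velocity in the frame fixed in space. -/
def spaceVelocity (x : SupportState) : Vec3 := Matrix.of x.2 *ᵥ x.1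

lemma dotProduct_angMomentumDeriv (x v : SupportState) :
    x.1 ⬝ᵥ S.angMomentumDeriv x v =
      2 * ∑ l, (S.spaceTensor *ᵥ spaceVelocity x) l * (v.2 l ⬝ᵥ x.1) + v.1 ⬝ᵥ S.angMomentum x := by
  have h1 : ∀ A : Matrix (Fin 3) (Fin 3) ℝ, x.1 ⬝ᵥ (Aᵀ *ᵥ x.1) = x.1 ⬝ᵥ (A *ᵥ x.1) := by
    intro A
    rw [Matrix.dotProduct_mulVec, Matrix.vecMul_transpose, dotProduct_comm]
  have h2 : (Matrix.of v.2)ᵀ * S.spaceTensor * Matrix.of x.2 =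
      ((Matrix.of x.2)ᵀ * S.spaceTensor * Matrix.of v.2)ᵀ := by
    simp [Matrix.transpose_mul, spaceTensor_transpose, Matrix.mul_assoc]
  rw [angMomentumDeriv, Matrix.add_mulVec, dotProduct_add, dotProduct_add, angMomentum,
    ← mulVec_dotProduct_comm (S.totalInertia_transpose x.2), dotProduct_comm v.1, h2, h1, ← two_mul]
  congr 2
  rw [← h1, ← h2, Matrix.mul_assoc, ← Matrix.mulVec_mulVec, Matrix.dotProduct_mulVec,
    ← Matrix.mulVec_transpose, Matrix.transpose_transpose, ← Matrix.mulVec_mulVec, dotProduct_comm]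
  rfl

lemma fderiv_energy (x v : SupportState) :
    fderiv ℝ S.energy x v = v.1 ⬝ᵥ S.angMomentum x +
      ∑ l, (S.spaceTensor *ᵥ spaceVelocity x) l * (v.2 l ⬝ᵥ x.1) := by
  refine fderiv_eq_of_hasDerivAt (S.contDiff_energy.differentiable (by simp) x) ?_
  refine (((hasDerivAt_line_fst x v).dotProduct'
    (S.hasDerivAt_line_angMomentum x v)).const_mul (1 / 2)).congr_deriv ?_
  rw [zero_smul, add_zero, dotProduct_angMomentumDeriv]
  ring

/-- The components of `K` in the frame fixed in space. -/
def spaceMomentum (x : SupportState) : Vec3 := Matrix.of x.2 *ᵥ S.angMomentum x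

lemma spaceMomentum_apply (x : SupportState) (l : Fin 3) :
    S.spaceMomentum x l = x.2 l ⬝ᵥ S.angMomentum x := rfl

lemma spaceVelocity_apply (x : SupportState) (l : Fin 3) : spaceVelocity x l = x.2 l ⬝ᵥ x.1 := rfl

lemma momentumIntegral_succ (x : SupportState) (l : Fin 3) :
    S.momentumIntegral l.succ x = S.spaceMomentum x l := by
  rw [spaceMomentum_apply, dotProduct_comm]
  rfl

lemma momentumIntegral_zero {x : SupportState} (hx : x ∈ phaseSpace) :
    S.momentumIntegral 0 x = S.spaceMomentum x ⬝ᵥ S.spaceMomentum x :=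
  (IsOrthonormalFrame.sum_mul_dotProduct hx _ _).symm

lemma energy_eq {x : SupportState} (hx : x ∈ phaseSpace) :
    S.energy x = (1 / 2) * (spaceVelocity x ⬝ᵥ S.spaceMomentum x) := by
  rw [energy, ← IsOrthonormalFrame.sum_mul_dotProduct hx]
  rfl

/-- The components of `ℐ Ω` in the frame fixed in space. -/
def spaceInertia (x : SupportState) : Vec3 := Matrix.of x.2 *ᵥ (S.inertia *ᵥ x.1)

lemma spaceMomentum_eq {x : SupportState} (hx : x ∈ phaseSpace) :
    S.spaceMomentum x = S.spaceInertia x + S.spaceTensor *ᵥ spaceVelocity x := by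
  rw [spaceMomentum, angMomentum_eq, Matrix.mulVec_add, gammaTensor_eq, ← Matrix.mulVec_mulVec,
    ← Matrix.mulVec_mulVec, Matrix.mulVec_mulVec _ _ (Matrix.of x.2)ᵀ, (isOrthonormalFrame_iff _).1 hx,
    Matrix.one_mulVec]
  rfl

/-- (K, K) is the sum of the squares (K, e_l)² only for orthonormal frames. Nearby the inverse Gram
matrix of the frame enters, and its first variation gives the double sum. -/
lemma fderiv_momentumIntegral_zero_eq {x : SupportState} (hx : x ∈ phaseSpace) :
    fderiv ℝ (S.momentumIntegral 0) x =
      ∑ l : Fin 3, (2 * S.spaceMomentum x l) • fderiv ℝ (S.momentumIntegral l.succ) x -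
      ∑ i, ∑ l, (S.spaceMomentum x i * S.spaceMomentum x l) •
        fderiv ℝ (fun x : SupportState => x.2 i ⬝ᵥ x.2 l) x := by
  refine ContinuousLinearMap.ext fun v => ?_
  have h1 : ∀ l, v.2 l ⬝ᵥ S.angMomentum x = ∑ i, S.spaceMomentum x i * (v.2 l ⬝ᵥ x.2 i) := by
    intro l
    conv_lhs => rw [← IsOrthonormalFrame.sum_dotProduct_smul hx (S.angMomentum x), dotProduct_sum]
    simp [dotProduct_smul, spaceMomentum_apply]
  have h2 := IsOrthonormalFrame.sum_mul_dotProduct hx (S.angMomentum x) (S.angMomentumDeriv x v)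
  simp only [_root_.sub_apply, _root_.sum_apply, _root_.smul_apply, fderiv_momentumIntegral_zero,
    fderiv_momentumIntegral_succ, fderiv_frame, smul_eq_mul, h1, ← h2, ← spaceMomentum_apply]
  simp only [Fin.sum_univ_three]
  ring

/-- The matrix `w_i k_l + (G w)_i w_l`. -/
def relationMatrix (x : SupportState) (i l : Fin 3) : ℝ :=
  spaceVelocity x i * S.spaceMomentum x l + (S.spaceTensor *ᵥ spaceVelocity x) i * spaceVelocity x l

/-- Expanding Ω in the frame expresses Ω · dK by the differentials of (K, e_l). The remainder is
linear in the products v_i · e_l; its symmetric part is a combination of the d(e_i · e_l), so only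
its antisymmetric part can make dE independent of the others. -/
lemma fderiv_energy_eq {x : SupportState} (hx : x ∈ phaseSpace) (v : SupportState) :
    fderiv ℝ S.energy x v =
      ∑ l : Fin 3, spaceVelocity x l * fderiv ℝ (S.momentumIntegral l.succ) x v -
      ∑ i, ∑ l, S.relationMatrix x i l * (v.2 i ⬝ᵥ x.2 l) := by
  have h1 : ∀ u w : Vec3, u ⬝ᵥ w = ∑ i, (x.2 i ⬝ᵥ w) * (u ⬝ᵥ x.2 i) := by
    intro u w
    conv_lhs => rw [← IsOrthonormalFrame.sum_dotProduct_smul hx w, dotProduct_sum]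
    simp [dotProduct_smul]
  have h2 := IsOrthonormalFrame.sum_mul_dotProduct hx x.1 (S.angMomentumDeriv x v)
  rw [dotProduct_angMomentumDeriv] at h2
  have h3 : v.1 ⬝ᵥ S.angMomentum x = ∑ l, (x.2 l ⬝ᵥ x.1) * (x.2 l ⬝ᵥ S.angMomentumDeriv x v) -
    2 * ∑ l, (S.spaceTensor *ᵥ spaceVelocity x) l * (v.2 l ⬝ᵥ x.1) := by rw [h2]; ring
  have h4 := fun l => h1 (v.2 l) x.1
  have h5 := fun l => h1 (v.2 l) (S.angMomentum x)
  simp only [fderiv_energy, fderiv_momentumIntegral_succ, h3, relationMatrix, h4, h5]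
  simp only [← spaceMomentum_apply, ← spaceVelocity_apply, Fin.sum_univ_three]
  ring

lemma cross_eq_zero_iff_forall {u v : Vec3} : u ⨯₃ v = 0 ↔ ∀ i l, u i * v l = u l * v i := by
  rw [cross_apply]
  constructor
  · intro h
    have h0 := congrFun h 0
    have h1 := congrFun h 1
    have h2 := congrFun h 2
    simp at h0 h1 h2
    intro i l
    fin_cases i <;> fin_cases l <;> simp <;> linarith
  · intro h
    ext i
    fin_cases i <;> simp [h 1 2, h 2 0, h 0 1]

lemma mulVec_cross_eq_zero_iff {M : Matrix (Fin 3) (Fin 3) ℝ} (hM : IsUnit M.det) {u v : Vec3} :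
    (M *ᵥ u) ⨯₃ (M *ᵥ v) = 0 ↔ u ⨯₃ v = 0 := by
  have key : ∀ (A : Matrix (Fin 3) (Fin 3) ℝ) {u v : Vec3}, u ⨯₃ v = 0 →
      (A *ᵥ u) ⨯₃ (A *ᵥ v) = 0 := by
    intro A u v h
    rw [cross_eq_zero_iff_forall] at h ⊢
    intro i l
    simp only [Matrix.mulVec, dotProduct, Finset.sum_mul_sum]
    rw [Finset.sum_comm]
    refine Finset.sum_congr rfl fun a _ => Finset.sum_congr rfl fun b _ => ?_
    linear_combination A i b * A l a * h b a
  refine ⟨fun h => ?_, key M⟩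
  have := key M⁻¹ h
  simpa [Matrix.mulVec_mulVec, Matrix.nonsing_inv_mul _ hM] using this

lemma isUnit_det_of_isOrthonormalFrame {e : Fin 3 → Vec3} (he : IsOrthonormalFrame e) :
    IsUnit (Matrix.of e).det :=
  Matrix.isUnit_det_of_right_inverse ((isOrthonormalFrame_iff e).1 he)

/-- After substituting k = ℐΩ + Gw in space components, the terms with G are symmetric. The
antisymmetric part of w ⊗ ℐΩ is what remains, and it vanishes exactly when the two vectors are
parallel. -/
lemma relationMatrix_symm_iff {x : SupportState} (hx : x ∈ phaseSpace) :
    (∀ i l, S.relationMatrix x i l = S.relationMatrix x l i) ↔ (S.inertia *ᵥ x.1) ⨯₃ x.1 = 0 := by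
  rw [← mulVec_cross_eq_zero_iff (isUnit_det_of_isOrthonormalFrame hx), cross_eq_zero_iff_forall]
  simp only [relationMatrix, S.spaceMomentum_eq hx, Pi.add_apply]
  change _ ↔ ∀ i l, S.spaceInertia x i * spaceVelocity x l = S.spaceInertia x l * spaceVelocity x i
  exact ⟨fun h i l => by linear_combination h l i, fun h i l => by linear_combination h l i⟩

lemma fderiv_frame_mem_span (x : SupportState) (j : Fin 4) (A : Set (IntegralIndex j))
    (hA : ∀ p, Sum.inl p ∈ A) (i l : Fin 3) :
    fderiv ℝ (fun x : SupportState => x.2 i ⬝ᵥ x.2 l) x ∈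
      Submodule.span ℝ ((fun o => fderiv ℝ (S.integrals j o) x) '' A) := by
  rcases le_total i l with h | h
  · exact Submodule.subset_span ⟨Sum.inl ⟨(i, l), h⟩, hA _, rfl⟩
  · have : (fun x : SupportState => x.2 i ⬝ᵥ x.2 l) = fun x => x.2 l ⬝ᵥ x.2 i := by
      funext x
      exact dotProduct_comm _ _
    rw [this]
    exact Submodule.subset_span ⟨Sum.inl ⟨(l, i), h⟩, hA _, rfl⟩

/-- If ℐΩ is parallel to Ω, the relation matrix is symmetric and dE becomes a combination of the
d(K, e_l) and the d(e_i · e_l). The one d(K, e_l) that may be missing has to be eliminated. -/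
lemma cross_ne_zero_of_linearIndependent {x : SupportState} (hx : x ∈ phaseSpace) (j : Fin 4)
    (hli : LinearIndependent ℝ fun o => fderiv ℝ (S.integrals j o) x) :
    (S.inertia *ᵥ x.1) ⨯₃ x.1 ≠ 0 := by
  intro hc
  rw [← S.relationMatrix_symm_iff hx] at hc
  rw [linearIndependent_iff_notMem_span] at hli
  have hE : fderiv ℝ S.energy x =
      ∑ l : Fin 3, spaceVelocity x l • fderiv ℝ (S.momentumIntegral l.succ) x -
      ∑ i, ∑ l, (S.relationMatrix x i l / 2) •
        fderiv ℝ (fun x : SupportState => x.2 i ⬝ᵥ x.2 l) x := by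
    refine ContinuousLinearMap.ext fun v => ?_
    rw [S.fderiv_energy_eq hx]
    simp only [_root_.sub_apply, _root_.sum_apply, _root_.smul_apply, fderiv_frame, smul_eq_mul]
    congr 1
    have h1 : ∑ i, ∑ l, S.relationMatrix x i l * (v.2 i ⬝ᵥ x.2 l) =
        ∑ i, ∑ l, S.relationMatrix x i l * (v.2 l ⬝ᵥ x.2 i) := by
      rw [Finset.sum_comm]
      exact Finset.sum_congr rfl fun i _ => Finset.sum_congr rfl fun l _ => by rw [hc l i]
    have h2 : ∑ i, ∑ l, S.relationMatrix x i l / 2 * (v.2 i ⬝ᵥ x.2 l + v.2 l ⬝ᵥ x.2 i) =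
        (∑ i, ∑ l, S.relationMatrix x i l * (v.2 i ⬝ᵥ x.2 l) +
        ∑ i, ∑ l, S.relationMatrix x i l * (v.2 l ⬝ᵥ x.2 i)) / 2 := by
      simp only [← Finset.sum_add_distrib, Finset.sum_div]
      exact Finset.sum_congr rfl fun i _ => Finset.sum_congr rfl fun l _ => by ring
    rw [h2, ← h1]
    ring
  have hP := fun (o : Option {i : Fin 4 // i ≠ j}) =>
    S.fderiv_frame_mem_span x j (Set.univ \ {Sum.inr o}) (fun p => by simp)
  have hm : ∀ (o : Option {i : Fin 4 // i ≠ j}) (i : {i : Fin 4 // i ≠ j}), some i ≠ o →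
      fderiv ℝ (S.momentumIntegral i) x ∈ Submodule.span ℝ
        ((fun o => fderiv ℝ (S.integrals j o) x) '' (Set.univ \ {Sum.inr o})) :=
    fun o i hi => Submodule.subset_span ⟨Sum.inr (some i), by simpa using hi, rfl⟩
  have hn := hli (Sum.inr none)
  change fderiv ℝ S.energy x ∉ _ at hn
  apply hn
  rw [hE]
  refine Submodule.sub_mem _ (Submodule.sum_mem _ fun l _ => Submodule.smul_mem _ _ ?_)
    (Submodule.sum_mem _ fun i _ => Submodule.sum_mem _ fun l _ => Submodule.smul_mem _ _ (hP _ i l))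
  by_cases hl : l.succ ≠ j
  · exact hm none ⟨l.succ, hl⟩ (by simp)
  · rw [not_not] at hl
    have h0 : (0 : Fin 4) ≠ j := hl ▸ (Fin.succ_ne_zero l).symm
    have hR := S.fderiv_momentumIntegral_zero_eq hx
    -- The missing d(K, e_l) can be solved for from d(K, K) if its coefficient 2k_l is nonzero. If
    -- k_l = 0, then d(K, K) is already a combination of the others.
    by_cases hk : S.spaceMomentum x l = 0
    · exfalso
      apply hli (Sum.inr (some ⟨0, h0⟩))
      change fderiv ℝ (S.momentumIntegral 0) x ∈ _
      rw [hR]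
      refine Submodule.sub_mem _ (Submodule.sum_mem _ fun l' _ => ?_)
        (Submodule.sum_mem _ fun i _ => Submodule.sum_mem _ fun l _ =>
          Submodule.smul_mem _ _ (hP _ i l))
      by_cases hl' : l' = l
      · rw [hl', hk]
        simp
      · refine Submodule.smul_mem _ _ (hm _ ⟨l'.succ, ?_⟩ ?_)
        · rw [← hl]
          exact fun h => hl' (Fin.succ_injective _ h)
        · simp [Fin.succ_ne_zero]
    · have h1 : (2 * S.spaceMomentum x l) • fderiv ℝ (S.momentumIntegral l.succ) x =
          fderiv ℝ (S.momentumIntegral 0) x -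
          ∑ l' ∈ Finset.univ.erase l,
            (2 * S.spaceMomentum x l') • fderiv ℝ (S.momentumIntegral l'.succ) x +
          ∑ i, ∑ l, (S.spaceMomentum x i * S.spaceMomentum x l) •
            fderiv ℝ (fun x : SupportState => x.2 i ⬝ᵥ x.2 l) x := by
        rw [hR, ← Finset.add_sum_erase _ _ (Finset.mem_univ l)]
        abel
      have h2 : (2 * S.spaceMomentum x l) ≠ 0 := by simpa using hk
      rw [← Submodule.smul_mem_iff _ h2, h1]
      refine Submodule.add_mem _ (Submodule.sub_mem _ (hm none ⟨0, h0⟩ (by simp))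
        (Submodule.sum_mem _ fun l' hl' => Submodule.smul_mem _ _ (hm none ⟨l'.succ, ?_⟩ (by simp))))
        (Submodule.sum_mem _ fun i _ => Submodule.sum_mem _ fun l _ =>
          Submodule.smul_mem _ _ (hP _ i l))
      rw [← hl]
      exact fun h => (Finset.ne_of_mem_erase hl') (Fin.succ_injective _ h)

end SphericalSupport

namespace SphericalSupport

variable {N : ℕ} (S : SphericalSupport N)

/-- A linear relation is tested first on variations of Ω alone and then on variations of one frame
vector in the direction of another. Symmetry of the coefficients of the scalar products kills the
coefficient of dE. -/
lemma linearIndependent_of_cross_ne_zero {x : SupportState} (hx : x ∈ phaseSpace)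
    (hU : x ∈ S.domain) (j : Fin 4) (hc : (S.inertia *ᵥ x.1) ⨯₃ x.1 ≠ 0)
    (hj : ∀ l : Fin 3, l.succ = j → S.spaceMomentum x l ≠ 0) :
    LinearIndependent ℝ fun o => fderiv ℝ (S.integrals j o) x := by
  rw [Fintype.linearIndependent_iff]
  intro c hsum
  -- The omitted integral gets the coefficient 0, so that all four momentum integrals can be treated
  -- uniformly.
  let m : Fin 4 → ℝ := fun i => if h : i ≠ j then c (Sum.inr (some ⟨i, h⟩)) else 0
  have hm : ∀ i : {i : Fin 4 // i ≠ j}, m i = c (Sum.inr (some i)) := fun i => dif_pos i.2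
  have hmj : m j = 0 := by simp [m]
  let E := c (Sum.inr none)
  have hv : ∀ v : SupportState,
      ∑ p : {p : Fin 3 × Fin 3 // p.1 ≤ p.2}, c (Sum.inl p) *
        (v.2 p.1.1 ⬝ᵥ x.2 p.1.2 + v.2 p.1.2 ⬝ᵥ x.2 p.1.1) +
      (E * fderiv ℝ S.energy x v + ∑ i, m i * fderiv ℝ (S.momentumIntegral i) x v) = 0 := by
    intro v
    have h := congrArg (fun L : SupportState →L[ℝ] ℝ => L v) hsum
    simp only [Fintype.sum_sum_type, Fintype.sum_option, _root_.add_apply, _root_.sum_apply,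
      _root_.smul_apply, smul_eq_mul, _root_.zero_apply] at h
    rw [← h]
    congr 1
    · exact Finset.sum_congr rfl fun p _ => by rw [← fderiv_frame]; rfl
    · congr 1
      rw [← Fintype.sum_subtype_add_sum_subtype (fun i => i ≠ j)
        (fun i => m i * fderiv ℝ (S.momentumIntegral i) x v)]
      rw [add_eq_left.2]
      · exact Finset.sum_congr rfl fun i _ => by rw [hm]; rfl
      · refine Finset.sum_eq_zero fun i _ => ?_
        rw [not_not.1 i.2, hmj, zero_mul]
  -- the coefficients of the functions `(K, e_l)` after elimination of `(K, K)`
  let b : Fin 3 → ℝ := fun l => m l.succ + 2 * m 0 * S.spaceMomentum x l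
  -- Variations of Ω with the frame fixed; invertibility of ℐ + Γ then forces EΩ + ∑ b_l e_l = 0.
  have hξ : ∀ ξ : Vec3, (E • x.1 + ∑ l, b l • x.2 l) ⬝ᵥ (S.totalInertia x.2 *ᵥ ξ) = 0 := by
    intro ξ
    have h := hv (ξ, 0)
    have hK : S.angMomentumDeriv x (ξ, 0) = S.totalInertia x.2 *ᵥ ξ := by
      simp only [angMomentumDeriv]
      have : Matrix.of (0 : Fin 3 → Vec3) = (0 : Matrix (Fin 3) (Fin 3) ℝ) := rfl
      rw [this]
      simp
    have h2 := IsOrthonormalFrame.sum_mul_dotProduct hx (S.angMomentum x) (S.totalInertia x.2 *ᵥ ξ)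
    have h3 : ξ ⬝ᵥ S.angMomentum x = x.1 ⬝ᵥ (S.totalInertia x.2 *ᵥ ξ) := by
      rw [angMomentum, ← mulVec_dotProduct_comm (S.totalInertia_transpose _), dotProduct_comm]
    rw [Fin.sum_univ_succ (n := 3)] at h
    simp only [fderiv_energy, fderiv_momentumIntegral_zero, fderiv_momentumIntegral_succ, hK, ← h2,
      Pi.zero_apply, zero_dotProduct, h3] at h
    rw [add_dotProduct, smul_dotProduct, sum_dotProduct]
    simp only [smul_dotProduct, smul_eq_mul, b, spaceMomentum_apply]
    simp only [add_zero, mul_zero, Finset.sum_const_zero, zero_add, Fin.sum_univ_three] at h ⊢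
    linear_combination h
  have hb0 : E • x.1 + ∑ l, b l • x.2 l = 0 := by
    have h := hξ ((S.totalInertia x.2)⁻¹ *ᵥ (E • x.1 + ∑ l, b l • x.2 l))
    rw [Matrix.mulVec_mulVec, Matrix.mul_nonsing_inv _ (S.isUnit_det_of_mem_domain hU),
      Matrix.one_mulVec] at h
    exact dotProduct_self_eq_zero.1 h
  have hb : ∀ l, b l = -(E * spaceVelocity x l) := by
    intro l
    have h := congrArg (fun u => x.2 l ⬝ᵥ u) hb0
    simp only [dotProduct_add, dotProduct_smul, dotProduct_sum, hx l, smul_eq_mul, dotProduct_zero,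
      mul_ite, mul_one, mul_zero, Finset.sum_ite_eq, Finset.mem_univ, if_true] at h
    rw [spaceVelocity_apply]
    linarith
  -- The contribution of the six scalar products when e_i is varied in the direction e_l. It is
  -- symmetric, with the diagonal coefficients doubled.
  let Q : Fin 3 → Fin 3 → ℝ := fun i l => ∑ p : {p : Fin 3 × Fin 3 // p.1 ≤ p.2}, c (Sum.inl p) *
        ((if p.1.1 = i then if l = p.1.2 then 1 else 0 else 0) +
          (if p.1.2 = i then if l = p.1.1 then 1 else 0 else 0))
  have hQs : ∀ i l, Q i l = Q l i := by
    intro i l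
    refine Finset.sum_congr rfl fun p _ => ?_
    congr 1
    rw [add_comm]
    congr 1
    · simp only [← ite_and, eq_comm (a := l), eq_comm (b := i), and_comm]
    · simp only [← ite_and, eq_comm (a := l), eq_comm (b := i), and_comm]
  have hη : ∀ i l, Q i l = E * S.relationMatrix x i l +
      m 0 * (S.spaceMomentum x i * S.spaceMomentum x l + S.spaceMomentum x l * S.spaceMomentum x i) := by
    intro i l
    have h := hv (0, Pi.single i (x.2 l))
    have hd : ∀ i' l', (Pi.single i (x.2 l) : Fin 3 → Vec3) i' ⬝ᵥ x.2 l' =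
        if i' = i then if l = l' then 1 else 0 else 0 := by
      intro i' l'
      by_cases hi : i' = i
      · subst hi
        simp [hx l l']
      · simp [hi]
    rw [Fin.sum_univ_succ (n := 3), S.fderiv_energy_eq hx, S.fderiv_momentumIntegral_zero_eq hx] at h
    simp only [_root_.sub_apply, _root_.sum_apply, _root_.smul_apply, fderiv_frame, hd,
      smul_eq_mul] at h
    have hs1 : ∑ i', ∑ l', S.relationMatrix x i' l' *
        (if i' = i then if l = l' then (1 : ℝ) else 0 else 0) = S.relationMatrix x i l := by
      rw [Finset.sum_eq_single i (fun i' _ hi' => by simp [hi']) (by simp)]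
      simp
    have hs2 : ∑ i', ∑ l', S.spaceMomentum x i' * S.spaceMomentum x l' *
        ((if i' = i then if l = l' then (1 : ℝ) else 0 else 0) +
          (if l' = i then if l = i' then (1 : ℝ) else 0 else 0)) =
        S.spaceMomentum x i * S.spaceMomentum x l + S.spaceMomentum x l * S.spaceMomentum x i := by
      simp only [mul_add, Finset.sum_add_distrib]
      congr 1
      · rw [Finset.sum_eq_single i (fun i' _ hi' => by simp [hi']) (by simp)]
        simp
      · rw [Finset.sum_comm, Finset.sum_eq_single i (fun i' _ hi' => by simp [hi']) (by simp)]
        simp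
    rw [hs1, hs2] at h
    have hb' : ∀ l', m (Fin.succ l') = -(E * spaceVelocity x l') - 2 * m 0 * S.spaceMomentum x l' := by
      intro l'
      have := hb l'
      simp only [b] at this
      linarith
    simp only [hb', Fin.sum_univ_three] at h
    change Q i l + _ = 0 at h
    linear_combination h
  -- In `hη` all terms but E times the relation matrix are symmetric, and the relation matrix is
  -- not.
  have hE : E = 0 := by
    by_contra hE
    refine hc ((S.relationMatrix_symm_iff hx).1 fun i l => ?_)
    refine mul_left_cancel₀ hE ?_
    linear_combination hQs i l - hη i l + hη l i
  have hm0 : m 0 = 0 ∧ ∀ l : Fin 3, m l.succ = 0 := by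
    have h1 : ∀ l : Fin 3, m l.succ = -(2 * m 0 * S.spaceMomentum x l) := by
      intro l
      have := hb l
      simp only [b, hE] at this
      linarith
    have h0 : m 0 = 0 := by
      revert hmj hj
      refine Fin.cases (fun _ h => h) (fun l hj hmj => ?_) j
      rw [h1] at hmj
      have := hj l rfl
      simpa [this] using hmj
    exact ⟨h0, fun l => by rw [h1, h0]; simp⟩
  have hQ0 : ∀ i l, Q i l = 0 := by
    intro i l
    rw [hη, hE, hm0.1]
    simp
  rintro (p | _ | i)
  · have h := hQ0 p.1.1 p.1.2
    have hle := p.2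
    simp only [Q] at h
    rw [Finset.sum_eq_single p] at h
    · rcases eq_or_ne p.1.1 p.1.2 with h1 | h1
      · simp [h1] at h
        linarith
      · simpa [h1, h1.symm] using h
    · intro p' _ hp'
      have h1 : ¬ (p'.1.1 = p.1.1 ∧ p.1.2 = p'.1.2) := fun h1 =>
        hp' (Subtype.ext (Prod.ext h1.1 h1.2.symm))
      have h2 : ¬ (p'.1.2 = p.1.1 ∧ p.1.2 = p'.1.1) := by
        intro h2
        have := p'.2
        rw [h2.1, ← h2.2] at this
        exact h1 ⟨by rw [← h2.2]; exact le_antisymm this hle, by rw [h2.1]; exact le_antisymm this hle⟩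
      simp only [← ite_and, if_neg h1, if_neg h2]
      simp
    · simp
  · exact hE
  · rw [← hm]
    obtain ⟨i, hi⟩ := i
    revert hi
    refine Fin.cases (fun _ => hm0.1) (fun l _ => hm0.2 l) i

end SphericalSupport

/-! ### Diagonalization -/

lemma exists_orthogonal_diagonal {B : Matrix (Fin 3) (Fin 3) ℝ} (hB : Bᵀ = B) :
    ∃ (F : Matrix (Fin 3) (Fin 3) ℝ) (a : Fin 3 → ℝ),
      F * Fᵀ = 1 ∧ B = Fᵀ * Matrix.diagonal a * F ∧ Monotone a := by
  have hH : B.IsHermitian := by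
    rw [Matrix.IsHermitian, Matrix.conjTranspose_eq_transpose_of_trivial, hB]
  let V : Matrix (Fin 3) (Fin 3) ℝ := hH.eigenvectorUnitary
  have hV : Vᵀ * V = 1 := by
    have := Unitary.coe_star_mul_self hH.eigenvectorUnitary
    rwa [Matrix.star_eq_conjTranspose, Matrix.conjTranspose_eq_transpose_of_trivial] at this
  have hs : B = V * Matrix.diagonal hH.eigenvalues * Vᵀ := by
    have := hH.spectral_theorem
    rw [Unitary.conjStarAlgAut_apply] at this
    rw [Matrix.star_eq_conjTranspose, Matrix.conjTranspose_eq_transpose_of_trivial] at this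
    exact this
  let σ := Tuple.sort hH.eigenvalues
  refine ⟨Vᵀ.submatrix σ id, hH.eigenvalues ∘ σ, ?_, ?_, Tuple.monotone_sort _⟩
  · rw [Matrix.transpose_submatrix, Matrix.transpose_transpose,
      ← Matrix.submatrix_mul _ _ σ id σ Function.bijective_id, hV, Matrix.submatrix_one_equiv]
  · rw [Matrix.transpose_submatrix, Matrix.transpose_transpose,
      ← Matrix.submatrix_diagonal_equiv, Matrix.submatrix_mul_equiv, Matrix.submatrix_mul_equiv]
    exact hs

/-- If the eigenvalues of two symmetric operators cannot be made to collide by a rotation, then some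
`r` separates them: all `1 / (γ_j - r)` are smaller than all `1 / (a_i - r)`. -/
lemma exists_separating {a γ : Fin 3 → ℝ} (ha : Monotone a) (hγ : Monotone γ)
    (h : ∀ σ : Equiv.Perm (Fin 3), 0 < ∏ i, (a i - γ (σ i))) :
    ∃ r, (∀ i, a i ≠ r) ∧ (∀ j, γ j ≠ r) ∧ ∀ i j, (γ j - r)⁻¹ < (a i - r)⁻¹ := by
  have a01 : a 0 ≤ a 1 := ha (by decide)
  have a12 : a 1 ≤ a 2 := ha (by decide)
  have g01 : γ 0 ≤ γ 1 := hγ (by decide)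
  have g12 : γ 1 ≤ γ 2 := hγ (by decide)
  have h1 := h 1
  have h2 := h (Equiv.swap 0 1)
  have h3 := h (Equiv.swap 0 2)
  have h4 := h (Equiv.swap 1 2)
  have h5 := h (Equiv.swap 0 1 * Equiv.swap 1 2)
  have h6 := h (Equiv.swap 0 2 * Equiv.swap 1 2)
  simp only [Fin.prod_univ_three, Equiv.Perm.coe_one, id_eq, Equiv.Perm.coe_mul,
    Function.comp_apply, Equiv.swap_apply_def, Fin.reduceEq, if_true, if_false] at h1 h2 h3 h4 h5 h6
  -- On the projective line the two triples occupy disjoint arcs, as positivity for all permutations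
  -- forbids interlacing. The sign of the product leaves these three of the six ways in which ∞ can
  -- cut the circle.
  have key : γ 2 < a 0 ∨ (γ 0 < a 0 ∧ a 2 < γ 1) ∨ (a 1 < γ 0 ∧ γ 2 < a 2) := by
    rcases lt_trichotomy (γ 2) (a 0) with h0 | h0 | h0
    · exact Or.inl h0
    · simp [h0] at h3
    · right
      have d02 : a 0 - γ 2 < 0 := by linarith
      have d11 : a 1 - γ 1 < 0 := by
        by_contra hc
        nlinarith [mul_nonneg (not_lt.1 hc) (by linarith : 0 ≤ a 2 - γ 0)]
      rcases lt_trichotomy (γ 0) (a 0) with h00 | h00 | h00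
      · left
        refine ⟨h00, ?_⟩
        by_contra hc
        nlinarith [mul_nonneg (by linarith : 0 ≤ a 0 - γ 0) (by linarith : 0 ≤ a 2 - γ 1),
          mul_nonneg (by linarith : 0 ≤ -(a 1 - γ 2))
          (mul_nonneg (by linarith : 0 ≤ a 0 - γ 0) (by linarith : 0 ≤ a 2 - γ 1))]
      · simp [h00] at h1
      · right
        have h22 : γ 2 < a 2 := by
          by_contra hc
          nlinarith [mul_nonneg (mul_nonneg (by linarith : 0 ≤ -(a 0 - γ 0))
            (by linarith : 0 ≤ -(a 1 - γ 1))) (by linarith : 0 ≤ -(a 2 - γ 2))]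
        refine ⟨?_, h22⟩
        by_contra hc
        nlinarith [mul_nonneg (mul_nonneg (by linarith : 0 ≤ -(a 0 - γ 1))
            (by linarith : 0 ≤ (a 1 - γ 0))) (by linarith : 0 ≤ (a 2 - γ 2))]
  have pos : ∀ {r x y : ℝ}, r < x → x < y → (y - r)⁻¹ < (x - r)⁻¹ := fun h1 h2 =>
    inv_strictAnti₀ (by linarith) (by linarith)
  have neg : ∀ {r x y : ℝ}, y < r → x < y → (y - r)⁻¹ < (x - r)⁻¹ := fun h1 h2 => by
    rw [inv_lt_inv_of_neg (by linarith) (by linarith)]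
    linarith
  have mix : ∀ {r x y : ℝ}, y < r → r < x → (y - r)⁻¹ < (x - r)⁻¹ := fun h1 h2 =>
    (inv_lt_zero.2 (by linarith)).trans (inv_pos.2 (by linarith))
  have hal : ∀ i, a 0 ≤ a i := fun i => ha (Fin.zero_le i)
  have hau : ∀ i, a i ≤ a 2 := fun i => ha (Fin.le_last i)
  have hgl : ∀ i, γ 0 ≤ γ i := fun i => hγ (Fin.zero_le i)
  have hgu : ∀ i, γ i ≤ γ 2 := fun i => hγ (Fin.le_last i)
  rcases key with h0 | ⟨h0, h7⟩ | ⟨h0, h7⟩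
  · refine ⟨(γ 2 + a 0) / 2, fun i => ?_, fun j => ?_, fun i j => mix ?_ ?_⟩
    · have := hal i
      exact ne_of_gt (by linarith)
    · have := hgu j
      exact ne_of_lt (by linarith)
    · have := hgu j
      linarith
    · have := hal i
      linarith
  · have hj : ∀ j, j = 0 ∨ γ 1 ≤ γ j := fun j => by
      fin_cases j
      exacts [Or.inl rfl, Or.inr le_rfl, Or.inr g12]
    refine ⟨(γ 0 + a 0) / 2, fun i => ?_, fun j => ?_, fun i j => ?_⟩
    · have := hal i
      exact ne_of_gt (by linarith)
    · rcases hj j with rfl | h8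
      · exact ne_of_lt (by linarith)
      · exact ne_of_gt (by linarith)
    · have := hal i
      have := hau i
      rcases hj j with rfl | h8
      · exact mix (by linarith) (by linarith)
      · exact pos (by linarith) (by linarith)
  · have hi : ∀ i, i = 2 ∨ a i ≤ a 1 := fun i => by
      fin_cases i
      exacts [Or.inr a01, Or.inr le_rfl, Or.inl rfl]
    refine ⟨(γ 2 + a 2) / 2, fun i => ?_, fun j => ?_, fun i j => ?_⟩
    · rcases hi i with rfl | h8
      · exact ne_of_gt (by linarith)
      · have := hgl 2
        exact ne_of_lt (by linarith)
    · have := hgu j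
      exact ne_of_lt (by linarith)
    · have := hgu j
      have := hgl j
      rcases hi i with rfl | h8
      · exact mix (by linarith) (by linarith)
      · exact neg (by linarith) (by linarith)

/-- The permutation matrix with `P f_i = h_{σ i}`. -/
def permutationMatrix (σ : Equiv.Perm (Fin 3)) : Matrix (Fin 3) (Fin 3) ℝ :=
  Matrix.of fun i j => if i = σ j then 1 else 0

lemma permutationMatrix_transpose_mul_diagonal_mul (σ : Equiv.Perm (Fin 3)) (γ : Fin 3 → ℝ) :
    (permutationMatrix σ)ᵀ * Matrix.diagonal γ * permutationMatrix σ =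
      Matrix.diagonal (γ ∘ σ) := by
  ext i j
  rw [Matrix.mul_apply]
  simp only [Matrix.mul_diagonal, Matrix.transpose_apply, permutationMatrix, Matrix.of_apply,
    Matrix.diagonal_apply, Function.comp_apply]
  rw [Finset.sum_eq_single (σ i)]
  · simp
  · intro b _ hb
    simp [hb]
  · simp

lemma permutationMatrix_transpose_mul (σ : Equiv.Perm (Fin 3)) :
    (permutationMatrix σ)ᵀ * permutationMatrix σ = 1 := by
  have := permutationMatrix_transpose_mul_diagonal_mul σ 1
  simpa using this

lemma permutationMatrix_mul_transpose (σ : Equiv.Perm (Fin 3)) :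
    permutationMatrix σ * (permutationMatrix σ)ᵀ = 1 :=
  mul_eq_one_comm.1 (permutationMatrix_transpose_mul σ)

/-! ### Normal form of the two tensors -/

namespace SphericalSupport

variable {N : ℕ} (S : SphericalSupport N)

lemma isOrthonormalFrame_of_mul {H O F : Matrix (Fin 3) (Fin 3) ℝ} (hH : H * Hᵀ = 1)
    (hO : O * Oᵀ = 1) (hF : F * Fᵀ = 1) : IsOrthonormalFrame (Matrix.of.symm (Hᵀ * O * F)) := by
  rw [isOrthonormalFrame_iff, Equiv.apply_symm_apply]
  calc _ = Hᵀ * (O * (F * Fᵀ) * Oᵀ) * H := by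
        simp only [Matrix.transpose_mul, Matrix.transpose_transpose, Matrix.mul_assoc]
    _ = 1 := by rw [hF, mul_one, hO, mul_one, mul_eq_one_comm.1 hH]

/-- In the position HᵀPF the eigenvectors of ℐ and G are aligned according to σ, and ℐ + Γ is
diagonal in the basis F with the entries a_i - γ_{σ i}. -/
lemma prod_sub_pos {F H : Matrix (Fin 3) (Fin 3) ℝ} {a γ : Fin 3 → ℝ} (hF : F * Fᵀ = 1)
    (hH : H * Hᵀ = 1) (hI : S.inertia = Fᵀ * Matrix.diagonal a * F)
    (hG : -S.spaceTensor = Hᵀ * Matrix.diagonal γ * H)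
    (hB : ∀ e : Fin 3 → Vec3, IsOrthonormalFrame e → 0 < (S.totalInertia e).det)
    (σ : Equiv.Perm (Fin 3)) : 0 < ∏ i, (a i - γ (σ i)) := by
  have h := hB _ (isOrthonormalFrame_of_mul hH (permutationMatrix_mul_transpose σ) hF)
  have h1 : S.totalInertia (Matrix.of.symm (Hᵀ * permutationMatrix σ * F)) =
      Fᵀ * Matrix.diagonal (fun i => a i - γ (σ i)) * F := by
    have h2 : Matrix.diagonal (fun i => a i - γ (σ i)) = Matrix.diagonal a -
        (permutationMatrix σ)ᵀ * Matrix.diagonal γ * permutationMatrix σ := by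
      rw [permutationMatrix_transpose_mul_diagonal_mul, Matrix.diagonal_sub]
      rfl
    have h3 : S.spaceTensor = -(Hᵀ * Matrix.diagonal γ * H) := by rw [← hG, neg_neg]
    rw [totalInertia, gammaTensor_eq, Equiv.apply_symm_apply, hI, h2, h3]
    calc _ = Fᵀ * Matrix.diagonal a * F - Fᵀ * ((permutationMatrix σ)ᵀ * ((H * Hᵀ) *
          Matrix.diagonal γ * (H * Hᵀ)) * permutationMatrix σ) * F := by
          simp only [Matrix.transpose_mul, Matrix.transpose_transpose, Matrix.mul_assoc,
            Matrix.neg_mul, Matrix.mul_neg, sub_eq_add_neg]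
      _ = _ := by rw [hH, one_mul, mul_one, Matrix.mul_sub, Matrix.sub_mul]
  have h4 : (Fᵀ).det * F.det = 1 := by
    rw [← Matrix.det_mul, mul_eq_one_comm.1 hF, Matrix.det_one]
  rw [h1, Matrix.det_mul, Matrix.det_mul, Matrix.det_diagonal, mul_right_comm, h4, one_mul] at h
  exact h

/-- Normal form of the two tensors: `F` diagonalizes `ℐ`, with eigenvalues `r + 1 / a_i`, and
`T = (G + r)⁻¹` for the tensor `G` of the peripheral balls, so that
`(ℐ - r)⁻¹ + T` is positive definite in all positions of the ball. -/
structure IsNormalForm (r δ : ℝ) (F : Matrix (Fin 3) (Fin 3) ℝ) (a : Fin 3 → ℝ)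
    (T : Matrix (Fin 3) (Fin 3) ℝ) : Prop where
  orthogonal : F * Fᵀ = 1
  ne_zero : ∀ i, a i ≠ 0
  inertia_eq : S.inertia = Fᵀ * Matrix.diagonal (fun i => r + (a i)⁻¹) * F
  symm : Tᵀ = T
  mul_eq_one : (S.spaceTensor + r • (1 : Matrix (Fin 3) (Fin 3) ℝ)) * T = 1
  le : ∀ i, δ ≤ a i
  lt : ∀ v : Vec3, v ≠ 0 → -(v ⬝ᵥ (T *ᵥ v)) < δ * (v ⬝ᵥ v)

/-- The separating r is inserted in both tensors: 1 / (eigenvalue - r) are the new a_i, and -T has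
the eigenvalues 1 / (γ_j - r), all below the smallest a_i, which serves as δ. That δ is attained is
needed later, when the a_i are sorted. -/
lemma exists_isNormalForm
    (hB : ∀ e : Fin 3 → Vec3, IsOrthonormalFrame e → 0 < (S.totalInertia e).det) :
    ∃ r δ F a T, S.IsNormalForm r δ F a T ∧ ∃ i, δ = a i := by
  obtain ⟨F, a, hF, hI, ha⟩ := exists_orthogonal_diagonal S.inertia_transpose
  obtain ⟨H, γ, hH, hG, hγ⟩ := exists_orthogonal_diagonal (B := -S.spaceTensor)
    (by rw [Matrix.transpose_neg, spaceTensor_transpose])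
  obtain ⟨r, h1, h2, h3⟩ := exists_separating ha hγ (S.prod_sub_pos hF hH hI hG hB)
  obtain ⟨i₀, hi₀⟩ := Finite.exists_min fun i => (a i - r)⁻¹
  have h1' : ∀ i, a i - r ≠ 0 := fun i => sub_ne_zero.2 (h1 i)
  have h2' : ∀ i, γ i - r ≠ 0 := fun i => sub_ne_zero.2 (h2 i)
  have hHH : Hᵀ * H = 1 := mul_eq_one_comm.1 hH
  refine ⟨r, (a i₀ - r)⁻¹, F, fun i => (a i - r)⁻¹,
    Hᵀ * Matrix.diagonal (fun j => -(γ j - r)⁻¹) * H, ⟨hF, fun i => inv_ne_zero (h1' i), ?_, ?_, ?_,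
    hi₀, ?_⟩, i₀, rfl⟩
  · simpa using hI
  · simp [Matrix.transpose_mul, Matrix.mul_assoc]
  · have h4 : S.spaceTensor + r • (1 : Matrix (Fin 3) (Fin 3) ℝ) =
        Hᵀ * Matrix.diagonal (fun j => -(γ j - r)) * H := by
      have h5 : Matrix.diagonal (fun j => -(γ j - r)) =
          r • (1 : Matrix (Fin 3) (Fin 3) ℝ) - Matrix.diagonal γ := by
        rw [Matrix.smul_one_eq_diagonal, Matrix.diagonal_sub]
        congr 1
        funext j
        ring
      rw [h5, Matrix.mul_sub, Matrix.sub_mul, ← hG, Matrix.mul_smul, Matrix.smul_mul, mul_one, hHH]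
      abel
    rw [h4]
    calc _ = Hᵀ * (Matrix.diagonal (fun j => -(γ j - r)) * (H * Hᵀ) *
          Matrix.diagonal (fun j => -(γ j - r)⁻¹)) * H := by simp only [Matrix.mul_assoc]
      _ = 1 := by
        have h5 : (fun j => -(γ j - r) * -(γ j - r)⁻¹) = fun _ => 1 := by
          funext j
          rw [neg_mul_neg, mul_inv_cancel₀ (h2' j)]
        rw [hH, mul_one, Matrix.diagonal_mul_diagonal, h5, Matrix.diagonal_one, mul_one, hHH]
  · intro v hv
    have h6 : v ⬝ᵥ ((Hᵀ * Matrix.diagonal (fun j => -(γ j - r)⁻¹) * H) *ᵥ v) =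
        ∑ j, -(γ j - r)⁻¹ * ((H *ᵥ v) j * (H *ᵥ v) j) := by
      rw [Matrix.mul_assoc, ← Matrix.mulVec_mulVec, Matrix.dotProduct_mulVec, Matrix.vecMul_transpose,
        ← Matrix.mulVec_mulVec, dotProduct]
      refine Finset.sum_congr rfl fun j _ => ?_
      rw [Matrix.mulVec_diagonal]
      ring
    have h7 : v ⬝ᵥ v = ∑ j, (H *ᵥ v) j * (H *ᵥ v) j := by
      change _ = (H *ᵥ v) ⬝ᵥ (H *ᵥ v)
      rw [Matrix.dotProduct_mulVec, ← Matrix.mulVec_transpose, Matrix.mulVec_mulVec, hHH, Matrix.one_mulVec]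
    have hv' : H *ᵥ v ≠ 0 := by
      intro h0
      rw [h0] at h7
      simp at h7
      exact hv h7
    obtain ⟨j₀, hj₀⟩ := Function.ne_iff.1 hv'
    rw [h6, h7, ← Finset.sum_neg_distrib, Finset.mul_sum]
    refine Finset.sum_lt_sum (fun j _ => ?_) ⟨j₀, Finset.mem_univ _, ?_⟩
    · nlinarith [mul_nonneg (sub_nonneg.2 (h3 i₀ j).le) (mul_self_nonneg ((H *ᵥ v) j))]
    · have h8 : 0 < (H *ᵥ v) j₀ * (H *ᵥ v) j₀ := mul_self_pos.2 hj₀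
      nlinarith [mul_pos (sub_pos.2 (h3 i₀ j₀)) h8]

end SphericalSupport

/-! ### Two triangles inscribed in a parabola -/

/-- The positions of the numbers `a, b, c` and `t, p, q` for which the triangles with the vertices
`(a, a²), (b, b²), (c, c²)` and `(t, t²), (p, p²), (q, q²)` meet in a quadrilateral, two sides of which
lie on the sides through `a` of the first triangle, the others on the sides through `t` of the
second one. -/
structure IsArranged (a b c t p q : ℝ) : Prop where
  pq : p ≤ q
  bc : b ≤ c
  order : (q < a ∧ a < t ∧ t < b) ∨ (q < b ∧ c < t ∧ t < a)

/-- The function `x / u + (1 - x) / v`. -/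
def mixInv (x u v : ℝ) : ℝ := x / u + (1 - x) / v

lemma mixInv_pos {x u v : ℝ} (hx0 : 0 ≤ x) (hx1 : x ≤ 1) (hu : 0 < u) (hv : 0 < v) :
    0 < mixInv x u v := by
  have h1 : 0 ≤ x / u := div_nonneg hx0 hu.le
  have h2 : 0 ≤ (1 - x) / v := div_nonneg (by linarith) hv.le
  rcases hx0.eq_or_lt with rfl | h
  · have : 0 < (1 - (0 : ℝ)) / v := div_pos (by norm_num) hv
    rw [mixInv]
    linarith
  · have : 0 < x / u := div_pos h hu
    rw [mixInv]
    linarith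

lemma mixInv_eq {x u v : ℝ} (hu : u ≠ 0) (hv : v ≠ 0) :
    mixInv x u v = (u - x * (u - v)) / (u * v) := by
  rw [mixInv]
  field_simp
  ring

namespace IsArranged

variable {a b c t p q : ℝ}

lemma signs (h : IsArranged a b c t p q) :
    (0 < a - p ∧ 0 < a - q) ∧ (0 < b - p ∧ 0 < b - q) ∧ (0 < c - p ∧ 0 < c - q) ∧
    (0 < t - p ∧ 0 < t - q) ∧ (0 < (b - a) * (t - a) ∧ 0 < (c - a) * (t - a)) ∧
    (0 < (b - t) * (t - a) ∧ 0 < (c - t) * (t - a)) ∧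
    (0 < (b - a) * (b - t) ∧ 0 < (c - a) * (c - t)) := by
  obtain ⟨h1, h2, ⟨h3, h4, h5⟩ | ⟨h3, h4, h5⟩⟩ := h
  · refine ⟨⟨?_, ?_⟩, ⟨?_, ?_⟩, ⟨?_, ?_⟩, ⟨?_, ?_⟩, ⟨?_, ?_⟩, ⟨?_, ?_⟩, ?_, ?_⟩ <;>
    first | linarith | (apply mul_pos <;> linarith)
  · refine ⟨⟨?_, ?_⟩, ⟨?_, ?_⟩, ⟨?_, ?_⟩, ⟨?_, ?_⟩, ⟨?_, ?_⟩, ⟨?_, ?_⟩, ?_, ?_⟩ <;>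
    first | linarith | (apply mul_pos_of_neg_of_neg <;> linarith)

lemma ne (h : IsArranged a b c t p q) :
    (a - p ≠ 0 ∧ a - q ≠ 0) ∧ (b - p ≠ 0 ∧ b - q ≠ 0) ∧ (c - p ≠ 0 ∧ c - q ≠ 0) ∧
    (t - p ≠ 0 ∧ t - q ≠ 0) ∧ (b - a ≠ 0 ∧ c - a ≠ 0) ∧ (b - t ≠ 0 ∧ c - t ≠ 0) ∧ t - a ≠ 0 := by
  obtain ⟨⟨h1, h2⟩, ⟨h3, h4⟩, ⟨h5, h6⟩, ⟨h7, h8⟩, ⟨h9, h10⟩, ⟨h11, h12⟩, -, -⟩ := h.signs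
  exact ⟨⟨h1.ne', h2.ne'⟩, ⟨h3.ne', h4.ne'⟩, ⟨h5.ne', h6.ne'⟩, ⟨h7.ne', h8.ne'⟩,
    ⟨left_ne_zero_of_mul h9.ne', left_ne_zero_of_mul h10.ne'⟩,
    ⟨left_ne_zero_of_mul h11.ne', left_ne_zero_of_mul h12.ne'⟩, right_ne_zero_of_mul h9.ne'⟩

end IsArranged

/-- The squares of the coordinates of the points of the quadrilateral, up to scale: here `x` and `y`
are the parameters of the lines through `t` and `a`. The coordinates for `a` and `t` are products
of two factors. -/
structure QuadSquares where
  (A₁ A₂ B C T₁ T₂ P Q : ℝ)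

/-- The squares of the coordinates of the points of the quadrilateral, up to scale. -/
def quadSquares (a b c t p q x y : ℝ) : QuadSquares where
  A₁ := mixInv x (a - p) (a - q)
  A₂ := mixInv y ((b - a) * (t - a)) ((c - a) * (t - a))
  B := mixInv x ((b - a) * (b - t) * (b - p)) ((b - a) * (b - t) * (b - q))
  C := mixInv x ((c - a) * (c - t) * (c - p)) ((c - a) * (c - t) * (c - q))
  T₁ := mixInv x (t - p) (t - q)
  T₂ := mixInv y ((b - t) * (t - a)) ((c - t) * (t - a))
  P := mixInv y ((t - p) * (a - p) * (b - p)) ((t - p) * (a - p) * (c - p))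
  Q := mixInv y ((t - q) * (a - q) * (b - q)) ((t - q) * (a - q) * (c - q))

namespace IsArranged

variable {a b c t p q : ℝ} {x y : ℝ}

lemma quadSquares_pos (h : IsArranged a b c t p q) (hx0 : 0 ≤ x) (hx1 : x ≤ 1) (hy0 : 0 ≤ y)
    (hy1 : y ≤ 1) :
    (0 < (quadSquares a b c t p q x y).A₁ ∧ 0 < (quadSquares a b c t p q x y).A₂) ∧
    (0 < (quadSquares a b c t p q x y).B ∧ 0 < (quadSquares a b c t p q x y).C) ∧
    (0 < (quadSquares a b c t p q x y).T₁ ∧ 0 < (quadSquares a b c t p q x y).T₂) ∧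
    (0 < (quadSquares a b c t p q x y).P ∧ 0 < (quadSquares a b c t p q x y).Q) := by
  obtain ⟨⟨h1, h2⟩, ⟨h3, h4⟩, ⟨h5, h6⟩, ⟨h7, h8⟩, ⟨h9, h10⟩, ⟨h11, h12⟩, h13, h14⟩ := h.signs
  refine ⟨⟨?_, ?_⟩, ⟨?_, ?_⟩, ⟨?_, ?_⟩, ?_, ?_⟩ <;> apply mixInv_pos <;> first | assumption | positivity

/-- The third divided difference of a monomial of degree below 3 at the nodes a, b, t, p vanishes.
Geometrically this is the vertex in which the sides ab and tp of the two triangles meet. -/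
lemma four_point {a b t p : ℝ} (h1 : a - p ≠ 0) (h2 : b - p ≠ 0) (h3 : t - p ≠ 0) (h4 : b - a ≠ 0)
    (h5 : b - t ≠ 0) (h6 : t - a ≠ 0) {k : ℕ} (hk : k < 3) :
    1 / (a - p) * (1 / ((b - a) * (t - a))) * a ^ k + 1 / ((b - a) * (b - t) * (b - p)) * b ^ k =
    1 / (t - p) * (1 / ((b - t) * (t - a))) * t ^ k + 1 / ((t - p) * (a - p) * (b - p)) * p ^ k := by
  field_simp
  interval_cases k <;> ring

/-- Bilinear interpolation, with the weights of x and y, between the identities for the four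
vertices of the quadrilateral. -/
lemma quadSquares_moment (h : IsArranged a b c t p q) (x y : ℝ) {k : ℕ} (hk : k < 3) :
    (quadSquares a b c t p q x y).A₁ * (quadSquares a b c t p q x y).A₂ * a ^ k +
      y * (quadSquares a b c t p q x y).B * b ^ k +
      (1 - y) * (quadSquares a b c t p q x y).C * c ^ k =
    (quadSquares a b c t p q x y).T₁ * (quadSquares a b c t p q x y).T₂ * t ^ k +
      x * (quadSquares a b c t p q x y).P * p ^ k +
      (1 - x) * (quadSquares a b c t p q x y).Q * q ^ k := by
  obtain ⟨⟨h1, h2⟩, ⟨h3, h4⟩, ⟨h5, h6⟩, ⟨h7, h8⟩, ⟨h9, h10⟩, ⟨h11, h12⟩, h13⟩ := h.ne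
  have e1 := four_point h1 h3 h7 h9 h11 h13 hk
  have e2 := four_point h1 h5 h7 h10 h12 h13 hk
  have e3 := four_point h2 h4 h8 h9 h11 h13 hk
  have e4 := four_point h2 h6 h8 h10 h12 h13 hk
  simp only [quadSquares, mixInv, div_eq_mul_one_div x, div_eq_mul_one_div y,
    div_eq_mul_one_div (1 - x), div_eq_mul_one_div (1 - y)]
  linear_combination x * y * e1 + x * (1 - y) * e2 + (1 - x) * y * e3 + (1 - x) * (1 - y) * e4

/-- Closed forms in terms of `X = p + (q - p) x` and `Y = b + (c - b) y`. -/
lemma quadSquares_eq (h : IsArranged a b c t p q) (x y : ℝ) :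
    (quadSquares a b c t p q x y).A₁ = (a - (p + (q - p) * x)) / ((a - p) * (a - q)) ∧
    (quadSquares a b c t p q x y).A₂ =
      (b + (c - b) * y - a) / ((b - a) * (c - a) * (t - a)) ∧
    (quadSquares a b c t p q x y).B =
      (b - (p + (q - p) * x)) / ((b - a) * (b - t) * (b - p) * (b - q)) ∧
    (quadSquares a b c t p q x y).C =
      (c - (p + (q - p) * x)) / ((c - a) * (c - t) * (c - p) * (c - q)) ∧
    (quadSquares a b c t p q x y).T₁ = (t - (p + (q - p) * x)) / ((t - p) * (t - q)) ∧
    (quadSquares a b c t p q x y).T₂ =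
      (b + (c - b) * y - t) / ((b - t) * (c - t) * (t - a)) ∧
    (quadSquares a b c t p q x y).P =
      (b + (c - b) * y - p) / ((t - p) * (a - p) * (b - p) * (c - p)) ∧
    (quadSquares a b c t p q x y).Q =
      (b + (c - b) * y - q) / ((t - q) * (a - q) * (b - q) * (c - q)) := by
  obtain ⟨⟨h1, h2⟩, ⟨h3, h4⟩, ⟨h5, h6⟩, ⟨h7, h8⟩, ⟨h9, h10⟩, ⟨h11, h12⟩, h13⟩ := h.ne
  have key : ∀ {x u v k z : ℝ}, u ≠ 0 → v ≠ 0 → k ≠ 0 → u - x * (u - v) = z →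
      mixInv x (k * u) (k * v) = z / (k * u * v) := by
    intro x u v k z hu hv hk hz
    rw [mixInv_eq (mul_ne_zero hk hu) (mul_ne_zero hk hv), div_eq_div_iff
      (mul_ne_zero (mul_ne_zero hk hu) (mul_ne_zero hk hv)) (mul_ne_zero (mul_ne_zero hk hu) hv), ← hz]
    ring
  refine ⟨?_, ?_, key h3 h4 (mul_ne_zero h9 h11) (by ring), key h5 h6 (mul_ne_zero h10 h12) (by ring),
    ?_, ?_, key h3 h5 (mul_ne_zero h7 h1) (by ring), key h4 h6 (mul_ne_zero h8 h2) (by ring)⟩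
  · have := key (x := x) h1 h2 one_ne_zero rfl
    simp only [one_mul] at this
    rw [quadSquares, this]
    ring
  · have := key (x := y) h9 h10 h13 rfl
    rw [quadSquares]
    simp only [mul_comm _ (t - a)]
    rw [this, mul_assoc]
    congr 1
    ring
  · have := key (x := x) h7 h8 one_ne_zero rfl
    simp only [one_mul] at this
    rw [quadSquares]
    simp only [this]
    congr 1
    ring
  · have := key (x := y) h11 h12 h13 rfl
    rw [quadSquares]
    simp only [mul_comm _ (t - a)]
    rw [this, mul_assoc]
    congr 1
    ring

end IsArranged

lemma exists_root_of_nonpos_of_nonneg {f : ℝ → ℝ} (hf : Continuous f) {u v : ℝ} (huv : u ≤ v)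
    (h : f u ≤ 0 ∧ 0 ≤ f v ∨ 0 ≤ f u ∧ f v ≤ 0) : ∃ r, u ≤ r ∧ r ≤ v ∧ f r = 0 := by
  rcases h with h | h
  · obtain ⟨r, hr, hr0⟩ := intermediate_value_Icc huv hf.continuousOn h
    exact ⟨r, hr.1, hr.2, hr0⟩
  · obtain ⟨r, hr, hr0⟩ := intermediate_value_Icc' huv hf.continuousOn ⟨h.2, h.1⟩
    exact ⟨r, hr.1, hr.2, hr0⟩

/-- The Bezoutian of the two cubic polynomials with the roots `a, b, c` and `t, p, q`, written in
terms of the roots of either of them. -/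
lemma bezout_eq {a b c t p q Ua Ub Uc Wt Wp Wq : ℝ} (X : ℝ) (h0 : Ua + Ub + Uc = Wt + Wp + Wq)
    (h1 : a * Ua + b * Ub + c * Uc = t * Wt + p * Wp + q * Wq)
    (h2 : a ^ 2 * Ua + b ^ 2 * Ub + c ^ 2 * Uc = t ^ 2 * Wt + p ^ 2 * Wp + q ^ 2 * Wq) :
    ((a - p) * (a - q) * (a - t) * Ua + (b - p) * (b - q) * (b - t) * Ub +
        (c - p) * (c - q) * (c - t) * Uc) * (X - b) * (X - c) +
      (b - a) * (b - t) * (b - p) * (b - q) * Ub * (X - c) +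
      (c - a) * (c - t) * (c - p) * (c - q) * Uc * (X - b) =
    ((a - p) * (a - q) * (a - t) * Ua + (b - p) * (b - q) * (b - t) * Ub +
        (c - p) * (c - q) * (c - t) * Uc) * (X - p) * (X - q) -
      (t - p) * (a - p) * (b - p) * (c - p) * Wp * (X - q) -
      (t - q) * (a - q) * (b - q) * (c - q) * Wq * (X - p) := by
  obtain ⟨k₂, hk₂⟩ : ∃ k₂, k₂ = (((-(t + p + q)) - (-(a + b + c))) * X ^ 2 + ((t * p + p * q + q * t) -
    (a * b + b * c + c * a)) * X + ((-(t * p * q)) - (-(a * b * c)))) -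
    ((-(t + p + q)) - (-(a + b + c))) * (X - p) * (X - q) := ⟨_, rfl⟩
  obtain ⟨k₁, hk₁⟩ : ∃ k₁, k₁ = ((t * p + p * q + q * t) - (a * b + b * c + c * a)) * X ^ 2 +
    (((-(t * p * q)) - (-(a * b * c))) + ((-(a + b + c)) * (t * p + p * q + q * t) -
    (a * b + b * c + c * a) * (-(t + p + q)))) * X + ((-(a + b + c)) * (-(t * p * q)) -
    (-(a * b * c)) * (-(t + p + q))) - ((t * p + p * q + q * t) - (a * b + b * c + c * a)) *
    (X - p) * (X - q) := ⟨_, rfl⟩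
  obtain ⟨k₀, hk₀⟩ : ∃ k₀, k₀ = ((-(t * p * q)) - (-(a * b * c))) * X ^ 2 +
    ((-(a + b + c)) * (-(t * p * q)) - (-(a * b * c)) * (-(t + p + q))) * X +
    ((a * b + b * c + c * a) * (-(t * p * q)) - (-(a * b * c)) * (t * p + p * q + q * t)) -
    ((-(t * p * q)) - (-(a * b * c))) * (X - p) * (X - q) := ⟨_, rfl⟩
  -- One quadratic polynomial k₂Z² + k₁Z + k₀ takes the prescribed value at each of the six nodes,
  -- so the identity is a combination of the three moment equations.
  have ea : (a - p) * (a - q) * (a - t) * ((X - b) * (X - c) - (X - p) * (X - q)) =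
      k₂ * a ^ 2 + k₁ * a + k₀ := by
    rw [hk₂, hk₁, hk₀]
    ring
  have eb : (b - p) * (b - q) * (b - t) * ((X - a) * (X - c) - (X - p) * (X - q)) =
      k₂ * b ^ 2 + k₁ * b + k₀ := by
    rw [hk₂, hk₁, hk₀]
    ring
  have ec : (c - p) * (c - q) * (c - t) * ((X - a) * (X - b) - (X - p) * (X - q)) =
      k₂ * c ^ 2 + k₁ * c + k₀ := by
    rw [hk₂, hk₁, hk₀]
    ring
  have et : 0 = k₂ * t ^ 2 + k₁ * t + k₀ := by
    rw [hk₂, hk₁, hk₀]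
    ring
  have ep : -((t - p) * (a - p) * (b - p) * (c - p) * (X - q)) = k₂ * p ^ 2 + k₁ * p + k₀ := by
    rw [hk₂, hk₁, hk₀]
    ring
  have eq : -((t - q) * (a - q) * (b - q) * (c - q) * (X - p)) = k₂ * q ^ 2 + k₁ * q + k₀ := by
    rw [hk₂, hk₁, hk₀]
    ring
  clear hk₂ hk₁ hk₀
  linear_combination k₂ * h2 + k₁ * h1 + k₀ * h0 + Ua * ea + Ub * eb + Uc * ec - Wt * et - Wp * ep -
    Wq * eq

namespace IsArranged

variable {a b c t p q : ℝ}

lemma signs_between (h : IsArranged a b c t p q) {X Y : ℝ} (_hpX : p ≤ X) (hXq : X ≤ q)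
    (hbY : b ≤ Y) (hYc : Y ≤ c) :
    (0 < a - X ∧ 0 < b - X ∧ 0 < c - X ∧ 0 < t - X) ∧ (0 < Y - p ∧ 0 < Y - q) ∧ 0 < Y - X ∧
    0 < (Y - a) * (t - a) ∧ 0 < (Y - t) * (t - a) := by
  obtain ⟨⟨h1, h2⟩, ⟨h3, h4⟩, ⟨h5, h6⟩, ⟨h7, h8⟩, -⟩ := h.signs
  refine ⟨⟨by linarith, by linarith, by linarith, by linarith⟩, ⟨by linarith, by linarith⟩,
    by linarith, ?_⟩
  rcases h.order with ⟨h9, h10, h11⟩ | ⟨h9, h10, h11⟩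
  · exact ⟨mul_pos (by linarith) (by linarith), mul_pos (by linarith) (by linarith)⟩
  · exact ⟨mul_pos_of_neg_of_neg (by linarith) (by linarith),
      mul_pos_of_neg_of_neg (by linarith) (by linarith)⟩

set_option maxHeartbeats 4000000 in
-- The parameters are read off from the zeros of a quadratic polynomial: its values at the six nodes
-- are known multiples of the six masses, so its two roots and its leading coefficient determine all
-- of them.
lemma exists_quadSquares (h : IsArranged a b c t p q) {Ua Ub Uc Wt Wp Wq : ℝ}
    (hUa : 0 ≤ Ua) (hUb : 0 ≤ Ub) (hUc : 0 ≤ Uc) (hWp : 0 ≤ Wp) (hWq : 0 ≤ Wq)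
    (hU : Ua + Ub + Uc ≠ 0) (h0 : Ua + Ub + Uc = Wt + Wp + Wq)
    (h1 : a * Ua + b * Ub + c * Uc = t * Wt + p * Wp + q * Wq)
    (h2 : a ^ 2 * Ua + b ^ 2 * Ub + c ^ 2 * Uc = t ^ 2 * Wt + p ^ 2 * Wp + q ^ 2 * Wq) :
    ∃ m x y, 0 < m ∧ (0 ≤ x ∧ x ≤ 1) ∧ (0 ≤ y ∧ y ≤ 1) ∧
      Ua = m * ((quadSquares a b c t p q x y).A₁ * (quadSquares a b c t p q x y).A₂) ∧
      Ub = m * (y * (quadSquares a b c t p q x y).B) ∧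
      Uc = m * ((1 - y) * (quadSquares a b c t p q x y).C) ∧
      Wt = m * ((quadSquares a b c t p q x y).T₁ * (quadSquares a b c t p q x y).T₂) ∧
      Wp = m * (x * (quadSquares a b c t p q x y).P) ∧
      Wq = m * ((1 - x) * (quadSquares a b c t p q x y).Q) := by
  obtain ⟨⟨sap, saq⟩, ⟨sbp, sbq⟩, ⟨scp, scq⟩, ⟨stp, stq⟩, ⟨sba, sca⟩, ⟨sbt, sct⟩, ⟨sb, sc⟩⟩ :=
    h.signs
  have hne := h.ne
  obtain ⟨⟨nap, naq⟩, ⟨nbp, nbq⟩, ⟨ncp, ncq⟩, ⟨ntp, ntq⟩, ⟨nba, nca⟩, ⟨nbt, nct⟩, nta⟩ := h.ne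
  obtain ⟨kb, hkb⟩ : ∃ kb, kb = (b - a) * (b - t) * (b - p) * (b - q) := ⟨_, rfl⟩
  obtain ⟨kc, hkc⟩ : ∃ kc, kc = (c - a) * (c - t) * (c - p) * (c - q) := ⟨_, rfl⟩
  obtain ⟨kp, hkp⟩ : ∃ kp, kp = (t - p) * (a - p) * (b - p) * (c - p) := ⟨_, rfl⟩
  obtain ⟨kq, hkq⟩ : ∃ kq, kq = (t - q) * (a - q) * (b - q) * (c - q) := ⟨_, rfl⟩
  have hkb0 : 0 < kb := hkb ▸ by positivity
  have hkc0 : 0 < kc := hkc ▸ by positivity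
  have hkp0 : 0 < kp := hkp ▸ by positivity
  have hkq0 : 0 < kq := hkq ▸ by positivity
  obtain ⟨m, hm⟩ : ∃ m, m = (a - p) * (a - q) * (a - t) * Ua + (b - p) * (b - q) * (b - t) * Ub +
    (c - p) * (c - q) * (c - t) * Uc := ⟨_, rfl⟩
  -- The numerator of ∑ U_i/(Z - a_i) - ∑ W_j/(Z - t_j) over the product of the six linear factors.
  -- Equality of three moments lowers its degree to 2, with leading coefficient m.
  let f : ℝ → ℝ := fun X => m * (X - b) * (X - c) + kb * Ub * (X - c) + kc * Uc * (X - b)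
  have hf : ∀ X, f X = m * (X - b) * (X - c) + kb * Ub * (X - c) + kc * Uc * (X - b) := fun _ => rfl
  -- the Bezoutian of the two cubic polynomials
  have hf' : ∀ X, f X = m * (X - p) * (X - q) - kp * Wp * (X - q) - kq * Wq * (X - p) := by
    intro X
    rw [hf, hm, hkb, hkc, hkp, hkq]
    exact bezout_eq X h0 h1 h2
  -- The nonnegative masses give f p ≥ 0 ≥ f q and, below, f b ≤ 0 ≤ f c. The intervals [p, q] and
  -- [b, c] are disjoint, so these are both roots of f.
  obtain ⟨X, hpX, hXq, hX⟩ := exists_root_of_nonpos_of_nonneg (f := f) (by fun_prop) h.pq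
    (Or.inr ⟨by
        have := mul_nonneg (mul_nonneg hkp0.le hWp) (sub_nonneg.2 h.pq)
        rw [hf']
        linear_combination this, by
        have := mul_nonneg (mul_nonneg hkq0.le hWq) (sub_nonneg.2 h.pq)
        rw [hf']
        linear_combination this⟩)
  obtain ⟨Y, hbY, hYc, hY⟩ := exists_root_of_nonpos_of_nonneg (f := f) (by fun_prop) h.bc
    (Or.inl ⟨by
        have := mul_nonneg (mul_nonneg hkb0.le hUb) (sub_nonneg.2 h.bc)
        rw [hf]
        linear_combination this, by
        have := mul_nonneg (mul_nonneg hkc0.le hUc) (sub_nonneg.2 h.bc)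
        rw [hf]
        linear_combination this⟩)
  obtain ⟨⟨hXa, hXb, hXc, hXt⟩, ⟨hYp, hYq⟩, hXY, hYa, hYt⟩ := h.signs_between hpX hXq hbY hYc
  have hfac : ∀ Z, f Z = m * (Z - X) * (Z - Y) := by
    intro Z
    rw [hf] at hX hY ⊢
    refine mul_left_cancel₀ hXY.ne' ?_
    linear_combination (Z - X) * hY + (Y - Z) * hX
  have hfa : m * ((a - X) * ((Y - a) * (t - a))) =
      ((b - a) * (t - a)) * ((c - a) * (t - a)) * ((a - p) * (a - q)) * Ua := by
    have e := hfac a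
    rw [hf, hkb, hkc, hm] at e
    rw [hm]
    linear_combination (t - a) * e
  -- The value of f at a excludes m < 0. For m = 0 it gives Ua = 0, and then f is zero identically,
  -- which leaves no mass at b and c either.
  have hm0 : 0 < m := by
    have hm1 : 0 ≤ m := by
      by_contra hm1
      have : m * ((a - X) * ((Y - a) * (t - a))) < 0 :=
        mul_neg_of_neg_of_pos (not_le.1 hm1) (by positivity)
      have : 0 ≤ ((b - a) * (t - a)) * ((c - a) * (t - a)) * ((a - p) * (a - q)) * Ua := by positivity
      linarith
    refine lt_of_le_of_ne hm1 fun hm2 => hU ?_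
    rw [← hm2, zero_mul] at hfa
    have hUa0 : Ua = 0 := by
      have : ((b - a) * (t - a)) * ((c - a) * (t - a)) * ((a - p) * (a - q)) ≠ 0 := by positivity
      exact (mul_eq_zero.1 hfa.symm).resolve_left this
    have e1 := hfac (b + 1)
    have e2 := hfac b
    rw [hf, ← hm2] at e1 e2
    have e3 : kb * Ub + kc * Uc = 0 := by linarith
    have e4 : 0 ≤ kb * Ub := by positivity
    have e5 : 0 ≤ kc * Uc := by positivity
    have e6 : Ub = 0 := (mul_eq_zero.1 (by linarith : kb * Ub = 0)).resolve_left hkb0.ne'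
    have e7 : Uc = 0 := (mul_eq_zero.1 (by linarith : kc * Uc = 0)).resolve_left hkc0.ne'
    rw [hUa0, e6, e7]
    simp
  -- This is (Y - b) / (c - b), written so that it makes sense for b = c; likewise x is (X - p) / (q
  -- - p), also when p = q.
  obtain ⟨y, hy⟩ : ∃ y, y = kb * Ub / (m * (b - X)) := ⟨_, rfl⟩
  obtain ⟨x, hx⟩ : ∃ x, x = kp * Wp / (m * (Y - p)) := ⟨_, rfl⟩
  have hy' : 1 - y = kc * Uc / (m * (c - X)) := by
    rw [hf] at hX
    rw [hy, eq_div_iff (by positivity)]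
    have hbX : b - X ≠ 0 := hXb.ne'
    field_simp
    linear_combination hX
  have hx' : 1 - x = kq * Wq / (m * (Y - q)) := by
    rw [hf'] at hY
    rw [hx, eq_div_iff (by positivity)]
    have hbX : Y - p ≠ 0 := hYp.ne'
    field_simp
    linear_combination hY
  have hy0 : 0 ≤ y := hy ▸ by positivity
  have hy1 : 0 ≤ 1 - y := hy' ▸ by positivity
  have hx0 : 0 ≤ x := hx ▸ by positivity
  have hx1 : 0 ≤ 1 - x := hx' ▸ by positivity
  have hYy : b + (c - b) * y = Y := by
    have e := hfac b
    rw [hf] at e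
    rw [hy]
    have hbX : b - X ≠ 0 := hXb.ne'
    field_simp
    linear_combination -e
  have hXx : p + (q - p) * x = X := by
    have e := hfac p
    rw [hf'] at e
    rw [hx]
    have hbX : Y - p ≠ 0 := hYp.ne'
    field_simp
    linear_combination e
  obtain ⟨g1, g2, g3, g4, g5, g6, g7, g8⟩ := h.quadSquares_eq x y
  rw [hYy] at g2 g6 g7 g8
  rw [hXx] at g1 g3 g4 g5
  refine ⟨m, x, y, hm0, ⟨hx0, by linarith⟩, ⟨hy0, by linarith⟩, ?_, ?_, ?_, ?_, ?_, ?_⟩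
  · rw [g1, g2, div_mul_div_comm, mul_div_assoc', eq_div_iff (by
      exact mul_ne_zero (mul_ne_zero nap naq) (mul_ne_zero (mul_ne_zero nba nca) nta))]
    refine mul_right_cancel₀ nta ?_
    linear_combination -hfa
  · rw [g3, hy, ← hkb]
    field_simp
  · rw [g4, hy', ← hkc]
    field_simp
  · have hft : m * ((t - X) * (Y - t)) = ((t - p) * (t - q)) * ((b - t) * (c - t) * (t - a)) * Wt := by
      have e2 : m = -((t - a) * (t - b) * (t - c) * Wt + (p - a) * (p - b) * (p - c) * Wp +
        (q - a) * (q - b) * (q - c) * Wq) := by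
        rw [hm]
        linear_combination ((-(t + p + q)) - (-(a + b + c))) * h2 + ((t * p + p * q + q * t) - (a * b + b * c + c * a)) * h1 + ((-(t * p * q)) - (-(a * b * c))) * h0
      have e3 := hf' t
      rw [hfac, hkp, hkq] at e3
      linear_combination -e3 - (t - p) * (t - q) * e2
    rw [g5, g6, div_mul_div_comm, mul_div_assoc', eq_div_iff (by
      exact mul_ne_zero (mul_ne_zero ntp ntq) (mul_ne_zero (mul_ne_zero nbt nct) nta))]
    linear_combination -hft
  · rw [g7, hx, ← hkp]
    field_simp
  · rw [g8, hx', ← hkq]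
    field_simp

end IsArranged

/-! ### The orthogonal matrix determined by two pairs of vectors -/

lemma transpose_mulVec_cross (M : Matrix (Fin 3) (Fin 3) ℝ) (v w : Vec3) :
    Mᵀ *ᵥ ((M *ᵥ v) ⨯₃ (M *ᵥ w)) = M.det • (v ⨯₃ w) := by
  ext i
  fin_cases i <;>
  · simp [cross_apply, Matrix.mulVec, dotProduct, Fin.sum_univ_three, Matrix.det_fin_three]
    ring

lemma det_sq_of_mul_transpose {O : Matrix (Fin 3) (Fin 3) ℝ} (hO : O * Oᵀ = 1) : O.det ^ 2 = 1 := by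
  have := congrArg Matrix.det hO
  rwa [Matrix.det_mul, Matrix.det_transpose, Matrix.det_one, ← sq] at this

lemma mulVec_cross {O : Matrix (Fin 3) (Fin 3) ℝ} (hO : O * Oᵀ = 1) (v w : Vec3) :
    O *ᵥ (v ⨯₃ w) = O.det • ((O *ᵥ v) ⨯₃ (O *ᵥ w)) := by
  have h := congrArg (fun z => O.det • (O *ᵥ z)) (transpose_mulVec_cross O v w)
  simp only [Matrix.mulVec_mulVec, hO, Matrix.one_mulVec, Matrix.mulVec_smul, smul_smul, ← sq,
    det_sq_of_mul_transpose hO, one_smul] at h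
  exact h.symm

lemma eq_zero_of_dotProduct_cross {v w z : Vec3} (hvw : v ⨯₃ w ≠ 0) (h1 : z ⬝ᵥ v = 0)
    (h2 : z ⬝ᵥ w = 0) (h3 : z ⬝ᵥ (v ⨯₃ w) = 0) : z = 0 := by
  have h4 : z ⨯₃ (v ⨯₃ w) = 0 := by
    rw [cross_cross_eq_smul_sub_smul']
    simp [dotProduct_comm v z, h1, h2]
  have h5 := cross_dot_cross z (v ⨯₃ w) z (v ⨯₃ w)
  rw [h4, h3, zero_dotProduct, zero_mul, sub_zero] at h5
  rcases mul_eq_zero.1 h5.symm with h | h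
  · exact dotProduct_self_eq_zero.1 h
  · exact absurd (dotProduct_self_eq_zero.1 h) hvw

/-- The matrix that maps `v₁` to `w₁`, `v₂` to `w₂` and `v₂ × v₁` to `η w₂ × w₁`. -/
def pairMatrix (v₁ v₂ w₁ w₂ : Vec3) (η : ℝ) : Matrix (Fin 3) (Fin 3) ℝ :=
  -- The coefficients in the plane are those of the inverse Gram matrix of v₁, v₂, whose determinant
  -- is |v₂ × v₁|².
  ((v₂ ⨯₃ v₁) ⬝ᵥ (v₂ ⨯₃ v₁))⁻¹ • ((v₂ ⬝ᵥ v₂) • Matrix.vecMulVec w₁ v₁ -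
    (v₁ ⬝ᵥ v₂) • (Matrix.vecMulVec w₁ v₂ + Matrix.vecMulVec w₂ v₁) +
    (v₁ ⬝ᵥ v₁) • Matrix.vecMulVec w₂ v₂ + η • Matrix.vecMulVec (w₂ ⨯₃ w₁) (v₂ ⨯₃ v₁))

section pairMatrix

variable {v₁ v₂ w₁ w₂ : Vec3} {η : ℝ}

lemma pairMatrix_mulVec (hv : v₂ ⨯₃ v₁ ≠ 0) :
    pairMatrix v₁ v₂ w₁ w₂ η *ᵥ v₁ = w₁ ∧ pairMatrix v₁ v₂ w₁ w₂ η *ᵥ v₂ = w₂ ∧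
    pairMatrix v₁ v₂ w₁ w₂ η *ᵥ (v₂ ⨯₃ v₁) = η • (w₂ ⨯₃ w₁) := by
  have hD : (v₂ ⨯₃ v₁) ⬝ᵥ (v₂ ⨯₃ v₁) ≠ 0 := fun h => hv (dotProduct_self_eq_zero.1 h)
  have hD' := cross_dot_cross v₂ v₁ v₂ v₁
  have h1 : (v₂ ⨯₃ v₁) ⬝ᵥ v₁ = 0 := by rw [dotProduct_comm, dot_cross_self]
  have h2 : (v₂ ⨯₃ v₁) ⬝ᵥ v₂ = 0 := by rw [dotProduct_comm, dot_self_cross]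
  have h3 : v₁ ⬝ᵥ (v₂ ⨯₃ v₁) = 0 := by rw [dot_cross_self]
  have h4 : v₂ ⬝ᵥ (v₂ ⨯₃ v₁) = 0 := by rw [dot_self_cross]
  obtain ⟨D, hDD⟩ : ∃ D, D = (v₂ ⨯₃ v₁) ⬝ᵥ (v₂ ⨯₃ v₁) := ⟨_, rfl⟩
  obtain ⟨n, hn⟩ : ∃ n, n = v₂ ⨯₃ v₁ := ⟨_, rfl⟩
  rw [← hn] at h1 h2 h3 h4 hD hD' hDD ⊢
  rw [← hDD] at hD'
  rw [← hDD] at hD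
  have h5 := dotProduct_comm v₂ v₁
  rw [h5] at hD'
  simp only [pairMatrix, ← hn, ← hDD]
  refine ⟨?_, ?_, ?_⟩ <;>
  · simp only [Matrix.smul_mulVec, Matrix.add_mulVec, Matrix.sub_mulVec, Matrix.vecMulVec_mulVec,
      h1, h2, h3, h4, h5, ← hDD]
    ext i
    simp only [Pi.smul_apply, Pi.add_apply, Pi.sub_apply, smul_eq_mul, MulOpposite.smul_eq_mul_unop,
      MulOpposite.unop_op]
    field_simp
    try rw [hD']
    try ring

lemma eq_of_mulVec_eq {O O' : Matrix (Fin 3) (Fin 3) ℝ} (hv : v₂ ⨯₃ v₁ ≠ 0)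
    (h1 : O *ᵥ v₁ = O' *ᵥ v₁) (h2 : O *ᵥ v₂ = O' *ᵥ v₂)
    (h3 : O *ᵥ (v₂ ⨯₃ v₁) = O' *ᵥ (v₂ ⨯₃ v₁)) : O = O' := by
  have key : ∀ i, (O - O') i = 0 := by
    intro i
    refine eq_zero_of_dotProduct_cross hv ?_ ?_ ?_
    · have := congrFun (sub_eq_zero.2 h2) i
      rwa [← Matrix.sub_mulVec] at this
    · have := congrFun (sub_eq_zero.2 h1) i
      rwa [← Matrix.sub_mulVec] at this
    · have := congrFun (sub_eq_zero.2 h3) i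
      rwa [← Matrix.sub_mulVec] at this
  exact sub_eq_zero.1 (funext key)

lemma eq_pairMatrix {O : Matrix (Fin 3) (Fin 3) ℝ} (hO : O * Oᵀ = 1) (hv : v₂ ⨯₃ v₁ ≠ 0)
    (h1 : O *ᵥ v₁ = w₁) (h2 : O *ᵥ v₂ = w₂) : O = pairMatrix v₁ v₂ w₁ w₂ O.det := by
  obtain ⟨h3, h4, h5⟩ := pairMatrix_mulVec (w₁ := w₁) (w₂ := w₂) (η := O.det) hv
  refine eq_of_mulVec_eq hv (by rw [h1, h3]) (by rw [h2, h4]) ?_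
  rw [h5, mulVec_cross hO, h1, h2]

/-- Equal Gram matrices of the pairs give equal lengths of the vector products, so the matrix
preserves scalar products on the basis v₁, v₂, v₂ × v₁. Its action on the third vector shows that η
is the determinant. -/
lemma pairMatrix_mul_transpose (hv : v₂ ⨯₃ v₁ ≠ 0) (h11 : w₁ ⬝ᵥ w₁ = v₁ ⬝ᵥ v₁)
    (h12 : w₁ ⬝ᵥ w₂ = v₁ ⬝ᵥ v₂) (h22 : w₂ ⬝ᵥ w₂ = v₂ ⬝ᵥ v₂) (hη : η ^ 2 = 1) :
    pairMatrix v₁ v₂ w₁ w₂ η * (pairMatrix v₁ v₂ w₁ w₂ η)ᵀ = 1 ∧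
    (pairMatrix v₁ v₂ w₁ w₂ η).det = η := by
  obtain ⟨h3, h4, h5⟩ := pairMatrix_mulVec (w₁ := w₁) (w₂ := w₂) (η := η) hv
  set O := pairMatrix v₁ v₂ w₁ w₂ η with hOdef
  have hD := cross_dot_cross v₂ v₁ v₂ v₁
  have hDw := cross_dot_cross w₂ w₁ w₂ w₁
  rw [dotProduct_comm w₂ w₁, h11, h12, h22] at hDw
  rw [dotProduct_comm v₂ v₁] at hD
  rw [← hD] at hDw
  have h6 : w₁ ⬝ᵥ (w₂ ⨯₃ w₁) = 0 := by rw [dot_cross_self]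
  have h7 : w₂ ⬝ᵥ (w₂ ⨯₃ w₁) = 0 := by rw [dot_self_cross]
  have h6' : v₁ ⬝ᵥ (v₂ ⨯₃ v₁) = 0 := by rw [dot_cross_self]
  have h7' : v₂ ⬝ᵥ (v₂ ⨯₃ v₁) = 0 := by rw [dot_self_cross]
  have h8' : (v₂ ⨯₃ v₁) ⬝ᵥ v₂ = 0 := by rw [dotProduct_comm, h7']
  have hmul : ∀ x y : Vec3, ((Oᵀ * O) *ᵥ x) ⬝ᵥ y = (O *ᵥ x) ⬝ᵥ (O *ᵥ y) := by
    intro x y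
    rw [← Matrix.mulVec_mulVec, Matrix.mulVec_transpose, ← Matrix.dotProduct_mulVec]
  have key : ∀ x, (∀ y ∈ ({v₁, v₂, v₂ ⨯₃ v₁} : Set Vec3), (O *ᵥ x) ⬝ᵥ (O *ᵥ y) = x ⬝ᵥ y) →
      (Oᵀ * O) *ᵥ x = (1 : Matrix (Fin 3) (Fin 3) ℝ) *ᵥ x := by
    intro x hx
    rw [Matrix.one_mulVec, ← sub_eq_zero]
    refine eq_zero_of_dotProduct_cross hv ?_ ?_ ?_ <;> rw [sub_dotProduct, hmul, sub_eq_zero] <;>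
      exact hx _ (by simp)
  have hO : Oᵀ * O = 1 := by
    refine eq_of_mulVec_eq hv (key _ ?_) (key _ ?_) (key _ ?_) <;>
    · simp only [Set.mem_insert_iff, Set.mem_singleton_iff, forall_eq_or_imp, forall_eq, h3, h4, h5]
      refine ⟨?_, ?_, ?_⟩ <;>
        simp [h6, h7, h6', h7', h8', h11, h12, h22, dotProduct_comm _ w₁, dotProduct_comm _ w₂,
          dotProduct_comm _ v₁, hDw, ← mul_assoc, ← sq, hη, smul_dotProduct, dotProduct_smul]
  have hO' : O * Oᵀ = 1 := mul_eq_one_comm.1 hO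
  refine ⟨hO', ?_⟩
  have h8 := mulVec_cross hO' v₂ v₁
  rw [h3, h4, h5] at h8
  by_contra hne
  have h9 : w₂ ⨯₃ w₁ = 0 := by
    have : (η - O.det) • (w₂ ⨯₃ w₁) = 0 := by rw [sub_smul, h8, sub_self]
    exact (smul_eq_zero.1 this).resolve_left (sub_ne_zero.2 (Ne.symm hne))
  rw [h9, zero_dotProduct] at hDw
  exact hv (dotProduct_self_eq_zero.1 hDw.symm)

end pairMatrix

/-! ### The points of the quadrilateral as functions of two angles -/

/-- The squares of the coordinates as functions of two angles. -/
def quadAngles (a b c t p q ψ φ : ℝ) : QuadSquares :=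
  quadSquares a b c t p q (Real.sin ψ ^ 2) (Real.sin φ ^ 2)

/-- A vector the squares of whose coordinates are the first three ones of the quadrilateral. -/
def leftVec (a b c t p q ε ψ φ : ℝ) : Vec3 :=
  ![ε * (√(quadAngles a b c t p q ψ φ).A₁ * √(quadAngles a b c t p q ψ φ).A₂),
    Real.sin φ * √(quadAngles a b c t p q ψ φ).B, Real.cos φ * √(quadAngles a b c t p q ψ φ).C]

/-- A vector the squares of whose coordinates are the last three ones of the quadrilateral. -/
def rightVec (a b c t p q ε ψ φ : ℝ) : Vec3 :=
  ![ε * (√(quadAngles a b c t p q ψ φ).T₁ * √(quadAngles a b c t p q ψ φ).T₂),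
    Real.sin ψ * √(quadAngles a b c t p q ψ φ).P, Real.cos ψ * √(quadAngles a b c t p q ψ φ).Q]

/-- The value at `u + (v - u) sin² θ`. -/
def sinMix (u v θ : ℝ) : ℝ := u + (v - u) * Real.sin θ ^ 2

lemma sinMix_mem {u v : ℝ} (h : u ≤ v) (θ : ℝ) : u ≤ sinMix u v θ ∧ sinMix u v θ ≤ v := by
  have h1 := sq_nonneg (Real.sin θ)
  have h2 := Real.sin_sq_le_one θ
  rw [sinMix]
  constructor
  · nlinarith
  · nlinarith

lemma hasDerivAt_sinMix {θ : ℝ → ℝ} {θ' τ : ℝ} (h : HasDerivAt θ θ' τ) (u v : ℝ) :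
    HasDerivAt (fun τ => sinMix u v (θ τ))
      (2 * ((v - u) * (Real.sin (θ τ) * Real.cos (θ τ)) * θ')) τ := by
  have := ((h.sin.fun_pow 2).const_mul (v - u)).const_add u
  refine this.congr_deriv ?_
  push_cast
  ring

lemma hasDerivAt_sqrt_div {f X : ℝ → ℝ} {X' z k τ : ℝ} (hX : HasDerivAt X X' τ)
    (hf : ∀ τ, f τ = (z - X τ) / k) (h0 : 0 < f τ) :
    HasDerivAt (fun τ => √(f τ)) (-(X' / (2 * k * √(f τ)))) τ := by
  have h1 : HasDerivAt f (-X' / k) τ := by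
    have := (hX.const_sub z).div_const k
    exact this.congr_of_eventuallyEq (Filter.Eventually.of_forall fun τ => hf τ)
  refine (h1.sqrt h0.ne').congr_deriv ?_
  rw [neg_div, neg_div, div_div]
  ring_nf

namespace IsArranged

variable {a b c t p q : ℝ}

lemma quadAngles_pos (h : IsArranged a b c t p q) (ψ φ : ℝ) :
    (0 < (quadAngles a b c t p q ψ φ).A₁ ∧ 0 < (quadAngles a b c t p q ψ φ).A₂) ∧
    (0 < (quadAngles a b c t p q ψ φ).B ∧ 0 < (quadAngles a b c t p q ψ φ).C) ∧
    (0 < (quadAngles a b c t p q ψ φ).T₁ ∧ 0 < (quadAngles a b c t p q ψ φ).T₂) ∧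
    (0 < (quadAngles a b c t p q ψ φ).P ∧ 0 < (quadAngles a b c t p q ψ φ).Q) :=
  h.quadSquares_pos (sq_nonneg _) (Real.sin_sq_le_one _) (sq_nonneg _) (Real.sin_sq_le_one _)

/-- Closed forms, as quotients of linear functions of `sinMix p q ψ` and `sinMix b c φ`. -/
lemma quadAngles_eq (h : IsArranged a b c t p q) (ψ φ : ℝ) :
    (quadAngles a b c t p q ψ φ).A₁ = (a - sinMix p q ψ) / ((a - p) * (a - q)) ∧
    (quadAngles a b c t p q ψ φ).A₂ =
      (a - sinMix b c φ) / (-((b - a) * (c - a) * (t - a))) ∧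
    (quadAngles a b c t p q ψ φ).B =
      (b - sinMix p q ψ) / ((b - a) * (b - t) * (b - p) * (b - q)) ∧
    (quadAngles a b c t p q ψ φ).C =
      (c - sinMix p q ψ) / ((c - a) * (c - t) * (c - p) * (c - q)) ∧
    (quadAngles a b c t p q ψ φ).T₁ = (t - sinMix p q ψ) / ((t - p) * (t - q)) ∧
    (quadAngles a b c t p q ψ φ).T₂ =
      (t - sinMix b c φ) / (-((b - t) * (c - t) * (t - a))) ∧
    (quadAngles a b c t p q ψ φ).P =
      (p - sinMix b c φ) / (-((t - p) * (a - p) * (b - p) * (c - p))) ∧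
    (quadAngles a b c t p q ψ φ).Q =
      (q - sinMix b c φ) / (-((t - q) * (a - q) * (b - q) * (c - q))) := by
  obtain ⟨h1, h2, h3, h4, h5, h6, h7, h8⟩ := h.quadSquares_eq (Real.sin ψ ^ 2) (Real.sin φ ^ 2)
  refine ⟨h1, ?_, h3, h4, h5, ?_, ?_, ?_⟩
  · rw [div_neg, ← neg_div, neg_sub]
    exact h2
  · rw [div_neg, ← neg_div, neg_sub]
    exact h6
  · rw [div_neg, ← neg_div, neg_sub]
    exact h7
  · rw [div_neg, ← neg_div, neg_sub]
    exact h8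

lemma leftVec_sq (h : IsArranged a b c t p q) {ε : ℝ} (hε : ε ^ 2 = 1) (ψ φ : ℝ) :
    leftVec a b c t p q ε ψ φ 0 ^ 2 =
      (quadAngles a b c t p q ψ φ).A₁ * (quadAngles a b c t p q ψ φ).A₂ ∧
    leftVec a b c t p q ε ψ φ 1 ^ 2 = Real.sin φ ^ 2 * (quadAngles a b c t p q ψ φ).B ∧
    leftVec a b c t p q ε ψ φ 2 ^ 2 = (1 - Real.sin φ ^ 2) * (quadAngles a b c t p q ψ φ).C := by
  obtain ⟨⟨h1, h2⟩, ⟨h3, h4⟩, -⟩ := h.quadAngles_pos ψ φ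
  rw [← Real.cos_sq']
  simp [leftVec, mul_pow, Real.sq_sqrt, h1.le, h2.le, h3.le, h4.le, hε]

lemma rightVec_sq (h : IsArranged a b c t p q) {ε : ℝ} (hε : ε ^ 2 = 1) (ψ φ : ℝ) :
    rightVec a b c t p q ε ψ φ 0 ^ 2 =
      (quadAngles a b c t p q ψ φ).T₁ * (quadAngles a b c t p q ψ φ).T₂ ∧
    rightVec a b c t p q ε ψ φ 1 ^ 2 = Real.sin ψ ^ 2 * (quadAngles a b c t p q ψ φ).P ∧
    rightVec a b c t p q ε ψ φ 2 ^ 2 = (1 - Real.sin ψ ^ 2) * (quadAngles a b c t p q ψ φ).Q := by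
  obtain ⟨-, -, ⟨h1, h2⟩, ⟨h3, h4⟩⟩ := h.quadAngles_pos ψ φ
  rw [← Real.cos_sq']
  simp [rightVec, mul_pow, Real.sq_sqrt, h1.le, h2.le, h3.le, h4.le, hε]

lemma leftVec_moment (h : IsArranged a b c t p q) {ε ε' : ℝ} (hε : ε ^ 2 = 1) (hε' : ε' ^ 2 = 1)
    (ψ φ : ℝ) {k : ℕ} (hk : k < 3) :
    leftVec a b c t p q ε ψ φ 0 ^ 2 * a ^ k + leftVec a b c t p q ε ψ φ 1 ^ 2 * b ^ k +
      leftVec a b c t p q ε ψ φ 2 ^ 2 * c ^ k =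
    rightVec a b c t p q ε' ψ φ 0 ^ 2 * t ^ k + rightVec a b c t p q ε' ψ φ 1 ^ 2 * p ^ k +
      rightVec a b c t p q ε' ψ φ 2 ^ 2 * q ^ k := by
  obtain ⟨h1, h2, h3⟩ := h.leftVec_sq hε ψ φ
  obtain ⟨h4, h5, h6⟩ := h.rightVec_sq hε' ψ φ
  rw [h1, h2, h3, h4, h5, h6]
  exact h.quadSquares_moment _ _ hk

lemma leftVec_ne_zero (h : IsArranged a b c t p q) {ε : ℝ} (hε : ε ^ 2 = 1) (ψ φ : ℝ) :
    leftVec a b c t p q ε ψ φ 0 ≠ 0 := by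
  obtain ⟨⟨h1, h2⟩, -⟩ := h.quadAngles_pos ψ φ
  rw [← sq_pos_iff, (h.leftVec_sq hε ψ φ).1]
  positivity

lemma rightVec_ne_zero (h : IsArranged a b c t p q) {ε : ℝ} (hε : ε ^ 2 = 1) (ψ φ : ℝ) :
    rightVec a b c t p q ε ψ φ 0 ≠ 0 := by
  obtain ⟨-, -, ⟨h1, h2⟩, -⟩ := h.quadAngles_pos ψ φ
  rw [← sq_pos_iff, (h.rightVec_sq hε ψ φ).1]
  positivity

/-- The quadratic numerator belonging to these squares has leading coefficient 1. For a multiple of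
`leftVec` this expression is therefore the square of the factor, which allows the scale to be
recovered from the vector. -/
lemma leftVec_scale (h : IsArranged a b c t p q) {ε : ℝ} (hε : ε ^ 2 = 1) (ψ φ : ℝ) :
    (a - p) * (a - q) * (a - t) * leftVec a b c t p q ε ψ φ 0 ^ 2 +
      (b - p) * (b - q) * (b - t) * leftVec a b c t p q ε ψ φ 1 ^ 2 +
      (c - p) * (c - q) * (c - t) * leftVec a b c t p q ε ψ φ 2 ^ 2 = 1 := by
  obtain ⟨⟨n1, n2⟩, ⟨n3, n4⟩, ⟨n5, n6⟩, ⟨n7, n8⟩, ⟨n9, n10⟩, ⟨n11, n12⟩, n13⟩ := h.ne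
  obtain ⟨h1, h2, h3⟩ := h.leftVec_sq hε ψ φ
  obtain ⟨g1, g2, g3, g4, -⟩ := h.quadAngles_eq ψ φ
  rw [h1, h2, h3, g1, g2, g3, g4, sinMix, sinMix]
  field_simp
  ring

/-- Vieta for the quadratic numerator with the roots X = `sinMix p q ψ` and Y = `sinMix b c φ`;
`leftVec_mul` is the companion for the product. -/
lemma leftVec_add (h : IsArranged a b c t p q) {ε : ℝ} (hε : ε ^ 2 = 1) (ψ φ : ℝ) :
    sinMix p q ψ + sinMix b c φ = b + c -
      ((b - a) * (b - t) * (b - p) * (b - q) * leftVec a b c t p q ε ψ φ 1 ^ 2 +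
        (c - a) * (c - t) * (c - p) * (c - q) * leftVec a b c t p q ε ψ φ 2 ^ 2) := by
  obtain ⟨⟨n1, n2⟩, ⟨n3, n4⟩, ⟨n5, n6⟩, ⟨n7, n8⟩, ⟨n9, n10⟩, ⟨n11, n12⟩, n13⟩ := h.ne
  obtain ⟨-, h2, h3⟩ := h.leftVec_sq hε ψ φ
  obtain ⟨-, -, g3, g4, -⟩ := h.quadAngles_eq ψ φ
  rw [h2, h3, g3, g4, sinMix, sinMix]
  field_simp
  ring

lemma leftVec_mul (h : IsArranged a b c t p q) {ε : ℝ} (hε : ε ^ 2 = 1) (ψ φ : ℝ) :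
    sinMix p q ψ * sinMix b c φ = b * c -
      (c * ((b - a) * (b - t) * (b - p) * (b - q)) * leftVec a b c t p q ε ψ φ 1 ^ 2 +
        b * ((c - a) * (c - t) * (c - p) * (c - q)) * leftVec a b c t p q ε ψ φ 2 ^ 2) := by
  obtain ⟨⟨n1, n2⟩, ⟨n3, n4⟩, ⟨n5, n6⟩, ⟨n7, n8⟩, ⟨n9, n10⟩, ⟨n11, n12⟩, n13⟩ := h.ne
  obtain ⟨-, h2, h3⟩ := h.leftVec_sq hε ψ φ
  obtain ⟨-, -, g3, g4, -⟩ := h.quadAngles_eq ψ φ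
  rw [h2, h3, g3, g4, sinMix, sinMix]
  field_simp
  ring

lemma sinMix_lt (h : IsArranged a b c t p q) (ψ φ : ℝ) : sinMix p q ψ < sinMix b c φ := by
  obtain ⟨h1, h2⟩ := sinMix_mem h.pq ψ
  obtain ⟨h3, h4⟩ := sinMix_mem h.bc φ
  linarith [(h.signs_between h1 h2 h3 h4).2.2.1]

/-- The points of the quadrilateral determine the angles. -/
lemma angles_unique (h : IsArranged a b c t p q) {ε ε' ψ φ ψ' φ' : ℝ} (hε : ε ^ 2 = 1)
    (hl : leftVec a b c t p q ε ψ φ = leftVec a b c t p q ε ψ' φ')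
    (hr : rightVec a b c t p q ε' ψ φ = rightVec a b c t p q ε' ψ' φ') :
    (Real.sin ψ = Real.sin ψ' ∧ Real.cos ψ = Real.cos ψ') ∧
    (Real.sin φ = Real.sin φ' ∧ Real.cos φ = Real.cos φ') := by
  have e1 := h.leftVec_add hε ψ φ
  have e2 := h.leftVec_mul hε ψ φ
  rw [hl, ← h.leftVec_add hε ψ' φ'] at e1
  rw [hl, ← h.leftVec_mul hε ψ' φ'] at e2
  -- X and Y have the same sum and product as X' and Y', and X < Y' excludes an exchange. Once the
  -- radicands agree, the remaining coordinates give the sines and cosines.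
  have hX : sinMix p q ψ = sinMix p q ψ' := by
    have : (sinMix p q ψ - sinMix p q ψ') * (sinMix p q ψ - sinMix b c φ') = 0 := by
      linear_combination sinMix p q ψ * e1 - e2
    rcases mul_eq_zero.1 this with h3 | h3
    · linarith
    · linarith [h.sinMix_lt ψ φ']
  have hY : sinMix b c φ = sinMix b c φ' := by linarith
  obtain ⟨g1, g2, g3, g4, g5, g6, g7, g8⟩ := h.quadAngles_eq ψ φ
  obtain ⟨k1, k2, k3, k4, k5, k6, k7, k8⟩ := h.quadAngles_eq ψ' φ'
  rw [hX, ← k3] at g3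
  rw [hX, ← k4] at g4
  rw [hY, ← k7] at g7
  rw [hY, ← k8] at g8
  obtain ⟨-, ⟨p1, p2⟩, -, ⟨p3, p4⟩⟩ := h.quadAngles_pos ψ' φ'
  have l1 := congrFun hl 1
  have l2 := congrFun hl 2
  have r1 := congrFun hr 1
  have r2 := congrFun hr 2
  simp only [leftVec, rightVec, Matrix.cons_val, g3, g4, g7, g8] at l1 l2 r1 r2
  exact ⟨⟨mul_right_cancel₀ (Real.sqrt_pos.2 p3).ne' r1,
      mul_right_cancel₀ (Real.sqrt_pos.2 p4).ne' r2⟩,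
    mul_right_cancel₀ (Real.sqrt_pos.2 p1).ne' l1, mul_right_cancel₀ (Real.sqrt_pos.2 p2).ne' l2⟩

end IsArranged

/-! ### Derivatives along a curve of angles -/

namespace IsArranged

variable {a b c t p q : ℝ}

/-- The derivative of `leftVec` with respect to the parameters. -/
lemma hasDerivAt_leftVec (h : IsArranged a b c t p q) (ε : ℝ) {ψ φ : ℝ → ℝ} {ψ' φ' τ : ℝ}
    (hψ : HasDerivAt ψ ψ' τ) (hφ : HasDerivAt φ φ' τ) {X' Y' : ℝ}
    (hX' : X' = (q - p) * (Real.sin (ψ τ) * Real.cos (ψ τ)) * ψ')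
    (hY' : Y' = (c - b) * (Real.sin (φ τ) * Real.cos (φ τ)) * φ') {R : QuadSquares}
    (hR : R = quadAngles a b c t p q (ψ τ) (φ τ)) :
    HasDerivAt (fun τ => leftVec a b c t p q ε (ψ τ) (φ τ))
      ![ε * (-(X' / ((a - p) * (a - q) * √R.A₁)) * √R.A₂ +
          √R.A₁ * (Y' / ((b - a) * (c - a) * (t - a) * √R.A₂))),
        Real.cos (φ τ) * φ' * √R.B -
          Real.sin (φ τ) * (X' / ((b - a) * (b - t) * (b - p) * (b - q) * √R.B)),
        -(Real.sin (φ τ) * φ' * √R.C) -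
          Real.cos (φ τ) * (X' / ((c - a) * (c - t) * (c - p) * (c - q) * √R.C))] τ := by
  subst hR
  obtain ⟨⟨p1, p2⟩, ⟨p3, p4⟩, -⟩ := h.quadAngles_pos (ψ τ) (φ τ)
  have dX := hasDerivAt_sinMix hψ p q
  have dY := hasDerivAt_sinMix hφ b c
  have d1 := hasDerivAt_sqrt_div dX (fun τ => (h.quadAngles_eq (ψ τ) (φ τ)).1) p1
  have d2 := hasDerivAt_sqrt_div dY (fun τ => (h.quadAngles_eq (ψ τ) (φ τ)).2.1) p2
  have d3 := hasDerivAt_sqrt_div dX (fun τ => (h.quadAngles_eq (ψ τ) (φ τ)).2.2.1) p3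
  have d4 := hasDerivAt_sqrt_div dX (fun τ => (h.quadAngles_eq (ψ τ) (φ τ)).2.2.2.1) p4
  rw [← hX'] at d1 d3 d4
  rw [← hY'] at d2
  rw [hasDerivAt_pi]
  intro i
  fin_cases i
  · refine ((d1.fun_mul d2).const_mul ε).congr_deriv ?_
    simp only [Fin.zero_eta, Matrix.cons_val_zero, mul_assoc (2 : ℝ), mul_neg, neg_mul, div_neg,
      neg_neg, mul_div_mul_left _ _ (two_ne_zero' ℝ)]
  · refine (hφ.sin.fun_mul d3).congr_deriv ?_
    simp only [Fin.mk_one, Matrix.cons_val_one, Matrix.cons_val_zero, mul_assoc (2 : ℝ),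
      mul_div_mul_left _ _ (two_ne_zero' ℝ)]
    ring
  · refine (hφ.cos.fun_mul d4).congr_deriv ?_
    simp only [Fin.reduceFinMk, Matrix.cons_val, mul_assoc (2 : ℝ),
      mul_div_mul_left _ _ (two_ne_zero' ℝ)]
    ring

/-- The derivative of `rightVec` with respect to the parameters. -/
lemma hasDerivAt_rightVec (h : IsArranged a b c t p q) (ε : ℝ) {ψ φ : ℝ → ℝ} {ψ' φ' τ : ℝ}
    (hψ : HasDerivAt ψ ψ' τ) (hφ : HasDerivAt φ φ' τ) {X' Y' : ℝ}
    (hX' : X' = (q - p) * (Real.sin (ψ τ) * Real.cos (ψ τ)) * ψ')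
    (hY' : Y' = (c - b) * (Real.sin (φ τ) * Real.cos (φ τ)) * φ') {R : QuadSquares}
    (hR : R = quadAngles a b c t p q (ψ τ) (φ τ)) :
    HasDerivAt (fun τ => rightVec a b c t p q ε (ψ τ) (φ τ))
      ![ε * (-(X' / ((t - p) * (t - q) * √R.T₁)) * √R.T₂ +
          √R.T₁ * (Y' / ((b - t) * (c - t) * (t - a) * √R.T₂))),
        Real.cos (ψ τ) * ψ' * √R.P +
          Real.sin (ψ τ) * (Y' / ((t - p) * (a - p) * (b - p) * (c - p) * √R.P)),
        -(Real.sin (ψ τ) * ψ' * √R.Q) +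
          Real.cos (ψ τ) * (Y' / ((t - q) * (a - q) * (b - q) * (c - q) * √R.Q))] τ := by
  subst hR
  obtain ⟨-, -, ⟨p1, p2⟩, ⟨p3, p4⟩⟩ := h.quadAngles_pos (ψ τ) (φ τ)
  have dX := hasDerivAt_sinMix hψ p q
  have dY := hasDerivAt_sinMix hφ b c
  have d1 := hasDerivAt_sqrt_div dX (fun τ => (h.quadAngles_eq (ψ τ) (φ τ)).2.2.2.2.1) p1
  have d2 := hasDerivAt_sqrt_div dY (fun τ => (h.quadAngles_eq (ψ τ) (φ τ)).2.2.2.2.2.1) p2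
  have d3 := hasDerivAt_sqrt_div dY (fun τ => (h.quadAngles_eq (ψ τ) (φ τ)).2.2.2.2.2.2.1) p3
  have d4 := hasDerivAt_sqrt_div dY (fun τ => (h.quadAngles_eq (ψ τ) (φ τ)).2.2.2.2.2.2.2) p4
  rw [← hX'] at d1
  rw [← hY'] at d2 d3 d4
  rw [hasDerivAt_pi]
  intro i
  fin_cases i
  · refine ((d1.fun_mul d2).const_mul ε).congr_deriv ?_
    simp only [Fin.zero_eta, Matrix.cons_val_zero, mul_assoc (2 : ℝ), mul_neg, neg_mul, div_neg,
      neg_neg, mul_div_mul_left _ _ (two_ne_zero' ℝ)]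
  · refine (hψ.sin.fun_mul d3).congr_deriv ?_
    simp only [Fin.mk_one, Matrix.cons_val_one, Matrix.cons_val_zero, mul_assoc (2 : ℝ), mul_neg,
      neg_mul, div_neg, neg_neg, mul_div_mul_left _ _ (two_ne_zero' ℝ)]
  · refine (hψ.cos.fun_mul d4).congr_deriv ?_
    simp only [Fin.reduceFinMk, Matrix.cons_val, mul_assoc (2 : ℝ), mul_neg, neg_mul, div_neg,
      neg_neg, mul_div_mul_left _ _ (two_ne_zero' ℝ)]

/-- The parametrization of the points of the quadrilateral by the angles is an immersion. -/
lemma angles_immersion (h : IsArranged a b c t p q) {ε ε' : ℝ} (hε : ε ^ 2 = 1)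
    {ψ φ : ℝ → ℝ} {ψ' φ' τ : ℝ} (hψ : HasDerivAt ψ ψ' τ) (hφ : HasDerivAt φ φ' τ)
    (hl : HasDerivAt (fun τ => leftVec a b c t p q ε (ψ τ) (φ τ)) 0 τ)
    (hr : HasDerivAt (fun τ => rightVec a b c t p q ε' (ψ τ) (φ τ)) 0 τ) : ψ' = 0 ∧ φ' = 0 := by
  obtain ⟨X', hX'⟩ : ∃ X', X' = (q - p) * (Real.sin (ψ τ) * Real.cos (ψ τ)) * ψ' := ⟨_, rfl⟩
  obtain ⟨Y', hY'⟩ : ∃ Y', Y' = (c - b) * (Real.sin (φ τ) * Real.cos (φ τ)) * φ' := ⟨_, rfl⟩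
  have dl := h.hasDerivAt_leftVec ε hψ hφ hX' hY' rfl
  have dr := h.hasDerivAt_rightVec ε' hψ hφ hX' hY' rfl
  have el := hl.unique dl
  have er := hr.unique dr
  have dX := hasDerivAt_sinMix hψ p q
  have dY := hasDerivAt_sinMix hφ b c
  rw [← hX'] at dX
  rw [← hY'] at dY
  rw [hasDerivAt_pi] at hl
  have l1 := hl 1
  have l2 := hl 2
  have e1 := (((l1.fun_pow 2).const_mul ((b - a) * (b - t) * (b - p) * (b - q))).fun_add
    ((l2.fun_pow 2).const_mul ((c - a) * (c - t) * (c - p) * (c - q)))).const_sub (b + c)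
  have e2 := (((l1.fun_pow 2).const_mul (c * ((b - a) * (b - t) * (b - p) * (b - q)))).fun_add
    ((l2.fun_pow 2).const_mul (b * ((c - a) * (c - t) * (c - p) * (c - q))))).const_sub (b * c)
  simp only [← h.leftVec_add hε, ← h.leftVec_mul hε, Pi.zero_apply, mul_zero, add_zero,
    neg_zero] at e1 e2
  -- X + Y and XY are functions of the left vector, so both are stationary. Since X ≠ Y, so are X
  -- and Y, and then the coordinates with sine and cosine show that the angles are.
  have f1 := (dX.fun_add dY).unique e1
  have f2 := (dX.fun_mul dY).unique e2
  have hXY := h.sinMix_lt (ψ τ) (φ τ)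
  have hX0 : X' = 0 := by
    have : X' * (sinMix b c (φ τ) - sinMix p q (ψ τ)) = 0 := by
      linear_combination (1 / 2) * f2 - (1 / 2) * sinMix p q (ψ τ) * f1
    exact (mul_eq_zero.1 this).resolve_right (by linarith)
  have hY0 : Y' = 0 := by linarith
  obtain ⟨-, ⟨p1, p2⟩, -, ⟨p3, p4⟩⟩ := h.quadAngles_pos (ψ τ) (φ τ)
  rw [hX0, hY0] at el er
  have l1 := congrFun el 1
  have l2 := congrFun el 2
  have r1 := congrFun er 1
  have r2 := congrFun er 2
  simp [(Real.sqrt_pos.2 p1).ne', (Real.sqrt_pos.2 p2).ne', (Real.sqrt_pos.2 p3).ne',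
    (Real.sqrt_pos.2 p4).ne'] at l1 l2 r1 r2
  constructor
  · by_contra h0
    have := Real.sin_sq_add_cos_sq (ψ τ)
    rw [r1.resolve_right h0, r2.resolve_right h0] at this
    norm_num at this
  · by_contra h0
    have := Real.sin_sq_add_cos_sq (φ τ)
    rw [l1.resolve_right h0, l2.resolve_right h0] at this
    norm_num at this

end IsArranged

/-! ### The direction of the flow in terms of the angles -/

/-- The scalar product of (a ∘ l) × l with a ∘ l' for l = (εα₁α₂, Sβ, Cγ). The part from the angle
of S and C and the part from X' collapse separately, to multiples of Y and of X: the origin of the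
separation of variables. -/
lemma triple_deriv {a b c X Y S C g X' ε α₁ α₂ β γ k₁ k₂ k₃ k₄ α₁' α₂' β' γ' : ℝ}
    (hα₁ : α₁ ≠ 0) (hα₂ : α₂ ≠ 0) (hβ : β ≠ 0) (hγ : γ ≠ 0)
    (hk₁ : k₁ ≠ 0) (hk₂ : k₂ ≠ 0) (hk₃ : k₃ ≠ 0) (hk₄ : k₄ ≠ 0)
    (hSC : S ^ 2 + C ^ 2 = 1) (hY : Y = b + (c - b) * S ^ 2)
    (h₁ : k₁ * α₁ ^ 2 = a - X) (h₂ : k₂ * α₂ ^ 2 = a - Y) (h₃ : k₃ * β ^ 2 = b - X)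
    (h₄ : k₄ * γ ^ 2 = c - X) (d₁ : k₁ * α₁ * α₁' = -X')
    (d₂ : k₂ * α₂ * α₂' = -((c - b) * (S * C) * g)) (d₃ : k₃ * β * β' = -X')
    (d₄ : k₄ * γ * γ' = -X') :
    a * (b - c) * (S * β) * (C * γ) * (ε * (α₁' * α₂ + α₁ * α₂')) +
      b * (c - a) * (C * γ) * (ε * (α₁ * α₂)) * (C * g * β + S * β') +
      c * (a - b) * (ε * (α₁ * α₂)) * (S * β) * (-(S * g * γ) + C * γ') =
    ε * (-((b - a) * (c - a) / k₂) * (α₁ * β * γ / α₂) * (Y * g) +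
      (b - a) * (c - a) * (c - b) / (k₁ * k₃ * k₄) * (S * C * α₂ / (α₁ * β * γ)) * (X * X')) := by
  have hg : a * (b - c) * (S * β) * (C * γ) * (α₁ * α₂') +
      b * (c - a) * (C * γ) * (α₁ * α₂) * (C * g * β) -
      c * (a - b) * (α₁ * α₂) * (S * β) * (S * g * γ) =
      -((b - a) * (c - a) / k₂) * (α₁ * β * γ / α₂) * (Y * g) := by
    have e : -((b - a) * (c - a) / k₂) * (α₁ * β * γ / α₂) * (Y * g) =
        -((b - a) * (c - a)) * (α₁ * β * γ) * (Y * g) / (k₂ * α₂) := by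
      field_simp
    rw [e, eq_div_iff (mul_ne_zero hk₂ hα₂)]
    have hC : C ^ 2 = 1 - S ^ 2 := by linarith
    rw [hY] at h₂ ⊢
    linear_combination a * (b - c) * (S * β) * (C * γ) * α₁ * d₂ +
      α₁ * β * γ * g * (b * (c - a) * C ^ 2 - c * (a - b) * S ^ 2) * h₂ +
      α₁ * β * γ * g * (a * (c - b) ^ 2 * S ^ 2 + (a - b - (c - b) * S ^ 2) * (b * (c - a))) * hC
  -- After clearing denominators this is the cyclic sum of a(b - c)(b - X)(c - X), whose terms of
  -- degree 0 and 2 in X vanish.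
  have hX : a * (b - c) * (β * γ) * α₁' + b * (c - a) * (γ * α₁) * β' + c * (a - b) * (α₁ * β) * γ' =
      (b - a) * (c - a) * (c - b) / (k₁ * k₃ * k₄) * (1 / (α₁ * β * γ)) * (X * X') := by
    have e : (b - a) * (c - a) * (c - b) / (k₁ * k₃ * k₄) * (1 / (α₁ * β * γ)) * (X * X') =
        (b - a) * (c - a) * (c - b) * (X * X') / (k₁ * k₃ * k₄ * (α₁ * β * γ)) := by
      field_simp
    rw [e, eq_div_iff (by positivity)]
    have e1 : a * (b - c) * (β * γ) * α₁' * (k₁ * k₃ * k₄ * (α₁ * β * γ)) =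
        -(a * (b - c) * X' * ((b - X) * (c - X))) := by
      rw [← h₃, ← h₄]
      linear_combination a * (b - c) * (k₃ * β ^ 2) * (k₄ * γ ^ 2) * d₁
    have e2 : b * (c - a) * (γ * α₁) * β' * (k₁ * k₃ * k₄ * (α₁ * β * γ)) =
        -(b * (c - a) * X' * ((c - X) * (a - X))) := by
      rw [← h₁, ← h₄]
      linear_combination b * (c - a) * (k₁ * α₁ ^ 2) * (k₄ * γ ^ 2) * d₃
    have e3 : c * (a - b) * (α₁ * β) * γ' * (k₁ * k₃ * k₄ * (α₁ * β * γ)) =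
        -(c * (a - b) * X' * ((a - X) * (b - X))) := by
      rw [← h₁, ← h₃]
      linear_combination c * (a - b) * (k₁ * α₁ ^ 2) * (k₃ * β ^ 2) * d₄
    rw [add_mul, add_mul, e1, e2, e3]
    ring
  have e : (b - a) * (c - a) * (c - b) / (k₁ * k₃ * k₄) * (S * C * α₂ / (α₁ * β * γ)) * (X * X') =
      S * C * α₂ * ((b - a) * (c - a) * (c - b) / (k₁ * k₃ * k₄) * (1 / (α₁ * β * γ)) * (X * X')) := by
    ring
  rw [e]
  linear_combination ε * hg + ε * S * C * α₂ * hX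

/-- With s = ηεε', s² = 1, the relation factors as (M' + sK')(x₀ψ' + s y₀φ') = 0, where M' and K'
are the right-hand and the signed left-hand product in `hlt`. The first factor is nonzero because
|K'| < M'. -/
lemma flow_factor {A₁ A₂ B C T₁ T₂ P Q X Y ψ' φ' κ r1 r2 δ σ ρ u v ε ε' η : ℝ} (q1 : A₁ ≠ 0)
    (q2 : A₂ ≠ 0) (q3 : B ≠ 0) (q4 : C ≠ 0) (q5 : T₁ ≠ 0) (q6 : T₂ ≠ 0) (q7 : P ≠ 0) (q8 : Q ≠ 0)
    (hδ : δ ≠ 0) (hε : ε ^ 2 = 1) (hε' : ε' ^ 2 = 1) (hη : η ^ 2 = 1)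
    (hlt : |κ * (σ * ρ) * (A₂ * T₁)| < A₁ * B * C * (P * Q * T₂)) (c2 : r1 * u = κ)
    (c4 : r2 * v = -κ / δ)
    (H : ε * (1 / δ * (A₁ * B * C / A₂) * (Y * φ') +
        r1 * (ρ * A₂ / (A₁ * B * C)) * (X * (u * σ * ψ'))) =
      η * (ε' * (-1 * (T₂ * P * Q / T₁) * (X * ψ') +
        r2 * (σ * T₁ / (T₂ * P * Q)) * (Y * (v * ρ * φ'))))) :
    X / (T₁ * A₁ * B * C) * ψ' + η * ε * ε' * (Y / (δ * A₂ * T₂ * P * Q)) * φ' = 0 := by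
  have hne : A₁ * B * C * (P * Q * T₂) + η * ε * ε' * (κ * (σ * ρ) * (A₂ * T₁)) ≠ 0 := by
    intro h0
    have he : |η * ε * ε'| = 1 := by
      rw [← pow_eq_one_iff_of_nonneg (abs_nonneg _) two_ne_zero, sq_abs, mul_pow, mul_pow, hη, hε,
        hε']
      norm_num
    have h1 : A₁ * B * C * (P * Q * T₂) = -(η * ε * ε' * (κ * (σ * ρ) * (A₂ * T₁))) := by linarith
    have h2 := congrArg abs h1
    rw [abs_neg, abs_mul (η * ε * ε'), he, one_mul] at h2
    exact absurd (le_abs_self _) (not_le.2 (h2 ▸ hlt))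
  refine (mul_eq_zero.1 ?_).resolve_left hne
  have e1 : 1 / δ * (A₁ * B * C / A₂) * (Y * φ') =
      A₁ * B * C * (P * Q * T₂) * (Y / (δ * A₂ * T₂ * P * Q) * φ') := by
    field_simp
  have e2 : r1 * (ρ * A₂ / (A₁ * B * C)) * (X * (u * σ * ψ')) =
      κ * (σ * ρ) * (A₂ * T₁) * (X / (T₁ * A₁ * B * C) * ψ') := by
    rw [← c2]
    field_simp
  have e3 : -1 * (T₂ * P * Q / T₁) * (X * ψ') =
      -(A₁ * B * C * (P * Q * T₂) * (X / (T₁ * A₁ * B * C) * ψ')) := by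
    field_simp
  have e4 : r2 * (σ * T₁ / (T₂ * P * Q)) * (Y * (v * ρ * φ')) =
      -(κ * (σ * ρ) * (A₂ * T₁) * (Y / (δ * A₂ * T₂ * P * Q) * φ')) := by
    have c5 : κ = -(r2 * v) * δ := by
      rw [c4]
      field_simp
    rw [c5]
    field_simp
  rw [e1, e2, e3, e4] at H
  generalize X / (T₁ * A₁ * B * C) = x0 at H ⊢
  generalize Y / (δ * A₂ * T₂ * P * Q) = y0 at H ⊢
  generalize A₁ * B * C * (P * Q * T₂) = M at H ⊢
  generalize κ * (σ * ρ) * (A₂ * T₁) = K at H ⊢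
  linear_combination η * ε' * H + K * y0 * φ' * (η ^ 2 * ε ^ 2 * hε' + η ^ 2 * hε + hη) -
    (M * (x0 * ψ') + K * (y0 * φ')) * (η ^ 2 * hε' + hη)

namespace IsArranged

variable {a b c t p q : ℝ}

lemma mul_lt_mul_of_pairs (h : IsArranged a b c t p q) {X Y : ℝ} (hpX : p ≤ X) (hXq : X ≤ q)
    (hbY : b ≤ Y) (hYc : Y ≤ c) :
    (X - p) * (q - X) * ((Y - b) * (c - Y)) * ((t - X) * ((Y - a) * (t - a))) <
      (a - X) * (b - X) * (c - X) * ((Y - p) * (Y - q)) * ((Y - t) * (t - a)) := by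
  obtain ⟨⟨hXa, hXb, hXc, hXt⟩, ⟨hYp, hYq⟩, hXY, hYa, hYt⟩ := h.signs_between hpX hXq hbY hYc
  have triple : ∀ {u v w u' v' w' : ℝ}, 0 ≤ u → 0 ≤ v → 0 ≤ w → u < u' → v < v' → w < w' →
      u * v * w < u' * v' * w' := fun h1 h2 h3 h4 h5 h6 =>
    mul_lt_mul'' (mul_lt_mul'' h4 h5 h1 h2) h6 (mul_nonneg h1 h2) h3
  have double : ∀ {u v u' v' : ℝ}, 0 ≤ u → 0 ≤ v → u < u' → v < v' → u * v < u' * v' :=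
    fun h1 h2 h3 h4 => mul_lt_mul'' h3 h4 h1 h2
  have x1 := sub_nonneg.2 hpX
  have x2 := sub_nonneg.2 hXq
  have y1 := sub_nonneg.2 hbY
  have y2 := sub_nonneg.2 hYc
  rcases h.order with ⟨o1, o2, o3⟩ | ⟨o1, o2, o3⟩
  -- The factors are paired so that each on the left is below its partner on the right. In the other
  -- order of the nodes one pair of products, (c - Y)(t - X) and (t - Y)(c - X), has to be compared
  -- as a whole.
  · have z1 : 0 < Y - a := by linarith
    have key := triple (mul_nonneg z1.le x2) (mul_nonneg y1 hXt.le) (mul_nonneg y2 x1)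
      (double z1.le x2 (by linarith : Y - a < Y - q) (by linarith : q - X < a - X))
      (double y1 hXt.le (by linarith : Y - b < Y - t) (by linarith : t - X < b - X))
      (double y2 x1 (by linarith : c - Y < c - X) (by linarith : X - p < Y - p))
    have := mul_lt_mul_of_pos_right key (by linarith : 0 < t - a)
    linarith
  · have z1 : 0 < a - Y := by linarith
    have key := triple (mul_nonneg y2 hXt.le) (mul_nonneg z1.le x1) (mul_nonneg y1 x2)
      (show (c - Y) * (t - X) < (t - Y) * (c - X) by linarith [mul_pos (sub_pos.2 o2) hXY])
      (double z1.le x1 (by linarith : a - Y < a - X) (by linarith : X - p < Y - p))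
      (double y1 x2 (by linarith : Y - b < Y - q) (by linarith : q - X < b - X))
    have := mul_lt_mul_of_pos_right key (by linarith : 0 < a - t)
    linarith

/-- The strength of the mixed terms in the flow relation. -/
def mixing (a b c t p q : ℝ) : ℝ :=
  (q - p) * (c - b) / ((a - p) * (a - q) * (b - t) * (c - t) * (b - p) * (b - q) * (c - p) * (c - q))

/-- Squared, with (X - p)(q - X) = (q - p)² sin² ψ cos² ψ and its analogue for Y, this is
`mul_lt_mul_of_pairs` divided by a positive constant. -/
lemma mixing_lt (h : IsArranged a b c t p q) (ψ φ : ℝ) {R : QuadSquares}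
    (hR : R = quadAngles a b c t p q ψ φ) :
    |mixing a b c t p q * (Real.sin ψ * Real.cos ψ * (Real.sin φ * Real.cos φ)) * (√R.A₂ * √R.T₁)| <
      √R.A₁ * √R.B * √R.C * (√R.P * √R.Q * √R.T₂) := by
  subst hR
  obtain ⟨⟨n1, n2⟩, ⟨n3, n4⟩, ⟨n5, n6⟩, ⟨n7, n8⟩, ⟨n9, n10⟩, ⟨n11, n12⟩, n13⟩ := h.ne
  obtain ⟨⟨s1, s2⟩, ⟨s3, s4⟩, ⟨s5, s6⟩, ⟨s7, s8⟩, ⟨s9, s10⟩, ⟨s11, s12⟩, s13, s14⟩ := h.signs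
  obtain ⟨⟨p1, p2⟩, ⟨p3, p4⟩, ⟨p5, p6⟩, ⟨p7, p8⟩⟩ := h.quadAngles_pos ψ φ
  obtain ⟨g1, g2, g3, g4, g5, g6, g7, g8⟩ := h.quadAngles_eq ψ φ
  obtain ⟨x1, x2⟩ := sinMix_mem h.pq ψ
  obtain ⟨y1, y2⟩ := sinMix_mem h.bc φ
  have hlt := h.mul_lt_mul_of_pairs x1 x2 y1 y2
  have ex : (sinMix p q ψ - p) * (q - sinMix p q ψ) = (q - p) ^ 2 * (Real.sin ψ * Real.cos ψ) ^ 2 := by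
    rw [sinMix, mul_pow, Real.cos_sq']
    ring
  have ey : (sinMix b c φ - b) * (c - sinMix b c φ) = (c - b) ^ 2 * (Real.sin φ * Real.cos φ) ^ 2 := by
    rw [sinMix, mul_pow, Real.cos_sq']
    ring
  rw [ex, ey] at hlt
  refine abs_lt_of_sq_lt_sq ?_ (by positivity)
  simp only [mul_pow, Real.sq_sqrt p1.le, Real.sq_sqrt p2.le, Real.sq_sqrt p3.le,
    Real.sq_sqrt p4.le, Real.sq_sqrt p5.le, Real.sq_sqrt p6.le, Real.sq_sqrt p7.le,
    Real.sq_sqrt p8.le] at hlt ⊢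
  have hD : 0 < ((a - p) * (a - q) * (b - t) * (c - t) * (b - p) * (b - q) * (c - p) * (c - q)) ^ 2 *
      (((b - a) * (t - a)) * ((c - a) * (t - a)) * ((t - p) * (t - q))) := by positivity
  generalize Real.sin ψ ^ 2 * Real.cos ψ ^ 2 = σ at hlt ⊢
  generalize Real.sin φ ^ 2 * Real.cos φ ^ 2 = ρ at hlt ⊢
  rw [mixing, g1, g2, g3, g4, g5, g6, g7, g8]
  generalize sinMix p q ψ = X at hlt ⊢
  generalize sinMix b c φ = Y at hlt ⊢
  have := div_lt_div_of_pos_right hlt hD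
  refine lt_of_eq_of_lt ?_ (lt_of_lt_of_eq this ?_)
  · field_simp
    ring
  · field_simp
    ring

/-- The component of the flow relation that depends only on `ψ`. -/
def flowCoeff₀ (a b c t p q ψ : ℝ) : ℝ :=
  -- T₁, A₁, B and C depend on ψ only; the second angle is set to the arbitrary value 0.
  sinMix p q ψ / (√(quadAngles a b c t p q ψ 0).T₁ * √(quadAngles a b c t p q ψ 0).A₁ *
    √(quadAngles a b c t p q ψ 0).B * √(quadAngles a b c t p q ψ 0).C)

/-- The component of the flow relation that depends only on `φ`. -/
def flowCoeff₁ (a b c t p q φ : ℝ) : ℝ :=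
  sinMix b c φ / ((t - a) * √(quadAngles a b c t p q 0 φ).A₂ * √(quadAngles a b c t p q 0 φ).T₂ *
    √(quadAngles a b c t p q 0 φ).P * √(quadAngles a b c t p q 0 φ).Q)

/-- The numerators are X and Y, and X < Y. -/
lemma flowCoeff_ne_zero (h : IsArranged a b c t p q) (ψ φ : ℝ) :
    flowCoeff₀ a b c t p q ψ ≠ 0 ∨ flowCoeff₁ a b c t p q φ ≠ 0 := by
  obtain ⟨⟨-, p2⟩, -, ⟨-, p6⟩, ⟨p7, p8⟩⟩ := h.quadAngles_pos 0 φ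
  obtain ⟨⟨p1, -⟩, ⟨p3, p4⟩, ⟨p5, -⟩, -⟩ := h.quadAngles_pos ψ 0
  by_contra! h0
  rw [flowCoeff₀, flowCoeff₁, div_eq_zero_iff, div_eq_zero_iff] at h0
  have h1 := h.sinMix_lt ψ φ
  have h2 := h0.1.resolve_right (by positivity)
  have h3 := h0.2.resolve_right (by have := h.ne.2.2.2.2.2.2; positivity)
  linarith

/-- If the derivatives of `leftVec` and `rightVec` along a curve of angles are related like the
derivatives of a vector and its image, then the direction of the curve is determined. -/
lemma flow_relation (h : IsArranged a b c t p q) {ε ε' η : ℝ} (hε : ε ^ 2 = 1) (hε' : ε' ^ 2 = 1)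
    (hη : η ^ 2 = 1) {ψ φ : ℝ → ℝ} {ψ' φ' τ : ℝ} (hψ : HasDerivAt ψ ψ' τ) (hφ : HasDerivAt φ φ' τ)
    {l l' r r' : Vec3} (hl : l = leftVec a b c t p q ε (ψ τ) (φ τ))
    (hr : r = rightVec a b c t p q ε' (ψ τ) (φ τ))
    (hl' : HasDerivAt (fun τ => leftVec a b c t p q ε (ψ τ) (φ τ)) l' τ)
    (hr' : HasDerivAt (fun τ => rightVec a b c t p q ε' (ψ τ) (φ τ)) r' τ)
    (H : a * (b - c) * l 1 * l 2 * l' 0 + b * (c - a) * l 2 * l 0 * l' 1 +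
        c * (a - b) * l 0 * l 1 * l' 2 =
      η * (t * (p - q) * r 1 * r 2 * r' 0 + p * (q - t) * r 2 * r 0 * r' 1 +
        q * (t - p) * r 0 * r 1 * r' 2)) :
    flowCoeff₀ a b c t p q (ψ τ) * ψ' + η * ε * ε' * flowCoeff₁ a b c t p q (φ τ) * φ' = 0 := by
  obtain ⟨⟨n1, n2⟩, ⟨n3, n4⟩, ⟨n5, n6⟩, ⟨n7, n8⟩, ⟨n9, n10⟩, ⟨n11, n12⟩, n13⟩ := h.ne
  obtain ⟨R, hR⟩ : ∃ R, R = quadAngles a b c t p q (ψ τ) (φ τ) := ⟨_, rfl⟩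
  have hlt := h.mixing_lt (ψ τ) (φ τ) hR
  rw [hl'.unique (h.hasDerivAt_leftVec ε hψ hφ rfl rfl hR),
    hr'.unique (h.hasDerivAt_rightVec ε' hψ hφ rfl rfl hR), hl, hr, leftVec, rightVec, ← hR] at H
  have hc0 : flowCoeff₀ a b c t p q (ψ τ) =
      sinMix p q (ψ τ) / (√R.T₁ * √R.A₁ * √R.B * √R.C) := by rw [hR]; rfl
  have hc1 : flowCoeff₁ a b c t p q (φ τ) =
      sinMix b c (φ τ) / ((t - a) * √R.A₂ * √R.T₂ * √R.P * √R.Q) := by rw [hR]; rfl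
  rw [hc0, hc1]
  clear hc0 hc1
  obtain ⟨⟨p1, p2⟩, ⟨p3, p4⟩, ⟨p5, p6⟩, ⟨p7, p8⟩⟩ := h.quadAngles_pos (ψ τ) (φ τ)
  obtain ⟨g1, g2, g3, g4, g5, g6, g7, g8⟩ := h.quadAngles_eq (ψ τ) (φ τ)
  rw [← hR] at g1 g2 g3 g4 g5 g6 g7 g8 p1 p2 p3 p4 p5 p6 p7 p8
  have sq : ∀ {A z k : ℝ}, 0 < A → A = z / k → k ≠ 0 → k * √A ^ 2 = z := by
    intro A z k hA hz hk
    rw [Real.sq_sqrt hA.le, hz, mul_div_cancel₀ _ hk]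
  have dv : ∀ {S x k : ℝ}, S ≠ 0 → k ≠ 0 → k * S * (x / (k * S)) = x := fun hS hk =>
    mul_div_cancel₀ _ (mul_ne_zero hk hS)
  have q1 := (Real.sqrt_pos.2 p1).ne'
  have q2 := (Real.sqrt_pos.2 p2).ne'
  have q3 := (Real.sqrt_pos.2 p3).ne'
  have q4 := (Real.sqrt_pos.2 p4).ne'
  have q5 := (Real.sqrt_pos.2 p5).ne'
  have q6 := (Real.sqrt_pos.2 p6).ne'
  have q7 := (Real.sqrt_pos.2 p7).ne'
  have q8 := (Real.sqrt_pos.2 p8).ne'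
  have k1 : (a - p) * (a - q) ≠ 0 := by positivity
  have k2 : (b - a) * (c - a) * (t - a) ≠ 0 := by positivity
  have k3 : (b - a) * (b - t) * (b - p) * (b - q) ≠ 0 := by positivity
  have k4 : (c - a) * (c - t) * (c - p) * (c - q) ≠ 0 := by positivity
  have k5 : (t - p) * (t - q) ≠ 0 := by positivity
  have k6 : (b - t) * (c - t) * (t - a) ≠ 0 := by positivity
  have k7 : (t - p) * (a - p) * (b - p) * (c - p) ≠ 0 := by positivity
  have k8 : (t - q) * (a - q) * (b - q) * (c - q) ≠ 0 := by positivity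
  simp only [Matrix.cons_val] at H
  obtain ⟨X', hX'⟩ : ∃ X', X' = (q - p) * (Real.sin (ψ τ) * Real.cos (ψ τ)) * ψ' := ⟨_, rfl⟩
  obtain ⟨Y', hY'⟩ : ∃ Y', Y' = (c - b) * (Real.sin (φ τ) * Real.cos (φ τ)) * φ' := ⟨_, rfl⟩
  rw [← hX', ← hY'] at H
  have d1 := dv (x := X') q1 k1
  have d2 := dv (x := Y') q2 k2
  have d3 := dv (x := X') q3 k3
  have d4 := dv (x := X') q4 k4
  have d5 := dv (x := X') q5 k5
  have d6 := dv (x := Y') q6 k6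
  have d7 := dv (x := Y') q7 k7
  have d8 := dv (x := Y') q8 k8
  generalize X' / ((a - p) * (a - q) * √R.A₁) = f1 at H d1
  generalize Y' / ((b - a) * (c - a) * (t - a) * √R.A₂) = f2 at H d2
  generalize X' / ((b - a) * (b - t) * (b - p) * (b - q) * √R.B) = f3 at H d3
  generalize X' / ((c - a) * (c - t) * (c - p) * (c - q) * √R.C) = f4 at H d4
  generalize X' / ((t - p) * (t - q) * √R.T₁) = f5 at H d5
  generalize Y' / ((b - t) * (c - t) * (t - a) * √R.T₂) = f6 at H d6
  generalize Y' / ((t - p) * (a - p) * (b - p) * (c - p) * √R.P) = f7 at H d7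
  generalize Y' / ((t - q) * (a - q) * (b - q) * (c - q) * √R.Q) = f8 at H d8
  have L := triple_deriv (ε := ε) (g := φ') (X' := X') (α₁' := -f1) (α₂' := f2) (β' := -f3)
    (γ' := -f4) q1 q2 q3 q4 k1 (neg_ne_zero.2 k2) k3 k4
    (Real.sin_sq_add_cos_sq (φ τ)) rfl (sq p1 g1 k1) (sq p2 g2 (neg_ne_zero.2 k2)) (sq p3 g3 k3)
    (sq p4 g4 k4) (by rw [mul_neg, d1]) (by rw [neg_mul, neg_mul, d2, hY']) (by rw [mul_neg, d3])
    (by rw [mul_neg, d4])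
  -- The same identity for the second triangle, with the angles exchanged: now Y plays the role of
  -- X, so the first factor is √T₂ and the second √T₁.
  have L' := triple_deriv (ε := ε') (g := ψ') (X' := Y') (α₁' := f6) (α₂' := -f5) (β' := f7)
    (γ' := f8) q6 q5 q7 q8 (neg_ne_zero.2 k6) k5 (neg_ne_zero.2 k7) (neg_ne_zero.2 k8)
    (Real.sin_sq_add_cos_sq (ψ τ)) rfl (sq p6 g6 (neg_ne_zero.2 k6)) (sq p5 g5 k5)
    (sq p7 g7 (neg_ne_zero.2 k7)) (sq p8 g8 (neg_ne_zero.2 k8))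
    (by rw [neg_mul, neg_mul, d6]) (by rw [mul_neg, d5, hX']) (by rw [neg_mul, neg_mul, d7])
    (by rw [neg_mul, neg_mul, d8])
  have H' := L.symm.trans (Eq.trans (by ring) (H.trans (Eq.trans (by ring) (congrArg (η * ·) L'))))
  clear L L' H d1 d2 d3 d4 d5 d6 d7 d8 sq g1 g2 g3 g4 g5 g6 g7 g8
  rw [← sinMix, ← sinMix] at H'
  have c1 : -((b - a) * (c - a) / -((b - a) * (c - a) * (t - a))) = 1 / (t - a) := by field_simp
  have c2 : (b - a) * (c - a) * (c - b) / ((a - p) * (a - q) *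
      ((b - a) * (b - t) * (b - p) * (b - q)) * ((c - a) * (c - t) * (c - p) * (c - q))) * (q - p) =
      mixing a b c t p q := by
    rw [mixing]
    field_simp
  have c3 : -((p - t) * (q - t) / ((t - p) * (t - q))) = -1 := by
    field_simp
    ring
  have c4 : (p - t) * (q - t) * (q - p) / (-((b - t) * (c - t) * (t - a)) *
      -((t - p) * (a - p) * (b - p) * (c - p)) * -((t - q) * (a - q) * (b - q) * (c - q))) *
      (c - b) = -mixing a b c t p q / (t - a) := by
    rw [mixing]
    field_simp
    ring
  rw [c1, c3, hX', hY'] at H'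
  generalize mixing a b c t p q = κ at hlt c2 c4
  generalize (b - a) * (c - a) * (c - b) / ((a - p) * (a - q) *
      ((b - a) * (b - t) * (b - p) * (b - q)) * ((c - a) * (c - t) * (c - p) * (c - q))) = r1 at H' c2
  generalize (p - t) * (q - t) * (q - p) / (-((b - t) * (c - t) * (t - a)) *
      -((t - p) * (a - p) * (b - p) * (c - p)) * -((t - q) * (a - q) * (b - q) * (c - q))) = r2
      at H' c4
  generalize sinMix p q (ψ τ) = X at H' ⊢
  generalize sinMix b c (φ τ) = Y at H' ⊢
  exact flow_factor q1 q2 q3 q4 q5 q6 q7 q8 n13 hε hε' hη hlt c2 c4 H'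

end IsArranged

/-! ### Vectors that an orthogonal matrix intertwines with two diagonal matrices -/

/-- The orthogonal matrix `O` and the vector `u` satisfy `O (a ∘ u) = τ ∘ O u` and
`(κ, O u) = c₀`. -/
structure IsCoupled (a τ κ : Vec3) (c₀ : ℝ) (u : Vec3) (O : Matrix (Fin 3) (Fin 3) ℝ) : Prop where
  orthogonal : O * Oᵀ = 1
  mulVec_eq : O *ᵥ (a * u) = τ * (O *ᵥ u)
  dotProduct_eq : κ ⬝ᵥ (O *ᵥ u) = c₀

/-- Smooth `2π`-periodic functions `u`, `O` that parametrize the coupled pairs with given signs, and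
functions `A₀`, `A₁` such that `A₀ dψ + A₁ dφ` vanishes on the flow. -/
structure IsCoupledTorus (a τ κ : Vec3) (c₀ : ℝ) (u₀ : Vec3) (O₀ : Matrix (Fin 3) (Fin 3) ℝ)
    (u : (Fin 2 → ℝ) → Vec3) (O : (Fin 2 → ℝ) → Fin 3 → Vec3) (A₀ A₁ : ℝ → ℝ) : Prop where
  contDiff_u : ContDiff ℝ ∞ u
  contDiff_O : ContDiff ℝ ∞ O
  isCoupled : ∀ s, IsCoupled a τ κ c₀ (u s) (Matrix.of (O s))
  left_pos : ∀ s, 0 < u₀ 0 * u s 0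
  right_pos : ∀ s, 0 < (O₀ *ᵥ u₀) 0 * (Matrix.of (O s) *ᵥ u s) 0
  det_eq : ∀ s, (Matrix.of (O s)).det = O₀.det
  surjective : ∀ u' O', IsCoupled a τ κ c₀ u' O' → 0 < u₀ 0 * u' 0 →
    0 < (O₀ *ᵥ u₀) 0 * (O' *ᵥ u') 0 → O'.det = O₀.det → ∃ s, u s = u' ∧ Matrix.of (O s) = O'
  injective : ∀ s s', u s = u s' → O s = O s' →
    ∃ n : Fin 2 → ℤ, ∀ i, s i = s' i + 2 * Real.pi * n i
  periodic_u : IsBiperiodic u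
  periodic_O : IsBiperiodic O
  immersion : ∀ s v : Fin 2 → ℝ, HasDerivAt (fun x : ℝ => u (s + x • v)) 0 0 →
    HasDerivAt (fun x : ℝ => O (s + x • v)) 0 0 → v = 0
  contDiff_A₀ : ContDiff ℝ ∞ A₀
  contDiff_A₁ : ContDiff ℝ ∞ A₁
  periodic_A₀ : ∀ x (n : ℤ), A₀ (x + 2 * Real.pi * n) = A₀ x
  periodic_A₁ : ∀ x (n : ℤ), A₁ (x + 2 * Real.pi * n) = A₁ x
  ne_zero : ∀ x y, A₀ x ≠ 0 ∨ A₁ y ≠ 0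
  flow : ∀ (s v : Fin 2 → ℝ) (O' : Fin 3 → Vec3), HasDerivAt (fun x : ℝ => O (s + x • v)) O' 0 →
    Matrix.of O' *ᵥ (a * u s) = 0 → A₀ (s 0) * v 0 + A₁ (s 1) * v 1 = 0

lemma sin_add_two_pi_mul (x : ℝ) (n : ℤ) : Real.sin (x + 2 * Real.pi * n) = Real.sin x := by
  rw [mul_comm (2 * Real.pi), Real.sin_add_int_mul_two_pi]

lemma cos_add_two_pi_mul (x : ℝ) (n : ℤ) : Real.cos (x + 2 * Real.pi * n) = Real.cos x := by
  rw [mul_comm (2 * Real.pi), Real.cos_add_int_mul_two_pi]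

lemma exists_eq_add_of_sin_eq {x y : ℝ} (hs : Real.sin x = Real.sin y)
    (hc : Real.cos x = Real.cos y) : ∃ n : ℤ, x = y + 2 * Real.pi * n := by
  obtain ⟨n, hn⟩ := Real.Angle.angle_eq_iff_two_pi_dvd_sub.1 (Real.Angle.cos_sin_inj hc hs)
  exact ⟨n, by linarith⟩

lemma exists_sin_cos_eq {x y : ℝ} (h : x ^ 2 + y ^ 2 = 1) : ∃ θ, Real.sin θ = x ∧ Real.cos θ = y := by
  have hn : ‖(⟨y, x⟩ : ℂ)‖ = 1 := by
    rw [Complex.norm_eq_sqrt_sq_add_sq, add_comm, h, Real.sqrt_one]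
  have h0 : (⟨y, x⟩ : ℂ) ≠ 0 := norm_ne_zero_iff.1 (by rw [hn]; exact one_ne_zero)
  refine ⟨Complex.arg ⟨y, x⟩, ?_, ?_⟩
  · rw [Complex.sin_arg, hn, div_one]
  · rw [Complex.cos_arg h0, hn, div_one]

section smooth

variable {a b c t p q : ℝ}

lemma contDiff_sinMix (u v : ℝ) : ContDiff ℝ ∞ (sinMix u v) := by
  unfold sinMix
  fun_prop

lemma IsArranged.contDiff_quadAngles (h : IsArranged a b c t p q) {E : Type*} [NormedAddCommGroup E]
    [NormedSpace ℝ E] {ψ φ : E → ℝ} (hψ : ContDiff ℝ ∞ ψ) (hφ : ContDiff ℝ ∞ φ) :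
    (ContDiff ℝ ∞ (fun s => √(quadAngles a b c t p q (ψ s) (φ s)).A₁) ∧
      ContDiff ℝ ∞ (fun s => √(quadAngles a b c t p q (ψ s) (φ s)).A₂)) ∧
    (ContDiff ℝ ∞ (fun s => √(quadAngles a b c t p q (ψ s) (φ s)).B) ∧
      ContDiff ℝ ∞ (fun s => √(quadAngles a b c t p q (ψ s) (φ s)).C)) ∧
    (ContDiff ℝ ∞ (fun s => √(quadAngles a b c t p q (ψ s) (φ s)).T₁) ∧
      ContDiff ℝ ∞ (fun s => √(quadAngles a b c t p q (ψ s) (φ s)).T₂)) ∧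
    (ContDiff ℝ ∞ (fun s => √(quadAngles a b c t p q (ψ s) (φ s)).P) ∧
      ContDiff ℝ ∞ (fun s => √(quadAngles a b c t p q (ψ s) (φ s)).Q)) := by
  have key : ∀ {θ : E → ℝ}, ContDiff ℝ ∞ θ → ∀ u v : ℝ,
      ContDiff ℝ ∞ (fun s => mixInv (Real.sin (θ s) ^ 2) u v) := by
    intro θ hθ u v
    unfold mixInv
    fun_prop
  have pos := fun s => h.quadAngles_pos (ψ s) (φ s)
  exact ⟨⟨(key hψ _ _).sqrt fun s => (pos s).1.1.ne', (key hφ _ _).sqrt fun s => (pos s).1.2.ne'⟩,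
    ⟨(key hψ _ _).sqrt fun s => (pos s).2.1.1.ne', (key hψ _ _).sqrt fun s => (pos s).2.1.2.ne'⟩,
    ⟨(key hψ _ _).sqrt fun s => (pos s).2.2.1.1.ne',
      (key hφ _ _).sqrt fun s => (pos s).2.2.1.2.ne'⟩,
    (key hφ _ _).sqrt fun s => (pos s).2.2.2.1.ne', (key hφ _ _).sqrt fun s => (pos s).2.2.2.2.ne'⟩

lemma IsArranged.contDiff_leftVec (h : IsArranged a b c t p q) (ε : ℝ) :
    ContDiff ℝ ∞ (fun s : Fin 2 → ℝ => leftVec a b c t p q ε (s 0) (s 1)) := by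
  obtain ⟨⟨h1, h2⟩, ⟨h3, h4⟩, -⟩ := h.contDiff_quadAngles (E := Fin 2 → ℝ) (contDiff_apply ℝ ℝ 0)
    (contDiff_apply ℝ ℝ 1)
  rw [contDiff_pi]
  intro i
  fin_cases i
  · exact contDiff_const.mul (h1.mul h2)
  · exact (contDiff_apply ℝ ℝ 1).sin.mul h3
  · exact (contDiff_apply ℝ ℝ 1).cos.mul h4

lemma IsArranged.contDiff_rightVec (h : IsArranged a b c t p q) (ε : ℝ) :
    ContDiff ℝ ∞ (fun s : Fin 2 → ℝ => rightVec a b c t p q ε (s 0) (s 1)) := by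
  obtain ⟨-, -, ⟨h1, h2⟩, ⟨h3, h4⟩⟩ := h.contDiff_quadAngles (E := Fin 2 → ℝ)
    (contDiff_apply ℝ ℝ 0) (contDiff_apply ℝ ℝ 1)
  rw [contDiff_pi]
  intro i
  fin_cases i
  · exact contDiff_const.mul (h1.mul h2)
  · exact (contDiff_apply ℝ ℝ 0).sin.mul h3
  · exact (contDiff_apply ℝ ℝ 0).cos.mul h4

lemma IsArranged.contDiff_flowCoeff₀ (h : IsArranged a b c t p q) :
    ContDiff ℝ ∞ (IsArranged.flowCoeff₀ a b c t p q) := by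
  obtain ⟨⟨h1, -⟩, ⟨h3, h4⟩, ⟨h5, -⟩, -⟩ := h.contDiff_quadAngles (E := ℝ) contDiff_id
    (contDiff_const (c := 0))
  refine (contDiff_sinMix p q).fun_div (((h5.mul h1).mul h3).mul h4) fun s => ?_
  obtain ⟨⟨p1, -⟩, ⟨p3, p4⟩, ⟨p5, -⟩, -⟩ := h.quadAngles_pos s 0
  positivity

lemma IsArranged.contDiff_flowCoeff₁ (h : IsArranged a b c t p q) :
    ContDiff ℝ ∞ (IsArranged.flowCoeff₁ a b c t p q) := by
  obtain ⟨⟨-, h2⟩, -, ⟨-, h6⟩, ⟨h7, h8⟩⟩ := h.contDiff_quadAngles (E := ℝ)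
    (contDiff_const (c := 0)) contDiff_id
  refine (contDiff_sinMix b c).fun_div ((((contDiff_const.mul h2).mul h6).mul h7).mul h8) fun s => ?_
  obtain ⟨⟨-, p2⟩, -, ⟨-, p6⟩, ⟨p7, p8⟩⟩ := h.quadAngles_pos 0 s
  have := h.ne.2.2.2.2.2.2
  positivity

lemma leftVec_periodic (ε ψ φ : ℝ) (m n : ℤ) :
    leftVec a b c t p q ε (ψ + 2 * Real.pi * m) (φ + 2 * Real.pi * n) =
      leftVec a b c t p q ε ψ φ := by
  simp only [leftVec, quadAngles, sin_add_two_pi_mul, cos_add_two_pi_mul]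

lemma rightVec_periodic (ε ψ φ : ℝ) (m n : ℤ) :
    rightVec a b c t p q ε (ψ + 2 * Real.pi * m) (φ + 2 * Real.pi * n) =
      rightVec a b c t p q ε ψ φ := by
  simp only [rightVec, quadAngles, sin_add_two_pi_mul, cos_add_two_pi_mul]

end smooth

/-- The directions of the coupled vectors. -/
def leftPt (a τ : Vec3) (ε : ℝ) (s : Fin 2 → ℝ) : Vec3 :=
  leftVec (a 0) (a 1) (a 2) (τ 0) (τ 1) (τ 2) ε (s 0) (s 1)

/-- The directions of the images of the coupled vectors. -/
def rightPt (a τ : Vec3) (ε : ℝ) (s : Fin 2 → ℝ) : Vec3 :=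
  rightVec (a 0) (a 1) (a 2) (τ 0) (τ 1) (τ 2) ε (s 0) (s 1)

/-- `a` and `τ` are arranged. -/
def Arranged (a τ : Vec3) : Prop := IsArranged (a 0) (a 1) (a 2) (τ 0) (τ 1) (τ 2)

lemma mul_cross_self (a u : Vec3) : (a * u) ⨯₃ u =
    ![(a 1 - a 2) * u 1 * u 2, (a 2 - a 0) * u 2 * u 0, (a 0 - a 1) * u 0 * u 1] := by
  rw [cross_apply]
  ext i
  fin_cases i <;> simp <;> ring

lemma dotProduct_eq_of_orthogonal {O : Matrix (Fin 3) (Fin 3) ℝ} (hO : O * Oᵀ = 1) (x y : Vec3) :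
    (O *ᵥ x) ⬝ᵥ (O *ᵥ y) = x ⬝ᵥ y := by
  rw [Matrix.dotProduct_mulVec, ← Matrix.mulVec_transpose, Matrix.mulVec_mulVec,
    mul_eq_one_comm.1 hO, Matrix.one_mulVec]

namespace Arranged

variable {a τ : Vec3} {ε ε' η : ℝ}

lemma dot_eq (h : Arranged a τ) (hε : ε ^ 2 = 1) (hε' : ε' ^ 2 = 1) (s : Fin 2 → ℝ) :
    rightPt a τ ε' s ⬝ᵥ rightPt a τ ε' s = leftPt a τ ε s ⬝ᵥ leftPt a τ ε s ∧
    rightPt a τ ε' s ⬝ᵥ (τ * rightPt a τ ε' s) = leftPt a τ ε s ⬝ᵥ (a * leftPt a τ ε s) ∧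
    (τ * rightPt a τ ε' s) ⬝ᵥ (τ * rightPt a τ ε' s) =
      (a * leftPt a τ ε s) ⬝ᵥ (a * leftPt a τ ε s) := by
  have h0 := h.leftVec_moment hε hε' (s 0) (s 1) (k := 0) (by norm_num)
  have h1 := h.leftVec_moment hε hε' (s 0) (s 1) (k := 1) (by norm_num)
  have h2 := h.leftVec_moment hε hε' (s 0) (s 1) (k := 2) (by norm_num)
  simp only [dotProduct, Fin.sum_univ_three, Pi.mul_apply, leftPt, rightPt]
  refine ⟨?_, ?_, ?_⟩
  · linear_combination -h0
  · linear_combination -h1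
  · linear_combination -h2

/-- Were a ∘ l parallel to l, all mass of l would sit at the node a₀. Equality of moments would give
∑ (τ_i - a₀)² r_i² = 0, against r₀ ≠ 0 and τ₀ ≠ a₀. -/
lemma cross_ne_zero (h : Arranged a τ) {l r : Vec3} (hl : l 0 ≠ 0) (hr : r 0 ≠ 0)
    (h0 : r ⬝ᵥ r = l ⬝ᵥ l) (h1 : r ⬝ᵥ (τ * r) = l ⬝ᵥ (a * l))
    (h2 : (τ * r) ⬝ᵥ (τ * r) = (a * l) ⬝ᵥ (a * l)) : (a * l) ⨯₃ l ≠ 0 := by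
  obtain ⟨-, -, -, -, ⟨n1, n2⟩, -, n3⟩ := IsArranged.ne h
  intro hc
  rw [mul_cross_self] at hc
  have c1 := congrFun hc 1
  have c2 := congrFun hc 2
  simp [hl] at c1 c2
  have l2 : l 2 = 0 := c1.resolve_left n2
  have l1 : l 1 = 0 := c2.resolve_left fun h => n1 (by linarith)
  simp only [dotProduct, Fin.sum_univ_three, Pi.mul_apply, l1, l2] at h0 h1 h2
  have : (τ 0 - a 0) ^ 2 * r 0 ^ 2 + (τ 1 - a 0) ^ 2 * r 1 ^ 2 + (τ 2 - a 0) ^ 2 * r 2 ^ 2 = 0 := by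
    linear_combination h2 - 2 * a 0 * h1 + a 0 ^ 2 * h0
  have h3 : (τ 0 - a 0) ^ 2 * r 0 ^ 2 = 0 := by
    have e1 : 0 ≤ (τ 0 - a 0) ^ 2 * r 0 ^ 2 := by positivity
    have e2 : 0 ≤ (τ 1 - a 0) ^ 2 * r 1 ^ 2 := by positivity
    have e3 : 0 ≤ (τ 2 - a 0) ^ 2 * r 2 ^ 2 := by positivity
    linarith
  have h4 : (τ 0 - a 0) ^ 2 * r 0 ^ 2 ≠ 0 := by positivity
  exact h4 h3

lemma leftPt_cross_ne_zero (h : Arranged a τ) (hε : ε ^ 2 = 1) (s : Fin 2 → ℝ) :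
    (a * leftPt a τ ε s) ⨯₃ leftPt a τ ε s ≠ 0 := by
  obtain ⟨h0, h1, h2⟩ := h.dot_eq hε hε s
  exact h.cross_ne_zero (IsArranged.leftVec_ne_zero h hε _ _)
    (IsArranged.rightVec_ne_zero h hε _ _) h0 h1 h2

/-- Coupled pairs are given by angles, up to signs. -/
lemma exists_angles (h : Arranged a τ) {u z : Vec3} (hu : u ≠ 0) (h0 : z ⬝ᵥ z = u ⬝ᵥ u)
    (h1 : z ⬝ᵥ (τ * z) = u ⬝ᵥ (a * u)) (h2 : (τ * z) ⬝ᵥ (τ * z) = (a * u) ⬝ᵥ (a * u)) :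
    u 0 ≠ 0 ∧ z 0 ≠ 0 ∧ ∀ ε ε' : ℝ, ε ^ 2 = 1 → ε' ^ 2 = 1 → 0 < ε * u 0 → 0 < ε' * z 0 →
      ∃ (m : ℝ) (s : Fin 2 → ℝ), 0 < m ∧ u = m • leftPt a τ ε s ∧ z = m • rightPt a τ ε' s := by
  have hu' : u ⬝ᵥ u ≠ 0 := fun h => hu (dotProduct_self_eq_zero.1 h)
  simp only [dotProduct, Fin.sum_univ_three, Pi.mul_apply] at h0 h1 h2 hu'
  obtain ⟨m, x, y, hm, ⟨hx0, hx1⟩, ⟨hy0, hy1⟩, e1, e2, e3, e4, e5, e6⟩ :=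
    IsArranged.exists_quadSquares h (Ua := u 0 ^ 2) (Ub := u 1 ^ 2) (Uc := u 2 ^ 2)
      (Wt := z 0 ^ 2) (Wp := z 1 ^ 2) (Wq := z 2 ^ 2) (by positivity) (by positivity) (by positivity)
      (by positivity) (by positivity) (fun h => hu' (by linarith)) (by linarith) (by linarith)
      (by linarith)
  obtain ⟨⟨p1, p2⟩, ⟨p3, p4⟩, ⟨p5, p6⟩, ⟨p7, p8⟩⟩ := IsArranged.quadSquares_pos h hx0 hx1 hy0 hy1
  have hu0 : u 0 ≠ 0 := by
    rw [← sq_pos_iff, e1]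
    positivity
  have hz0 : z 0 ≠ 0 := by
    rw [← sq_pos_iff, e4]
    positivity
  refine ⟨hu0, hz0, fun ε ε' hε hε' hu1 hz1 => ?_⟩
  have hsm := Real.sq_sqrt hm.le
  have hsm0 := Real.sqrt_pos.2 hm
  -- The coordinates paired by sine and cosine need no choice of sign: the angle carries both signs.
  have angle : ∀ {v w w₁ w₂ y : ℝ}, 0 < w₁ → 0 < w₂ → v ^ 2 = m * (y * w₁) →
      w ^ 2 = m * ((1 - y) * w₂) → ∃ θ, Real.sin θ ^ 2 = y ∧ v = √m * (Real.sin θ * √w₁) ∧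
        w = √m * (Real.cos θ * √w₂) := by
    intro v w w₁ w₂ y h1 h2 hv hw
    have k1 := Real.sqrt_pos.2 h1
    have k2 := Real.sqrt_pos.2 h2
    have f1 : (v / (√m * √w₁)) ^ 2 = y := by
      rw [div_pow, mul_pow, hsm, Real.sq_sqrt h1.le, hv]
      field_simp
    have f2 : (w / (√m * √w₂)) ^ 2 = 1 - y := by
      rw [div_pow, mul_pow, hsm, Real.sq_sqrt h2.le, hw]
      field_simp
    obtain ⟨θ, hs, hc⟩ := exists_sin_cos_eq (x := v / (√m * √w₁)) (y := w / (√m * √w₂))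
      (by rw [f1, f2]; ring)
    refine ⟨θ, by rw [hs, f1], ?_, ?_⟩
    · rw [hs]
      field_simp
    · rw [hc]
      field_simp
  have first : ∀ {v w₁ w₂ ε : ℝ}, 0 < w₁ → 0 < w₂ → v ^ 2 = m * (w₁ * w₂) → ε ^ 2 = 1 →
      0 < ε * v → v = √m * (ε * (√w₁ * √w₂)) := by
    intro v w₁ w₂ ε h1 h2 hv hε hp
    have f1 : (ε * v) ^ 2 = (√m * (√w₁ * √w₂)) ^ 2 := by
      rw [mul_pow, hε, one_mul, hv, mul_pow, mul_pow, hsm, Real.sq_sqrt h1.le, Real.sq_sqrt h2.le]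
    have f2 := (pow_left_inj₀ hp.le (by positivity) two_ne_zero).1 f1
    linear_combination ε * f2 - v * hε
  obtain ⟨φ, hφ, u1, u2⟩ := angle p3 p4 e2 e3
  obtain ⟨ψ, hψ, z1, z2⟩ := angle p7 p8 e5 e6
  have u0 := first p1 p2 e1 hε hu1
  have z0 := first p5 p6 e4 hε' hz1
  subst hφ hψ
  refine ⟨√m, ![ψ, φ], hsm0, ?_, ?_⟩
  · ext i
    fin_cases i
    · exact u0
    · exact u1
    · exact u2
  · ext i
    fin_cases i
    · exact z0
    · exact z1
    · exact z2

end Arranged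

/-! ### The torus of coupled pairs -/

lemma IsPreconnected.pos_of_pos {α : Type*} [TopologicalSpace α] {S : Set α} (hS : IsPreconnected S)
    {f : α → ℝ} (hf : ContinuousOn f S) (h0 : ∀ x ∈ S, f x ≠ 0) {x y : α} (hx : x ∈ S) (hy : y ∈ S)
    (hfx : 0 < f x) : 0 < f y := by
  by_contra hy0
  obtain ⟨z, hz, hz0⟩ := hS.intermediate_value hy hx hf ⟨not_lt.1 hy0, hfx.le⟩
  exact h0 z hz hz0

lemma exists_sign {x : ℝ} (hx : x ≠ 0) : ∃ ε : ℝ, ε ^ 2 = 1 ∧ 0 < ε * x ∧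
    ∀ y, 0 < x * y ↔ 0 < ε * y := by
  rcases hx.lt_or_gt with h | h
  · refine ⟨-1, by norm_num, by linarith, fun y => ?_⟩
    rw [neg_one_mul, Left.neg_pos_iff, mul_pos_iff]
    constructor
    · rintro (⟨h1, -⟩ | ⟨-, h2⟩)
      · linarith
      · exact h2
    · exact fun h2 => Or.inr ⟨h, h2⟩
  · refine ⟨1, by norm_num, by linarith, fun y => ?_⟩
    rw [one_mul, mul_pos_iff_of_pos_left h]

lemma IsCoupled.dot_eq {a τ κ u : Vec3} {c₀ : ℝ} {O : Matrix (Fin 3) (Fin 3) ℝ}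
    (h : IsCoupled a τ κ c₀ u O) :
    (O *ᵥ u) ⬝ᵥ (O *ᵥ u) = u ⬝ᵥ u ∧ (O *ᵥ u) ⬝ᵥ (τ * (O *ᵥ u)) = u ⬝ᵥ (a * u) ∧
    (τ * (O *ᵥ u)) ⬝ᵥ (τ * (O *ᵥ u)) = (a * u) ⬝ᵥ (a * u) := by
  rw [← h.mulVec_eq]
  exact ⟨dotProduct_eq_of_orthogonal h.orthogonal _ _, dotProduct_eq_of_orthogonal h.orthogonal _ _,
    dotProduct_eq_of_orthogonal h.orthogonal _ _⟩

lemma IsCoupled.ne_zero {a τ κ u : Vec3} {c₀ : ℝ} {O : Matrix (Fin 3) (Fin 3) ℝ}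
    (h : IsCoupled a τ κ c₀ u O) (hc : 0 < c₀) : u ≠ 0 := by
  rintro rfl
  have := h.dotProduct_eq
  rw [Matrix.mulVec_zero, dotProduct_zero] at this
  exact hc.ne this

/-- The matrix of the coupled pair with given angles and signs. -/
def coupledMat (a τ : Vec3) (ε ε' η : ℝ) (s : Fin 2 → ℝ) : Matrix (Fin 3) (Fin 3) ℝ :=
  pairMatrix (leftPt a τ ε s) (a * leftPt a τ ε s) (rightPt a τ ε' s) (τ * rightPt a τ ε' s) η

/-- The vector of the coupled pair with given angles and signs. -/
def coupledVec (a τ κ : Vec3) (c₀ ε ε' : ℝ) (s : Fin 2 → ℝ) : Vec3 :=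
  (c₀ / (κ ⬝ᵥ rightPt a τ ε' s)) • leftPt a τ ε s

lemma contDiff_vecMulVec {E : Type*} [NormedAddCommGroup E] [NormedSpace ℝ E] {u v : E → Vec3}
    (hu : ContDiff ℝ ∞ u) (hv : ContDiff ℝ ∞ v) (i j : Fin 3) :
    ContDiff ℝ ∞ (fun s => Matrix.vecMulVec (u s) (v s) i j) := by
  rw [contDiff_pi] at hu hv
  exact (hu i).mul (hv j)

namespace Arranged

variable {a τ κ : Vec3} {c₀ ε ε' η : ℝ}

lemma contDiff_leftPt (h : Arranged a τ) (ε : ℝ) : ContDiff ℝ ∞ (leftPt a τ ε) :=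
  IsArranged.contDiff_leftVec h ε

lemma contDiff_rightPt (h : Arranged a τ) (ε : ℝ) : ContDiff ℝ ∞ (rightPt a τ ε) :=
  IsArranged.contDiff_rightVec h ε

lemma coupledMat_mulVec (h : Arranged a τ) (hε : ε ^ 2 = 1) (s : Fin 2 → ℝ) :
    coupledMat a τ ε ε' η s *ᵥ leftPt a τ ε s = rightPt a τ ε' s ∧
    coupledMat a τ ε ε' η s *ᵥ (a * leftPt a τ ε s) = τ * rightPt a τ ε' s ∧
    coupledMat a τ ε ε' η s *ᵥ ((a * leftPt a τ ε s) ⨯₃ leftPt a τ ε s) =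
      η • ((τ * rightPt a τ ε' s) ⨯₃ rightPt a τ ε' s) :=
  pairMatrix_mulVec (h.leftPt_cross_ne_zero hε s)

lemma coupledMat_mul_transpose (h : Arranged a τ) (hε : ε ^ 2 = 1) (hε' : ε' ^ 2 = 1)
    (hη : η ^ 2 = 1) (s : Fin 2 → ℝ) :
    coupledMat a τ ε ε' η s * (coupledMat a τ ε ε' η s)ᵀ = 1 ∧ (coupledMat a τ ε ε' η s).det = η := by
  obtain ⟨h1, h2, h3⟩ := h.dot_eq hε hε' s
  exact pairMatrix_mul_transpose (h.leftPt_cross_ne_zero hε s) h1 h2 h3 hη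

lemma contDiff_coupledMat (h : Arranged a τ) (hε : ε ^ 2 = 1) (ε' η : ℝ) (i j : Fin 3) :
    ContDiff ℝ ∞ (fun s => coupledMat a τ ε ε' η s i j) := by
  have hl := h.contDiff_leftPt ε
  have hr := h.contDiff_rightPt ε'
  have hal : ContDiff ℝ ∞ (fun s => a * leftPt a τ ε s) := contDiff_const.mul hl
  have htr : ContDiff ℝ ∞ (fun s => τ * rightPt a τ ε' s) := contDiff_const.mul hr
  have hn := SphericalSupport.contDiff_cross hal hl
  have hn' := SphericalSupport.contDiff_cross htr hr
  have hD := SphericalSupport.contDiff_dotProduct hn hn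
  simp only [coupledMat, pairMatrix, Matrix.smul_apply, Matrix.add_apply, Matrix.sub_apply,
    smul_eq_mul]
  refine (hD.inv fun s h0 => h.leftPt_cross_ne_zero hε s (dotProduct_self_eq_zero.1 h0)).mul ?_
  refine (((ContDiff.sub ?_ ?_).add ?_).add ?_)
  · exact (SphericalSupport.contDiff_dotProduct hal hal).mul (contDiff_vecMulVec hr hl i j)
  · exact (SphericalSupport.contDiff_dotProduct hl hal).mul
      ((contDiff_vecMulVec hr hal i j).add (contDiff_vecMulVec htr hl i j))
  · exact (SphericalSupport.contDiff_dotProduct hl hl).mul (contDiff_vecMulVec htr hal i j)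
  · exact contDiff_const.mul (contDiff_vecMulVec hn' hn i j)

/-- If κ · r = 0, then `hlt` gives r · τr < δ|r|², whereas equality of moments gives r · τr = l · al
≥ δ|l|² = δ|r|². Hence every direction can be scaled to satisfy the normalization. -/
lemma dotProduct_rightPt_ne_zero (h : Arranged a τ) {δ : ℝ} (hδ : ∀ i, δ ≤ a i)
    (hlt : ∀ v ≠ 0, v ⬝ᵥ (τ * v) < δ * (v ⬝ᵥ v) + (κ ⬝ᵥ v) ^ 2 / c₀) (hε' : ε' ^ 2 = 1)
    (s : Fin 2 → ℝ) : κ ⬝ᵥ rightPt a τ ε' s ≠ 0 := by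
  intro h0
  obtain ⟨h1, h2, -⟩ := h.dot_eq hε' hε' s
  have hr : rightPt a τ ε' s ≠ 0 := fun hr =>
    IsArranged.rightVec_ne_zero h hε' (s 0) (s 1) (congrFun hr 0)
  have h3 := hlt _ hr
  rw [h0, h1, h2] at h3
  refine absurd h3 (not_lt.2 ?_)
  simp only [dotProduct, Fin.sum_univ_three, Pi.mul_apply]
  have e : ∀ i, δ * leftPt a τ ε' s i ^ 2 ≤ a i * leftPt a τ ε' s i ^ 2 := fun i =>
    mul_le_mul_of_nonneg_right (hδ i) (sq_nonneg _)
  have e0 := e 0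
  have e1 := e 1
  have e2 := e 2
  norm_num
  linarith

lemma coupledVec_isCoupled (h : Arranged a τ) (hε : ε ^ 2 = 1) (hε' : ε' ^ 2 = 1) (hη : η ^ 2 = 1)
    (s : Fin 2 → ℝ) (hs : κ ⬝ᵥ rightPt a τ ε' s ≠ 0) :
    IsCoupled a τ κ c₀ (coupledVec a τ κ c₀ ε ε' s) (coupledMat a τ ε ε' η s) := by
  obtain ⟨h1, h2, -⟩ := h.coupledMat_mulVec (ε' := ε') (η := η) hε s
  refine ⟨(h.coupledMat_mul_transpose hε hε' hη s).1, ?_, ?_⟩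
  · rw [coupledVec, mul_smul_comm, Matrix.mulVec_smul, Matrix.mulVec_smul, h1, h2, mul_smul_comm]
  · rw [coupledVec, Matrix.mulVec_smul, h1, dotProduct_smul, smul_eq_mul, div_mul_cancel₀ _ hs]

lemma eq_coupled (h : Arranged a τ) (hε : ε ^ 2 = 1) {u : Vec3} {O : Matrix (Fin 3) (Fin 3) ℝ}
    (hu : IsCoupled a τ κ c₀ u O) (hc : 0 < c₀) {m : ℝ} {s : Fin 2 → ℝ} (hm : 0 < m)
    (hul : u = m • leftPt a τ ε s) (hur : O *ᵥ u = m • rightPt a τ ε' s) :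
    κ ⬝ᵥ rightPt a τ ε' s = c₀ / m ∧ coupledVec a τ κ c₀ ε ε' s = u ∧
      coupledMat a τ ε ε' O.det s = O := by
  have h1 := hu.dotProduct_eq
  rw [hur, dotProduct_smul, smul_eq_mul] at h1
  have h2 : κ ⬝ᵥ rightPt a τ ε' s = c₀ / m := by
    rw [← h1]
    field_simp
  refine ⟨h2, ?_, ?_⟩
  · rw [coupledVec, h2, hul]
    congr 1
    field_simp
  · symm
    have e1 : m • (O *ᵥ leftPt a τ ε s) = m • rightPt a τ ε' s := by
      rw [← Matrix.mulVec_smul, ← hul, hur]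
    have e2 : m • (O *ᵥ (a * leftPt a τ ε s)) = m • (τ * rightPt a τ ε' s) := by
      rw [← Matrix.mulVec_smul, ← mul_smul_comm, ← hul, hu.mulVec_eq, hur, mul_smul_comm]
    exact eq_pairMatrix hu.orthogonal (h.leftPt_cross_ne_zero hε s) (smul_right_injective _ hm.ne' e1)
      (smul_right_injective _ hm.ne' e2)

lemma leftPt_scale (h : Arranged a τ) (hε : ε ^ 2 = 1) (s : Fin 2 → ℝ) {m : ℝ} {u : Vec3}
    (hu : u = m • leftPt a τ ε s) :
    (a 0 - τ 1) * (a 0 - τ 2) * (a 0 - τ 0) * u 0 ^ 2 +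
      (a 1 - τ 1) * (a 1 - τ 2) * (a 1 - τ 0) * u 1 ^ 2 +
      (a 2 - τ 1) * (a 2 - τ 2) * (a 2 - τ 0) * u 2 ^ 2 = m ^ 2 := by
  have := IsArranged.leftVec_scale h hε (s 0) (s 1)
  rw [hu]
  simp only [leftPt, Pi.smul_apply, smul_eq_mul]
  linear_combination m ^ 2 * this

lemma hasDerivAt_line {E : Type*} [NormedAddCommGroup E] [NormedSpace ℝ E] {f : (Fin 2 → ℝ) → E}
    (hf : ContDiff ℝ ∞ f) (s v : Fin 2 → ℝ) :
    HasDerivAt (fun x : ℝ => f (s + x • v)) (fderiv ℝ f s v) 0 := by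
  have h1 : HasDerivAt (fun x : ℝ => s + x • v) v 0 := by
    have := ((hasDerivAt_id (0 : ℝ)).smul_const v).const_add s
    rwa [one_smul] at this
  have h2 : HasFDerivAt f (fderiv ℝ f s) (s + (0 : ℝ) • v) := by
    rw [zero_smul, add_zero]
    exact (hf.differentiable (by simp) s).hasFDerivAt
  exact h2.comp_hasDerivAt 0 h1

lemma hasDerivAt_line_apply (s v : Fin 2 → ℝ) (i : Fin 2) :
    HasDerivAt (fun x : ℝ => (s + x • v) i) (v i) 0 := by
  have := ((hasDerivAt_id (0 : ℝ)).mul_const (v i)).const_add (s i)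
  rwa [one_mul] at this

/-- The square of the scale is a quadratic form in u, so the scale is stationary together with u.
Then `leftPt` is stationary, hence also its image under O, and `angles_immersion` applies. -/
lemma coupled_immersion (h : Arranged a τ) (hε : ε ^ 2 = 1)
    (hκ : ∀ s, κ ⬝ᵥ rightPt a τ ε' s ≠ 0) (hc : c₀ ≠ 0) (s v : Fin 2 → ℝ)
    (hu : HasDerivAt (fun x : ℝ => coupledVec a τ κ c₀ ε ε' (s + x • v)) 0 0)
    (hO : HasMatDerivAt (fun x : ℝ => coupledMat a τ ε ε' η (s + x • v)) 0 0) : v = 0 := by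
  have dl := hasDerivAt_line (h.contDiff_leftPt ε) s v
  have dr := hasDerivAt_line (h.contDiff_rightPt ε') s v
  obtain ⟨σ, hσ⟩ : ∃ σ : ℝ → ℝ, ∀ x, σ x = c₀ / (κ ⬝ᵥ rightPt a τ ε' (s + x • v)) :=
    ⟨_, fun _ => rfl⟩
  have hσ0 : σ 0 ≠ 0 := by
    rw [hσ]
    exact div_ne_zero hc (hκ _)
  obtain ⟨σ', dσ⟩ : ∃ σ', HasDerivAt σ σ' 0 := by
    have := ((hasDerivAt_const (0 : ℝ) κ).dotProduct' dr).fun_inv (hκ _)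
    refine ⟨_, ((this.const_mul c₀).congr_of_eventuallyEq (Filter.Eventually.of_forall fun x => ?_))⟩
    simp only [hσ, div_eq_mul_inv]
  have hul : ∀ x, coupledVec a τ κ c₀ ε ε' (s + x • v) = σ x • leftPt a τ ε (s + x • v) := by
    intro x
    rw [hσ, coupledVec]
  have hσ' : σ' = 0 := by
    rw [hasDerivAt_pi] at hu
    have e1 := ((((hu 0).fun_pow 2).const_mul ((a 0 - τ 1) * (a 0 - τ 2) * (a 0 - τ 0))).fun_add
      (((hu 1).fun_pow 2).const_mul ((a 1 - τ 1) * (a 1 - τ 2) * (a 1 - τ 0)))).fun_add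
      (((hu 2).fun_pow 2).const_mul ((a 2 - τ 1) * (a 2 - τ 2) * (a 2 - τ 0)))
    simp only [h.leftPt_scale hε _ (hul _), Pi.zero_apply, mul_zero, add_zero] at e1
    have e2 := (dσ.fun_pow 2).unique e1
    simpa [hσ0] using e2
  have dl0 : HasDerivAt (fun x : ℝ => leftPt a τ ε (s + x • v)) 0 0 := by
    have e1 := dσ.fun_smul dl
    simp only [← hul, hσ', zero_smul, add_zero] at e1
    have e2 := hu.unique e1
    rwa [(smul_eq_zero.1 e2.symm).resolve_left hσ0] at dl
  have dr0 : HasDerivAt (fun x : ℝ => rightPt a τ ε' (s + x • v)) 0 0 := by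
    have e1 := hO.mulVec dl0
    simpa only [(h.coupledMat_mulVec hε _).1, Matrix.zero_mulVec, Matrix.mulVec_zero, add_zero]
      using e1
  obtain ⟨h1, h2⟩ := IsArranged.angles_immersion h hε (hasDerivAt_line_apply s v 0)
    (hasDerivAt_line_apply s v 1) dl0 dr0
  ext i
  fin_cases i
  · exact h1
  · exact h2

/-- As O'(a ∘ l) = 0, the derivative of O(a ∘ l) = τ ∘ r is O(a ∘ l') = τ ∘ r'. The scalar product
with O((a ∘ l) × l) = η (τ ∘ r) × r removes O and leaves the relation between triple products used
by `flow_relation`. -/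
lemma coupled_flow (h : Arranged a τ) (hε : ε ^ 2 = 1) (hε' : ε' ^ 2 = 1) (hη : η ^ 2 = 1)
    (hκ : ∀ s, κ ⬝ᵥ rightPt a τ ε' s ≠ 0) (hc : c₀ ≠ 0) (s v : Fin 2 → ℝ)
    {O' : Matrix (Fin 3) (Fin 3) ℝ}
    (hO : HasMatDerivAt (fun x : ℝ => coupledMat a τ ε ε' η (s + x • v)) O' 0)
    (hO' : O' *ᵥ (a * coupledVec a τ κ c₀ ε ε' s) = 0) :
    IsArranged.flowCoeff₀ (a 0) (a 1) (a 2) (τ 0) (τ 1) (τ 2) (s 0) * v 0 +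
      η * ε * ε' * IsArranged.flowCoeff₁ (a 0) (a 1) (a 2) (τ 0) (τ 1) (τ 2) (s 1) * v 1 = 0 := by
  have dl := hasDerivAt_line (h.contDiff_leftPt ε) s v
  have dr := hasDerivAt_line (h.contDiff_rightPt ε') s v
  obtain ⟨l', hl'⟩ : ∃ l', l' = fderiv ℝ (leftPt a τ ε) s v := ⟨_, rfl⟩
  obtain ⟨r', hr'⟩ : ∃ r', r' = fderiv ℝ (rightPt a τ ε') s v := ⟨_, rfl⟩
  rw [← hl'] at dl
  rw [← hr'] at dr
  have e1 := hO.mulVec ((hasDerivAt_const (0 : ℝ) a).fun_mul dl)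
  simp only [(h.coupledMat_mulVec hε _).2.1] at e1
  have e2 := e1.unique ((hasDerivAt_const (0 : ℝ) τ).fun_mul dr)
  simp only [zero_smul, add_zero, zero_mul, zero_add] at e2
  have e3 : O' *ᵥ (a * leftPt a τ ε s) = 0 := by
    rw [coupledVec, mul_smul_comm, Matrix.mulVec_smul] at hO'
    exact (smul_eq_zero.1 hO').resolve_left (div_ne_zero hc (hκ s))
  rw [e3, zero_add] at e2
  have e4 := dotProduct_eq_of_orthogonal (h.coupledMat_mul_transpose hε hε' hη s).1
    ((a * leftPt a τ ε s) ⨯₃ leftPt a τ ε s) (a * l')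
  rw [e2, (h.coupledMat_mulVec hε s).2.2, smul_dotProduct, mul_cross_self, mul_cross_self] at e4
  have key := IsArranged.flow_relation h hε hε' hη (hasDerivAt_line_apply s v 0)
    (hasDerivAt_line_apply s v 1) (l := leftPt a τ ε s) (r := rightPt a τ ε' s) (by simp [leftPt])
    (by simp [rightPt]) dl dr (by
      simp only [dotProduct, Fin.sum_univ_three, Pi.mul_apply, Matrix.cons_val, smul_eq_mul] at e4
      linear_combination -e4)
  simpa using key

end Arranged

/-- The coupled pairs with given signs form a torus. -/
theorem exists_isCoupledTorus {a τ κ : Vec3} {c₀ δ : ℝ} (h : Arranged a τ) (hc : 0 < c₀)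
    (hδ : ∀ i, δ ≤ a i) (hlt : ∀ v ≠ 0, v ⬝ᵥ (τ * v) < δ * (v ⬝ᵥ v) + (κ ⬝ᵥ v) ^ 2 / c₀) {u₀ : Vec3}
    {O₀ : Matrix (Fin 3) (Fin 3) ℝ} (h₀ : IsCoupled a τ κ c₀ u₀ O₀) :
    ∃ u O A₀ A₁, IsCoupledTorus a τ κ c₀ u₀ O₀ u O A₀ A₁ := by
  have angles : ∀ {u O}, IsCoupled a τ κ c₀ u O → _ := fun hu =>
    h.exists_angles (hu.ne_zero hc) hu.dot_eq.1 hu.dot_eq.2.1 hu.dot_eq.2.2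
  obtain ⟨hu0, hz0, hang⟩ := angles h₀
  obtain ⟨ε, hε, hεu, hεiff⟩ := exists_sign hu0
  obtain ⟨ε', hε', hεz, hεiff'⟩ := exists_sign hz0
  obtain ⟨m₀, s₀, hm₀, hl₀, hr₀⟩ := hang ε ε' hε hε' hεu hεz
  have hη := det_sq_of_mul_transpose h₀.orthogonal
  have hκ : ∀ s, κ ⬝ᵥ rightPt a τ ε' s ≠ 0 := fun s => h.dotProduct_rightPt_ne_zero hδ hlt hε' s
  have hrc := h.contDiff_rightPt ε'
  have hκc : ContDiff ℝ ∞ (fun s => κ ⬝ᵥ rightPt a τ ε' s) :=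
    SphericalSupport.contDiff_dotProduct contDiff_const hrc
  -- The plane of angles is connected and κ · r has no zeros; at the angles s₀ of the given pair it
  -- is positive.
  have hκpos : ∀ s, 0 < κ ⬝ᵥ rightPt a τ ε' s := fun s =>
    isPreconnected_univ.pos_of_pos hκc.continuous.continuousOn (fun s _ => hκ s) (Set.mem_univ s₀)
      (Set.mem_univ s) (by rw [(h.eq_coupled hε h₀ hc hm₀ hl₀ hr₀).1]; positivity)
  have hpos : ∀ s, 0 < c₀ / (κ ⬝ᵥ rightPt a τ ε' s) := fun s => div_pos hc (hκpos s)
  have hmulVec : ∀ s, coupledMat a τ ε ε' O₀.det s *ᵥ coupledVec a τ κ c₀ ε ε' s =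
      (c₀ / (κ ⬝ᵥ rightPt a τ ε' s)) • rightPt a τ ε' s := fun s => by
    rw [coupledVec, Matrix.mulVec_smul, (h.coupledMat_mulVec hε s).1]
  have hper : IsBiperiodic (leftPt a τ ε) := fun s n => leftVec_periodic _ _ _ _ _
  have hper' : IsBiperiodic (rightPt a τ ε') := fun s n => rightVec_periodic _ _ _ _ _
  have hself : ∀ {e : ℝ}, e ^ 2 = 1 → ∀ {x : ℝ}, 0 < x → 0 < e * (e * x) := by
    intro e he x hx
    rw [← mul_assoc, ← sq, he, one_mul]
    exact hx
  refine ⟨coupledVec a τ κ c₀ ε ε', fun s => Matrix.of.symm (coupledMat a τ ε ε' O₀.det s),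
    IsArranged.flowCoeff₀ (a 0) (a 1) (a 2) (τ 0) (τ 1) (τ 2),
    fun x => O₀.det * ε * ε' * IsArranged.flowCoeff₁ (a 0) (a 1) (a 2) (τ 0) (τ 1) (τ 2) x,
    ?_, ?_, ?_, ?_, ?_, ?_, ?_, ?_, ?_, ?_, ?_, ?_, ?_, ?_, ?_, ?_, ?_⟩
  · exact (contDiff_const.fun_div hκc hκ).smul (h.contDiff_leftPt ε)
  · rw [contDiff_pi]
    intro i
    rw [contDiff_pi]
    intro j
    exact h.contDiff_coupledMat hε ε' O₀.det i j
  · intro s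
    exact h.coupledVec_isCoupled hε hε' hη s (hκ s)
  · intro s
    obtain ⟨⟨p1, p2⟩, -⟩ := IsArranged.quadAngles_pos h (s 0) (s 1)
    rw [hεiff]
    change 0 < ε * (c₀ / (κ ⬝ᵥ rightPt a τ ε' s) * (ε * (_ * _)))
    rw [mul_left_comm]
    exact mul_pos (hpos s) (hself hε (mul_pos (Real.sqrt_pos.2 p1) (Real.sqrt_pos.2 p2)))
  · intro s
    obtain ⟨-, -, ⟨p1, p2⟩, -⟩ := IsArranged.quadAngles_pos h (s 0) (s 1)
    rw [hεiff', Equiv.apply_symm_apply, hmulVec]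
    change 0 < ε' * (c₀ / (κ ⬝ᵥ rightPt a τ ε' s) * (ε' * (_ * _)))
    rw [mul_left_comm]
    exact mul_pos (hpos s) (hself hε' (mul_pos (Real.sqrt_pos.2 p1) (Real.sqrt_pos.2 p2)))
  · intro s
    exact (h.coupledMat_mul_transpose hε hε' hη s).2
  · intro u' O' hu' h1 h2 h3
    rw [hεiff] at h1
    rw [hεiff'] at h2
    obtain ⟨m, s, hm, hl, hr⟩ := (angles hu').2.2 ε ε' hε hε' h1 h2
    obtain ⟨-, e1, e2⟩ := h.eq_coupled hε hu' hc hm hl hr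
    exact ⟨s, e1, by rw [← h3]; exact e2⟩
  · intro s s' h1 h2
    have h2' : coupledMat a τ ε ε' O₀.det s = coupledMat a τ ε ε' O₀.det s' := h2
    have e1 : c₀ / (κ ⬝ᵥ rightPt a τ ε' s) = c₀ / (κ ⬝ᵥ rightPt a τ ε' s') := by
      have f1 := h.leftPt_scale hε s (m := c₀ / (κ ⬝ᵥ rightPt a τ ε' s)) rfl
      have f2 := h.leftPt_scale hε s' (m := c₀ / (κ ⬝ᵥ rightPt a τ ε' s')) rfl
      have h1' : (c₀ / (κ ⬝ᵥ rightPt a τ ε' s)) • leftPt a τ ε s =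
        (c₀ / (κ ⬝ᵥ rightPt a τ ε' s')) • leftPt a τ ε s' := h1
      rw [h1', f2] at f1
      exact (pow_left_inj₀ (hpos s).le (hpos s').le two_ne_zero).1 f1.symm
    have e2 : leftPt a τ ε s = leftPt a τ ε s' := by
      simp only [coupledVec, e1] at h1
      exact smul_right_injective _ (hpos s').ne' h1
    have e3 : rightPt a τ ε' s = rightPt a τ ε' s' := by
      rw [← (h.coupledMat_mulVec (η := O₀.det) hε s).1, h2', e2, (h.coupledMat_mulVec hε s').1]
    obtain ⟨⟨g1, g2⟩, g3, g4⟩ := IsArranged.angles_unique h hε e2 e3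
    obtain ⟨n₀, hn₀⟩ := exists_eq_add_of_sin_eq g1 g2
    obtain ⟨n₁, hn₁⟩ := exists_eq_add_of_sin_eq g3 g4
    refine ⟨![n₀, n₁], fun i => ?_⟩
    fin_cases i
    · exact hn₀
    · exact hn₁
  · intro s n
    simp only [coupledVec, hper s n, hper' s n]
  · intro s n
    simp only [coupledMat, hper s n, hper' s n]
  · intro s v hu hO
    refine h.coupled_immersion hε hκ hc.ne' s v hu (η := O₀.det) fun i j => ?_
    exact hasDerivAt_pi.1 (hasDerivAt_pi.1 hO i) j
  · exact IsArranged.contDiff_flowCoeff₀ h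
  · exact contDiff_const.mul (IsArranged.contDiff_flowCoeff₁ h)
  · intro x n
    simp only [IsArranged.flowCoeff₀, quadAngles, sinMix, sin_add_two_pi_mul]
  · intro x n
    simp only [IsArranged.flowCoeff₁, quadAngles, sinMix, sin_add_two_pi_mul]
  · intro x y
    rcases IsArranged.flowCoeff_ne_zero h x y with h1 | h1
    · exact Or.inl h1
    · refine Or.inr (mul_ne_zero (mul_ne_zero (mul_ne_zero ?_ ?_) ?_) h1) <;>
      · rintro h2
        simp [h2] at hη hε hε'
  · intro s v O' hO hO'
    refine h.coupled_flow hε hε' hη hκ hc.ne' s v (fun i j => ?_) hO'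
    exact hasDerivAt_pi.1 (hasDerivAt_pi.1 hO i) j

/-! ### The position of the eigenvalues -/

lemma mul_eq_smul_of_forall {a u : Vec3} {r : ℝ} (h : ∀ i, (a i - r) * u i ^ 2 = 0) :
    a * u = r • u := by
  ext i
  rcases mul_eq_zero.1 (h i) with h1 | h1
  · rw [Pi.mul_apply, sub_eq_zero.1 h1, Pi.smul_apply, smul_eq_mul]
  · rw [Pi.mul_apply, Pi.smul_apply, pow_eq_zero_iff two_ne_zero |>.1 h1, mul_zero, smul_zero]

lemma forall_eq_zero_of_add {f : Fin 3 → ℝ} (h0 : ∀ i, 0 ≤ f i) (h : f 0 + f 1 + f 2 ≤ 0) (i : Fin 3) :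
    f i = 0 := by
  have h1 := h0 0
  have h2 := h0 1
  have h3 := h0 2
  have e1 : f 0 = 0 := by linarith
  have e2 : f 1 = 0 := by linarith
  have e3 : f 2 = 0 := by linarith
  fin_cases i
  exacts [e1, e2, e3]

/-- If no coupled vector is an eigenvector, then the eigenvalues are arranged, in a suitable
order. -/
lemma exists_arranged {a τ κ : Vec3} {c₀ : ℝ} (ha : Monotone a) (hτ : Monotone τ) (hc : 0 < c₀)
    (hlt : ∀ v ≠ 0, v ⬝ᵥ (τ * v) < a 0 * (v ⬝ᵥ v) + (κ ⬝ᵥ v) ^ 2 / c₀)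
    {u₀ : Vec3} {O₀ : Matrix (Fin 3) (Fin 3) ℝ} (h₀ : IsCoupled a τ κ c₀ u₀ O₀)
    (heig : ∀ u O (r : ℝ), IsCoupled a τ κ c₀ u O → a * u ≠ r • u) :
    ∃ σ ρ : Equiv.Perm (Fin 3), Arranged (a ∘ σ) (τ ∘ ρ) := by
  have a01 : a 0 ≤ a 1 := ha (Fin.zero_le 1)
  have a12 : a 1 ≤ a 2 := ha (by decide)
  have t01 : τ 0 ≤ τ 1 := hτ (Fin.zero_le 1)
  have t12 : τ 1 ≤ τ 2 := hτ (by decide)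
  obtain ⟨m0, m1, m2⟩ := h₀.dot_eq
  have he := fun r => heig u₀ O₀ r h₀
  generalize O₀ *ᵥ u₀ = z at m0 m1 m2
  simp only [dotProduct, Fin.sum_univ_three, Pi.mul_apply] at m0 m1 m2 hlt
  -- The span of the last two basis vectors meets κ^⊥. There the form τ lies below a₀ by `hlt`, but
  -- it is at least τ₁.
  have h1 : τ 1 < a 0 := by
    by_contra hge
    obtain ⟨x, y, hxy, hk⟩ : ∃ x y : ℝ, 0 < x ^ 2 + y ^ 2 ∧ κ 1 * x + κ 2 * y = 0 := by
      by_cases h2 : κ 2 = 0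
      · exact ⟨0, 1, by norm_num, by simp [h2]⟩
      · exact ⟨κ 2, -κ 1, by positivity, by ring⟩
    have hne : (![0, x, y] : Vec3) ≠ 0 := by
      intro h0
      have e1 : x = 0 := congrFun h0 1
      have e2 : y = 0 := congrFun h0 2
      rw [e1, e2] at hxy
      norm_num at hxy
    have := hlt _ hne
    simp only [Matrix.cons_val, mul_zero, zero_add, hk] at this
    have e1 := mul_nonneg (by linarith : 0 ≤ τ 1 - a 0) (sq_nonneg x)
    have e2 := mul_nonneg (by linarith : 0 ≤ τ 2 - a 0) (sq_nonneg y)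
    norm_num at this
    linarith
  -- Otherwise ∑ (a_i - a₀)u_i² = ∑ (τ_i - a₀)z_i² ≤ 0, and u is an eigenvector for a₀.
  have h2 : a 0 < τ 2 := by
    by_contra hge
    refine he (a 0) (mul_eq_smul_of_forall fun i => ?_)
    refine forall_eq_zero_of_add (f := fun i => (a i - a 0) * u₀ i ^ 2)
      (fun i => mul_nonneg (sub_nonneg.2 (ha (Fin.zero_le i))) (sq_nonneg _)) ?_ i
    have e0 := mul_nonneg (by linarith : 0 ≤ a 0 - τ 0) (sq_nonneg (z 0))
    have e1 := mul_nonneg (by linarith : 0 ≤ a 0 - τ 1) (sq_nonneg (z 1))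
    have e2 := mul_nonneg (by linarith : 0 ≤ a 0 - τ 2) (sq_nonneg (z 2))
    linear_combination e0 + e1 + e2 - m1 + a 0 * m0
  -- Otherwise ∑ (a_i - τ₁)(τ₂ - a_i)u_i² = ∑ (τ_i - τ₁)(τ₂ - τ_i)z_i² ≤ 0 has nonnegative terms on
  -- the left, and u is an eigenvector for τ₂.
  have h3 : τ 2 < a 2 := by
    by_contra hge
    refine he (τ 2) (mul_eq_smul_of_forall fun i => ?_)
    have hpos : ∀ i, 0 < a i - τ 1 := fun i => by linarith [ha (Fin.zero_le i)]
    have hall : ∀ i, a i ≤ τ 2 := fun i => (ha (Fin.le_last i)).trans (not_lt.1 hge)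
    have := forall_eq_zero_of_add (f := fun i => (a i - τ 1) * ((τ 2 - a i) * u₀ i ^ 2))
      (fun i => mul_nonneg (hpos i).le (mul_nonneg (sub_nonneg.2 (hall i)) (sq_nonneg _))) (by
        have e1 := mul_nonneg (mul_nonneg (by linarith : 0 ≤ τ 2 - τ 0) (by linarith : 0 ≤ τ 1 - τ 0))
          (sq_nonneg (z 0))
        linear_combination e1 + m2 - (τ 1 + τ 2) * m1 + τ 1 * τ 2 * m0) i
    have := (mul_eq_zero.1 this).resolve_left (hpos i).ne'
    linear_combination -this
  -- If τ₂ = a₁, the matrix exchanging the last two axes and a multiple of the second basis vector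
  -- form a coupled pair with an eigenvector. Its scale exists because κ₂ = 0 would give τ₂ < a₀.
  have h4 : τ 2 ≠ a 1 := by
    intro h4
    have hκ : κ 2 ≠ 0 := by
      intro hκ
      have := hlt ![0, 0, 1] (fun h0 => one_ne_zero (congrFun h0 2))
      simp [hκ] at this
      linarith
    let P : Matrix (Fin 3) (Fin 3) ℝ := !![1, 0, 0; 0, 0, 1; 0, 1, 0]
    refine heig ![0, c₀ / κ 2, 0] P (a 1) ⟨?_, ?_, ?_⟩ ?_
    · ext i j
      fin_cases i <;> fin_cases j <;> simp [P, Matrix.mul_apply, Fin.sum_univ_three]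
    · ext i
      fin_cases i <;> simp [P, Matrix.mulVec, dotProduct, Fin.sum_univ_three, h4]
    · simp [P, Matrix.mulVec, dotProduct, Fin.sum_univ_three]
      field_simp
    · ext i
      fin_cases i <;> simp
  -- Moves the largest entry to the front: τ₂ always becomes t, and a₂ becomes a in the second case.
  let σ : Equiv.Perm (Fin 3) := ⟨![2, 0, 1], ![1, 2, 0], by decide, by decide⟩
  rcases lt_or_gt_of_ne h4 with h5 | h5
  · exact ⟨Equiv.refl _, σ, t01, a12, Or.inl ⟨h1, h2, h5⟩⟩
  · exact ⟨σ, σ, t01, a01, Or.inr ⟨h1, h5, h3⟩⟩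

/-- Reordering the eigenvalues of a diagonalized matrix. -/
lemma diagonal_perm {F : Matrix (Fin 3) (Fin 3) ℝ} (hF : F * Fᵀ = 1) (b : Vec3)
    (σ : Equiv.Perm (Fin 3)) :
    F.submatrix σ id * (F.submatrix σ id)ᵀ = 1 ∧
    Fᵀ * Matrix.diagonal b * F =
      (F.submatrix σ id)ᵀ * Matrix.diagonal (b ∘ σ) * F.submatrix σ id := by
  constructor
  · rw [Matrix.transpose_submatrix, ← Matrix.submatrix_mul F Fᵀ σ id σ Function.bijective_id, hF,
      Matrix.submatrix_one_equiv]
  · have h : Matrix.diagonal (b ∘ σ) = (Matrix.diagonal b).submatrix σ σ :=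
      (Matrix.submatrix_diagonal_equiv b σ).symm
    rw [Matrix.transpose_submatrix, h, Matrix.submatrix_mul_equiv Fᵀ (Matrix.diagonal b) id σ σ,
      Matrix.submatrix_mul_equiv _ F id σ id, Matrix.submatrix_id_id]

lemma SphericalSupport.IsNormalForm.perm {N : ℕ} {S : SphericalSupport N} {r δ : ℝ}
    {F T : Matrix (Fin 3) (Fin 3) ℝ} {a : Fin 3 → ℝ} (h : S.IsNormalForm r δ F a T)
    (σ : Equiv.Perm (Fin 3)) : S.IsNormalForm r δ (F.submatrix σ id) (a ∘ σ) T where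
  orthogonal := (diagonal_perm h.orthogonal a σ).1
  ne_zero i := h.ne_zero _
  inertia_eq := by
    rw [h.inertia_eq, (diagonal_perm h.orthogonal _ σ).2]
    rfl
  symm := h.symm
  mul_eq_one := h.mul_eq_one
  le i := h.le _
  lt := h.lt

namespace SphericalSupport

variable {N : ℕ} (S : SphericalSupport N)

/-! ### States as coupled pairs -/

/-- The data that turn the states with spatial momentum `k` and energy `(k · T k - c₀) / 2` into
coupled pairs. -/
structure IsLevelForm (r δ : ℝ) (F : Matrix (Fin 3) (Fin 3) ℝ) (a : Vec3)
    (T H : Matrix (Fin 3) (Fin 3) ℝ) (τ k : Vec3) (c₀ : ℝ) : Prop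
    extends S.IsNormalForm r δ F a T where
  pos : 0 < c₀
  orthogonal' : H * Hᵀ = 1
  tensor_eq : -(T - c₀⁻¹ • Matrix.vecMulVec (T *ᵥ k) (T *ᵥ k)) = Hᵀ * Matrix.diagonal τ * H

/-- The state of a coupled pair. -/
def coupledState (F H : Matrix (Fin 3) (Fin 3) ℝ) (a u : Vec3) (O : Matrix (Fin 3) (Fin 3) ℝ) :
    SupportState :=
  (Fᵀ *ᵥ (a * u), Matrix.of.symm (Hᵀ * O * F))

/-- The vector of the coupled pair of a state. -/
def stateVec (F : Matrix (Fin 3) (Fin 3) ℝ) (a : Vec3) (x : SupportState) : Vec3 :=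
  fun i => (F *ᵥ x.1) i / a i

/-- The matrix of the coupled pair of a state. -/
def stateMat (F H : Matrix (Fin 3) (Fin 3) ℝ) (x : SupportState) : Matrix (Fin 3) (Fin 3) ℝ :=
  H * Matrix.of x.2 * Fᵀ

namespace IsNormalForm

variable {S} {r δ : ℝ} {F T : Matrix (Fin 3) (Fin 3) ℝ} {a : Vec3}

lemma mul_stateVec (h : S.IsNormalForm r δ F a T) (x : SupportState) :
    Fᵀ *ᵥ (a * stateVec F a x) = x.1 := by
  have : a * stateVec F a x = F *ᵥ x.1 := by
    ext i
    rw [Pi.mul_apply, stateVec, mul_div_cancel₀ _ (h.ne_zero i)]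
  rw [this, Matrix.mulVec_mulVec, mul_eq_one_comm.1 h.orthogonal, Matrix.one_mulVec]

lemma inertia_mulVec (h : S.IsNormalForm r δ F a T) (u : Vec3) :
    S.inertia *ᵥ (Fᵀ *ᵥ (a * u)) = r • (Fᵀ *ᵥ (a * u)) + Fᵀ *ᵥ u := by
  rw [h.inertia_eq, Matrix.mulVec_mulVec, Matrix.mul_assoc, Matrix.mul_assoc, h.orthogonal, mul_one,
    ← Matrix.mulVec_mulVec, ← Matrix.mulVec_smul, ← Matrix.mulVec_add]
  congr 1
  ext i
  rw [Matrix.mulVec_diagonal]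
  simp only [Pi.mul_apply, Pi.add_apply, Pi.smul_apply, smul_eq_mul]
  have := h.ne_zero i
  field_simp

lemma mul_eq_one' (h : S.IsNormalForm r δ F a T) :
    T * (S.spaceTensor + r • (1 : Matrix (Fin 3) (Fin 3) ℝ)) = 1 :=
  mul_eq_one_comm.1 h.mul_eq_one

/-- Shifting r from ℐ to G gives k = (G + r)w + W, with W the space components of (ℐ - r)Ω; T
inverts G + r. -/
lemma mulVec_spaceMomentum (h : S.IsNormalForm r δ F a T) {x : SupportState} (hx : x ∈ phaseSpace)
    {u : Vec3} (hu : Fᵀ *ᵥ (a * u) = x.1) :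
    T *ᵥ S.spaceMomentum x = spaceVelocity x + T *ᵥ (Matrix.of x.2 *ᵥ (Fᵀ *ᵥ u)) := by
  have h1 : S.spaceMomentum x = (S.spaceTensor + r • (1 : Matrix (Fin 3) (Fin 3) ℝ)) *ᵥ
      spaceVelocity x + Matrix.of x.2 *ᵥ (Fᵀ *ᵥ u) := by
    rw [S.spaceMomentum_eq hx, spaceInertia, ← hu, h.inertia_mulVec, Matrix.mulVec_add,
      Matrix.mulVec_smul, hu, Matrix.add_mulVec, Matrix.smul_mulVec, Matrix.one_mulVec]
    simp only [spaceVelocity]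
    abel
  rw [h1, Matrix.mulVec_add, Matrix.mulVec_mulVec, h.mul_eq_one', Matrix.one_mulVec]

lemma dotProduct_mulVec_comm (h : S.IsNormalForm r δ F a T) (u v : Vec3) :
    u ⬝ᵥ (T *ᵥ v) = (T *ᵥ u) ⬝ᵥ v := by
  rw [Matrix.dotProduct_mulVec, ← Matrix.mulVec_transpose, h.symm]

/-- `k · T k - 2 E` in terms of the velocity. -/
lemma sub_energy (h : S.IsNormalForm r δ F a T) {x : SupportState} (hx : x ∈ phaseSpace)
    {u : Vec3} (hu : Fᵀ *ᵥ (a * u) = x.1) :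
    S.spaceMomentum x ⬝ᵥ (T *ᵥ S.spaceMomentum x) - 2 * S.energy x =
      (T *ᵥ S.spaceMomentum x) ⬝ᵥ (Matrix.of x.2 *ᵥ (Fᵀ *ᵥ u)) := by
  rw [← h.dotProduct_mulVec_comm (S.spaceMomentum x) (Matrix.of x.2 *ᵥ (Fᵀ *ᵥ u)),
    h.mulVec_spaceMomentum hx hu, dotProduct_add, S.energy_eq hx, dotProduct_comm (spaceVelocity x)]
  ring

/-- The quantity is w · W + W · TW, with w · W = ∑ a_i u_i² ≥ δ|u|² and |W| = |u|, while -W · TW <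
δ|W|². -/
lemma sub_energy_pos (h : S.IsNormalForm r δ F a T) {x : SupportState} (hx : x ∈ phaseSpace)
    (hx0 : x.1 ≠ 0) :
    0 < S.spaceMomentum x ⬝ᵥ (T *ᵥ S.spaceMomentum x) - 2 * S.energy x := by
  have hu := h.mul_stateVec x
  obtain ⟨u, hu'⟩ : ∃ u, u = stateVec F a x := ⟨_, rfl⟩
  rw [← hu'] at hu
  have hFF := mul_eq_one_comm.1 h.orthogonal
  have hM := (isOrthonormalFrame_iff _).1 hx
  have hu0 : u ≠ 0 := by
    rintro rfl
    rw [mul_zero, Matrix.mulVec_zero] at hu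
    exact hx0 hu.symm
  obtain ⟨W, hW⟩ : ∃ W, W = Matrix.of x.2 *ᵥ (Fᵀ *ᵥ u) := ⟨_, rfl⟩
  have hWW : W ⬝ᵥ W = u ⬝ᵥ u := by
    rw [hW, dotProduct_eq_of_orthogonal hM, dotProduct_eq_of_orthogonal]
    rw [Matrix.transpose_transpose, hFF]
  have hW0 : W ≠ 0 := by
    intro h0
    rw [h0, dotProduct_zero] at hWW
    exact hu0 (dotProduct_self_eq_zero.1 hWW.symm)
  have hw : spaceVelocity x ⬝ᵥ W = (a * u) ⬝ᵥ u := by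
    rw [hW, spaceVelocity, dotProduct_eq_of_orthogonal hM, ← hu, dotProduct_eq_of_orthogonal]
    rw [Matrix.transpose_transpose, hFF]
  rw [h.sub_energy hx hu, h.mulVec_spaceMomentum hx hu, ← hW, add_dotProduct, hw, dotProduct_comm _ W]
  have h1 := h.lt W hW0
  rw [hWW] at h1
  have h2 : δ * (u ⬝ᵥ u) ≤ (a * u) ⬝ᵥ u := by
    simp only [dotProduct, Finset.mul_sum, Pi.mul_apply]
    refine Finset.sum_le_sum fun i _ => ?_
    rw [mul_assoc]
    exact mul_le_mul_of_nonneg_right (h.le i) (mul_self_nonneg _)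
  linarith

end IsNormalForm

namespace IsLevelForm

variable {S} {r δ c₀ : ℝ} {F T H : Matrix (Fin 3) (Fin 3) ℝ} {a τ k : Vec3}

lemma tensor_mulVec (h : S.IsLevelForm r δ F a T H τ k c₀) (W : Vec3) :
    Hᵀ *ᵥ (τ * (H *ᵥ W)) = -(T *ᵥ W) + (c₀⁻¹ * ((T *ᵥ k) ⬝ᵥ W)) • (T *ᵥ k) := by
  have h1 : τ * (H *ᵥ W) = Matrix.diagonal τ *ᵥ (H *ᵥ W) := by
    ext i
    rw [Matrix.mulVec_diagonal, Pi.mul_apply]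
  rw [h1, Matrix.mulVec_mulVec, Matrix.mulVec_mulVec, ← h.tensor_eq, Matrix.neg_mulVec,
    Matrix.sub_mulVec, Matrix.smul_mulVec, Matrix.vecMulVec_mulVec]
  ext i
  simp
  ring

lemma lt' (h : S.IsLevelForm r δ F a T H τ k c₀) (v : Vec3) (hv : v ≠ 0) :
    v ⬝ᵥ (τ * v) < δ * (v ⬝ᵥ v) + ((H *ᵥ (T *ᵥ k)) ⬝ᵥ v) ^ 2 / c₀ := by
  obtain ⟨y, rfl⟩ : ∃ y, v = H *ᵥ y := ⟨Hᵀ *ᵥ v, by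
    rw [Matrix.mulVec_mulVec, h.orthogonal', Matrix.one_mulVec]⟩
  have hy : y ≠ 0 := by
    rintro rfl
    exact hv (Matrix.mulVec_zero _)
  rw [dotProduct_eq_of_orthogonal h.orthogonal', dotProduct_eq_of_orthogonal h.orthogonal']
  have h1 : (H *ᵥ y) ⬝ᵥ (τ * (H *ᵥ y)) = y ⬝ᵥ (Hᵀ *ᵥ (τ * (H *ᵥ y))) := by
    rw [Matrix.dotProduct_mulVec, Matrix.vecMul_transpose]
  rw [h1, h.tensor_mulVec, dotProduct_add, dotProduct_neg, dotProduct_smul, smul_eq_mul,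
    dotProduct_comm y (T *ᵥ k)]
  have h2 := h.lt y hy
  rw [div_eq_inv_mul]
  nlinarith

/-- The energy equation reads Tk · W = c₀, so the constant vector in w = Tk - TW can be written as
c₀⁻¹(Tk · W)Tk. This makes w a linear function of W whose matrix is diagonal in the basis H. -/
lemma isCoupled (h : S.IsLevelForm r δ F a T H τ k c₀) {x : SupportState} (hx : x ∈ phaseSpace)
    (hk : S.spaceMomentum x = k) (hE : k ⬝ᵥ (T *ᵥ k) - 2 * S.energy x = c₀) :
    IsCoupled a τ (H *ᵥ (T *ᵥ k)) c₀ (stateVec F a x) (stateMat F H x) := by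
  have hu := h.mul_stateVec x
  have h1 := h.sub_energy hx hu
  have h2 := h.mulVec_spaceMomentum hx hu
  have hM := (isOrthonormalFrame_iff _).1 hx
  rw [hk] at h1 h2
  rw [hE] at h1
  have h3 : H *ᵥ (Matrix.of x.2 *ᵥ (Fᵀ *ᵥ stateVec F a x)) = stateMat F H x *ᵥ stateVec F a x := by
    rw [stateMat, Matrix.mulVec_mulVec, Matrix.mulVec_mulVec, Matrix.mul_assoc]
  have h4 := h.tensor_mulVec (Matrix.of x.2 *ᵥ (Fᵀ *ᵥ stateVec F a x))
  rw [← h1, inv_mul_cancel₀ h.pos.ne', one_smul, h2, h3] at h4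
  refine ⟨?_, ?_, ?_⟩
  · calc _ = H * (Matrix.of x.2 * (Fᵀ * F) * (Matrix.of x.2)ᵀ) * Hᵀ := by
          simp only [stateMat, Matrix.transpose_mul, Matrix.transpose_transpose, Matrix.mul_assoc]
      _ = 1 := by
          rw [mul_eq_one_comm.1 h.orthogonal, mul_one, hM, mul_one, h.orthogonal']
  · have h5 := congrArg (H *ᵥ ·) h4
    simp only [Matrix.mulVec_mulVec, h.orthogonal', Matrix.one_mulVec, neg_add_cancel_comm_assoc] at h5
    rw [h5, stateMat, ← Matrix.mulVec_mulVec, hu, ← Matrix.mulVec_mulVec, spaceVelocity]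
  · rw [← h3, dotProduct_eq_of_orthogonal h.orthogonal', h1]

lemma coupledState_stateVec (h : S.IsLevelForm r δ F a T H τ k c₀) (x : SupportState) :
    coupledState F H a (stateVec F a x) (stateMat F H x) = x := by
  refine Prod.ext (h.mul_stateVec x) ?_
  have : Hᵀ * (H * Matrix.of x.2 * Fᵀ) * F = Matrix.of x.2 := by
    calc _ = (Hᵀ * H) * Matrix.of x.2 * (Fᵀ * F) := by simp only [Matrix.mul_assoc]
      _ = _ := by rw [mul_eq_one_comm.1 h.orthogonal', mul_eq_one_comm.1 h.orthogonal, one_mul, mul_one]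
  simp only [coupledState, stateMat, this, Equiv.symm_apply_apply]

lemma stateVec_coupledState (h : S.IsLevelForm r δ F a T H τ k c₀) (u : Vec3)
    (O : Matrix (Fin 3) (Fin 3) ℝ) : stateVec F a (coupledState F H a u O) = u := by
  ext i
  rw [stateVec, coupledState]
  simp only [Matrix.mulVec_mulVec, h.orthogonal, Matrix.one_mulVec, Pi.mul_apply]
  rw [mul_div_cancel_left₀ _ (h.ne_zero i)]

lemma stateMat_coupledState (h : S.IsLevelForm r δ F a T H τ k c₀) (u : Vec3)
    (O : Matrix (Fin 3) (Fin 3) ℝ) : stateMat F H (coupledState F H a u O) = O := by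
  rw [stateMat, coupledState]
  simp only [Equiv.apply_symm_apply]
  calc _ = (H * Hᵀ) * O * (F * Fᵀ) := by simp only [Matrix.mul_assoc]
    _ = _ := by rw [h.orthogonal', h.orthogonal, one_mul, mul_one]

/-- Reverses `isCoupled`: the normalization restores w = Tk - TW, and multiplication by G + r
recovers the momentum. -/
lemma coupledState_spec (h : S.IsLevelForm r δ F a T H τ k c₀) {u : Vec3}
    {O : Matrix (Fin 3) (Fin 3) ℝ} (hu : IsCoupled a τ (H *ᵥ (T *ᵥ k)) c₀ u O) :
    coupledState F H a u O ∈ phaseSpace ∧ S.spaceMomentum (coupledState F H a u O) = k ∧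
      k ⬝ᵥ (T *ᵥ k) - 2 * S.energy (coupledState F H a u O) = c₀ := by
  have hx : coupledState F H a u O ∈ phaseSpace :=
    isOrthonormalFrame_of_mul h.orthogonal' hu.orthogonal h.orthogonal
  have hxu : Fᵀ *ᵥ (a * u) = (coupledState F H a u O).1 := rfl
  have h2 := h.mulVec_spaceMomentum hx hxu
  have h1 := h.sub_energy hx hxu
  have hv : ∀ v, Matrix.of (coupledState F H a u O).2 *ᵥ (Fᵀ *ᵥ v) = Hᵀ *ᵥ (O *ᵥ v) := by
    intro v
    simp only [coupledState, Equiv.apply_symm_apply, Matrix.mulVec_mulVec]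
    rw [Matrix.mul_assoc, h.orthogonal, mul_one]
  have hW : H *ᵥ (Hᵀ *ᵥ (O *ᵥ u)) = O *ᵥ u := by
    rw [Matrix.mulVec_mulVec, h.orthogonal', Matrix.one_mulVec]
  have h3 : (T *ᵥ k) ⬝ᵥ (Hᵀ *ᵥ (O *ᵥ u)) = c₀ := by
    rw [← dotProduct_eq_of_orthogonal h.orthogonal', hW, hu.dotProduct_eq]
  have h4 := h.tensor_mulVec (Hᵀ *ᵥ (O *ᵥ u))
  rw [hW, h3, inv_mul_cancel₀ h.pos.ne', one_smul, ← hu.mulVec_eq, ← hv] at h4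
  have h5 : spaceVelocity (coupledState F H a u O) = Matrix.of (coupledState F H a u O).2 *ᵥ
    (Fᵀ *ᵥ (a * u)) := rfl
  rw [h5, h4, hv, neg_add_eq_sub, sub_add_cancel] at h2
  have hk : S.spaceMomentum (coupledState F H a u O) = k := by
    have := congrArg ((S.spaceTensor + r • (1 : Matrix (Fin 3) (Fin 3) ℝ)) *ᵥ ·) h2
    simpa only [Matrix.mulVec_mulVec, h.mul_eq_one, Matrix.one_mulVec] using this
  refine ⟨hx, hk, ?_⟩
  rw [hk, hv, h3] at h1
  exact h1

end IsLevelForm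

end SphericalSupport

/-! ### Vector fields on parametrized tori -/

/-- The common kernel of the functionals has dimension 2 by independence, and it contains the
two-dimensional image of D, so both coincide. -/
lemma exists_apply_eq_of_linearIndependent {E ι : Type*} [NormedAddCommGroup E] [NormedSpace ℝ E]
    [FiniteDimensional ℝ E] [Fintype ι] {l : ι → E →L[ℝ] ℝ} (hl : LinearIndependent ℝ l)
    (hcard : Fintype.card ι + 2 = Module.finrank ℝ E) {D : (Fin 2 → ℝ) →L[ℝ] E}
    (hD : Function.Injective D) (hlD : ∀ i v, l i (D v) = 0) {w : E} (hw : ∀ i, l i w = 0) :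
    ∃ v, D v = w := by
  have hl' : LinearIndependent ℝ fun i => (l i : E →ₗ[ℝ] ℝ) :=
    hl.map' (ContinuousLinearMap.coeLM ℝ) (LinearMap.ker_eq_bot.2 ContinuousLinearMap.coe_injective)
  let W : Submodule ℝ (Module.Dual ℝ E) := Submodule.span ℝ (Set.range fun i => (l i : E →ₗ[ℝ] ℝ))
  have hW : Module.finrank ℝ W = Fintype.card ι := finrank_span_eq_card hl'
  have hco := Subspace.finrank_add_finrank_dualCoannihilator_eq W
  have hmem : ∀ x : E, (∀ i, l i x = 0) → x ∈ W.dualCoannihilator := by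
    intro x hx
    rw [Submodule.mem_dualCoannihilator]
    intro φ hφ
    refine Submodule.span_induction ?_ ?_ ?_ ?_ hφ
    · rintro _ ⟨i, rfl⟩
      exact hx i
    · rfl
    · intro a b _ _ ha hb
      rw [LinearMap.add_apply, ha, hb, add_zero]
    · intro r a _ ha
      rw [LinearMap.smul_apply, ha, smul_zero]
  have hle : LinearMap.range (D : (Fin 2 → ℝ) →ₗ[ℝ] E) ≤ W.dualCoannihilator := by
    rintro _ ⟨v, rfl⟩
    exact hmem _ fun i => hlD i v
  have hrank : Module.finrank ℝ (LinearMap.range (D : (Fin 2 → ℝ) →ₗ[ℝ] E)) = 2 := by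
    rw [LinearMap.finrank_range_of_inj hD]
    simp
  have heq := Submodule.eq_of_le_of_finrank_eq hle (by omega)
  have := hmem w hw
  rw [← heq] at this
  exact this

/-- With a fixed left inverse Q of the derivative at s₀, Q ∘ dφ is invertible near s₀, and g = (Q ∘
dφ)⁻¹ Q h there. -/
lemma contDiff_of_fderiv_apply {E : Type*} [NormedAddCommGroup E] [NormedSpace ℝ E]
    [FiniteDimensional ℝ E] {φ : (Fin 2 → ℝ) → E} (hφ : ContDiff ℝ ∞ φ)
    (hinj : ∀ s, Function.Injective (fderiv ℝ φ s)) {h : (Fin 2 → ℝ) → E} (hh : ContDiff ℝ ∞ h)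
    {g : (Fin 2 → ℝ) → (Fin 2 → ℝ)} (hg : ∀ s, fderiv ℝ φ s (g s) = h s) : ContDiff ℝ ∞ g := by
  rw [contDiff_iff_contDiffAt]
  intro s₀
  obtain ⟨P, hP⟩ := LinearMap.exists_leftInverse_of_injective
    (fderiv ℝ φ s₀ : (Fin 2 → ℝ) →ₗ[ℝ] E) (LinearMap.ker_eq_bot.2 (hinj s₀))
  let Q : E →L[ℝ] (Fin 2 → ℝ) := LinearMap.toContinuousLinearMap P
  have hQ : Q.comp (fderiv ℝ φ s₀) = 1 := by
    refine ContinuousLinearMap.ext fun v => ?_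
    exact LinearMap.congr_fun hP v
  have hB : ContDiff ℝ ∞ fun s => Q.comp (fderiv ℝ φ s) :=
    contDiff_const.clm_comp (hφ.fderiv_right (by simp))
  have hinv : ContDiffAt ℝ ∞ (fun s => Ring.inverse (Q.comp (fderiv ℝ φ s))) s₀ := by
    have h1 : ContDiffAt ℝ ∞ Ring.inverse (Q.comp (fderiv ℝ φ s₀)) := by
      rw [hQ]
      exact contDiffAt_ringInverse ℝ (1 : ((Fin 2 → ℝ) →L[ℝ] (Fin 2 → ℝ))ˣ)
    exact h1.comp s₀ hB.contDiffAt
  have hunit : ∀ᶠ s in nhds s₀, IsUnit (Q.comp (fderiv ℝ φ s)) := by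
    have : IsOpen {A : (Fin 2 → ℝ) →L[ℝ] (Fin 2 → ℝ) | IsUnit A} := Units.isOpen
    exact (this.preimage hB.continuous).mem_nhds (by simp [hQ])
  have h2 : ContDiffAt ℝ ∞ (fun s => Ring.inverse (Q.comp (fderiv ℝ φ s)) (Q (h s))) s₀ :=
    hinv.clm_apply (Q.contDiff.comp hh).contDiffAt
  refine h2.congr_of_eventuallyEq ?_
  filter_upwards [hunit] with s hs
  rw [← hg s]
  have := congrArg (fun A : (Fin 2 → ℝ) →L[ℝ] (Fin 2 → ℝ) => A (g s)) (Ring.inverse_mul_cancel _ hs)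
  exact this.symm

/-- An invariant measure of a flow on a torus which is tangent to the kernel of
`A₀ dψ + A₁ dφ`. -/
lemma exists_density {g : (Fin 2 → ℝ) → (Fin 2 → ℝ)} (hg : ContDiff ℝ ∞ g) (hper : IsBiperiodic g)
    (hg0 : ∀ s, g s ≠ 0) {A₀ A₁ : ℝ → ℝ} (hA₀ : ContDiff ℝ ∞ A₀) (hA₁ : ContDiff ℝ ∞ A₁)
    (hp₀ : ∀ x (n : ℤ), A₀ (x + 2 * Real.pi * n) = A₀ x)
    (hp₁ : ∀ x (n : ℤ), A₁ (x + 2 * Real.pi * n) = A₁ x) (hA : ∀ x y, A₀ x ≠ 0 ∨ A₁ y ≠ 0)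
    (hrel : ∀ s, A₀ (s 0) * g s 0 + A₁ (s 1) * g s 1 = 0) :
    ∃ Φ : (Fin 2 → ℝ) → ℝ, IsBiperiodic Φ ∧ IsInvariantDensityOn Set.univ g Φ := by
  -- The scalar product of g with (A₁, -A₀). The relation makes these vectors parallel, so D has no
  -- zeros, and (A₀² + A₁²)/D times g is (A₁, -A₀). Each component of that field is independent of
  -- the variable it would be differentiated by.
  obtain ⟨D, hD⟩ : ∃ D : (Fin 2 → ℝ) → ℝ, ∀ s, D s = g s 0 * A₁ (s 1) - g s 1 * A₀ (s 0) :=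
    ⟨_, fun _ => rfl⟩
  have hA₀' : ContDiff ℝ ∞ fun s : Fin 2 → ℝ => A₀ (s 0) := hA₀.comp (contDiff_apply ℝ ℝ 0)
  have hA₁' : ContDiff ℝ ∞ fun s : Fin 2 → ℝ => A₁ (s 1) := hA₁.comp (contDiff_apply ℝ ℝ 1)
  have hDc : ContDiff ℝ ∞ D := by
    rw [contDiff_pi] at hg
    rw [funext hD]
    exact ((hg 0).mul hA₁').sub ((hg 1).mul hA₀')
  have hN : ∀ s : Fin 2 → ℝ, 0 < A₀ (s 0) ^ 2 + A₁ (s 1) ^ 2 := by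
    intro s
    rcases hA (s 0) (s 1) with h | h <;> positivity
  have hD0 : ∀ s, D s ≠ 0 := by
    intro s h0
    rw [hD] at h0
    refine hg0 s ?_
    ext i
    fin_cases i
    · refine (mul_eq_zero.1 (?_ : (A₀ (s 0) ^ 2 + A₁ (s 1) ^ 2) * g s 0 = 0)).resolve_left (hN s).ne'
      linear_combination A₀ (s 0) * hrel s + A₁ (s 1) * h0
    · refine (mul_eq_zero.1 (?_ : (A₀ (s 0) ^ 2 + A₁ (s 1) ^ 2) * g s 1 = 0)).resolve_left (hN s).ne'
      linear_combination A₁ (s 1) * hrel s - A₀ (s 0) * h0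
  obtain ⟨ς, hς, hςD⟩ : ∃ ς : ℝ, ς ^ 2 = 1 ∧ ∀ s, 0 < ς * D s := by
    obtain ⟨ς, h1, h2, -⟩ := exists_sign (hD0 0)
    refine ⟨ς, h1, fun s => ?_⟩
    refine isPreconnected_univ.pos_of_pos (f := fun s => ς * D s)
      (continuous_const.mul hDc.continuous).continuousOn (fun s _ => ?_) (Set.mem_univ 0)
      (Set.mem_univ s) h2
    exact mul_ne_zero (by rintro rfl; norm_num at h1) (hD0 s)
  have hperD : IsBiperiodic D := by
    intro s n
    simp only [hD, hper s n, hp₀, hp₁]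
  have hc : ContDiff ℝ ∞ fun s => (A₀ (s 0) ^ 2 + A₁ (s 1) ^ 2) / (ς * D s) :=
    ((hA₀'.pow 2).add (hA₁'.pow 2)).fun_div (contDiff_const.mul hDc) fun s => (hςD s).ne'
  refine ⟨fun s => (A₀ (s 0) ^ 2 + A₁ (s 1) ^ 2) / (ς * D s), fun s n => ?_, hc.contDiffOn,
    fun s _ => div_pos (hN s) (hςD s), fun s _ => ?_⟩
  · simp only [hperD s n, hp₀, hp₁]
  · have key : (fun s => ((A₀ (s 0) ^ 2 + A₁ (s 1) ^ 2) / (ς * D s)) • g s) =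
        fun s => (![ς * A₁ (s 1), -(ς * A₀ (s 0))] : Fin 2 → ℝ) := by
      funext s
      ext i
      have h1 : D s ≠ 0 := hD0 s
      have h2 : ς ≠ 0 := by rintro rfl; norm_num at hς
      have h3 := hrel s
      fin_cases i
      · simp only [Fin.zero_eta, Pi.smul_apply, smul_eq_mul, Matrix.cons_val_zero]
        rw [div_mul_eq_mul_div, div_eq_iff (mul_ne_zero h2 h1), hD]
        linear_combination A₀ (s 0) * h3 -
          A₁ (s 1) * (g s 0 * A₁ (s 1) - g s 1 * A₀ (s 0)) * hς
      · simp only [Fin.mk_one, Pi.smul_apply, smul_eq_mul, Matrix.cons_val_one, Matrix.cons_val_zero]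
        rw [div_mul_eq_mul_div, div_eq_iff (mul_ne_zero h2 h1), hD]
        linear_combination A₁ (s 1) * h3 +
          A₀ (s 0) * (g s 0 * A₁ (s 1) - g s 1 * A₀ (s 0)) * hς
    rw [divergence, key, LinearMap.trace_eq_matrix_trace ℝ (Pi.basisFun ℝ (Fin 2)), Matrix.trace]
    have hd : ContDiff ℝ ∞ fun s : Fin 2 → ℝ => (![ς * A₁ (s 1), -(ς * A₀ (s 0))] : Fin 2 → ℝ) := by
      rw [contDiff_pi]
      intro i
      fin_cases i
      · exact contDiff_const.mul hA₁'
      · exact (contDiff_const.mul hA₀').neg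
    have h0 : ∀ i : Fin 2, fderiv ℝ (fun s : Fin 2 → ℝ =>
        (![ς * A₁ (s 1), -(ς * A₀ (s 0))] : Fin 2 → ℝ)) s (Pi.single i 1) i = 0 := by
      intro i
      have h1 := hasDerivAt_pi.1 (Arranged.hasDerivAt_line hd s (Pi.single i 1)) i
      refine h1.unique ?_
      have h2 : (fun x : ℝ => (![ς * A₁ ((s + x • (Pi.single i 1 : Fin 2 → ℝ)) 1),
          -(ς * A₀ ((s + x • (Pi.single i 1 : Fin 2 → ℝ)) 0))] : Fin 2 → ℝ) i) =
          fun _ => (![ς * A₁ (s 1), -(ς * A₀ (s 0))] : Fin 2 → ℝ) i := by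
        funext x
        fin_cases i <;> simp
      rw [h2]
      exact hasDerivAt_const _ _
    refine Finset.sum_eq_zero fun i _ => ?_
    rw [Matrix.diag_apply, LinearMap.toMatrix_apply]
    simpa using h0 i

/-! ### The invariant tori -/

lemma IsPreconnected.eq_of_sq_eq_sq {α : Type*} [TopologicalSpace α] {S : Set α} (hS : IsPreconnected S)
    {f : α → ℝ} (hf : ContinuousOn f S) {x y : α} (h : ∀ z ∈ S, f z ^ 2 = f x ^ 2) (hx : x ∈ S)
    (hy : y ∈ S) : f y = f x := by
  by_cases h0 : f x = 0
  · have := h y hy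
    rw [h0] at this ⊢
    simpa using this
  · have h1 : ∀ z ∈ S, f x * f z ≠ 0 := by
      intro z hz hz0
      have h2 := h z hz
      rw [(mul_eq_zero.1 hz0).resolve_left h0] at h2
      exact h0 (pow_eq_zero_iff two_ne_zero |>.1 (by simpa using h2.symm))
    have h3 := hS.pos_of_pos (f := fun z => f x * f z) (continuousOn_const.mul hf) h1 hx hy
      (mul_self_pos.2 h0)
    rcases sq_eq_sq_iff_eq_or_eq_neg.1 (h y hy) with h4 | h4
    · exact h4
    · rw [h4] at h3
      nlinarith [sq_nonneg (f x)]

namespace SphericalSupport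

variable {N : ℕ} {S : SphericalSupport N}

lemma mem_domain_of_phaseSpace
    (hB : ∀ e : Fin 3 → Vec3, IsOrthonormalFrame e → 0 < (S.totalInertia e).det) {x : SupportState}
    (hx : x ∈ phaseSpace) : x ∈ S.domain := hB _ hx

lemma mem_invariantLevel_iff
    (hB : ∀ e : Fin 3 → Vec3, IsOrthonormalFrame e → 0 < (S.totalInertia e).det) {j : Fin 4}
    {c : Option {i : Fin 4 // i ≠ j} → ℝ} {x : SupportState} :
    x ∈ S.invariantLevel j c ↔ x ∈ phaseSpace ∧ ∀ o, S.dynamicIntegrals j o x = c o := by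
  constructor
  · rintro ⟨-, h2⟩
    refine ⟨fun i l => ?_, fun o => h2 (Sum.inr o)⟩
    rcases le_total i l with h | h
    · exact h2 (Sum.inl ⟨(i, l), h⟩)
    · have := h2 (Sum.inl ⟨(l, i), h⟩)
      rw [dotProduct_comm]
      simp only [eq_comm (a := i)]
      exact this
  · rintro ⟨h1, h2⟩
    refine ⟨mem_domain_of_phaseSpace hB h1, ?_⟩
    rintro (p | o)
    · exact h1 _ _
    · exact h2 o

lemma dynamicIntegrals_eq_of_eq {x y : SupportState} (hx : x ∈ phaseSpace) (hy : y ∈ phaseSpace)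
    (hk : S.spaceMomentum x = S.spaceMomentum y) (hE : S.energy x = S.energy y) (j : Fin 4)
    (o : Option {i : Fin 4 // i ≠ j}) : S.dynamicIntegrals j o x = S.dynamicIntegrals j o y := by
  rcases o with - | ⟨i, hi⟩
  · exact hE
  · change S.momentumIntegral i x = S.momentumIntegral i y
    refine Fin.cases ?_ (fun l => ?_) i
    · rw [momentumIntegral_zero S hx, momentumIntegral_zero S hy, hk]
    · rw [momentumIntegral_succ, momentumIntegral_succ, hk]

lemma continuous_spaceMomentum (l : Fin 3) : Continuous fun x => S.spaceMomentum x l := by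
  simp only [← momentumIntegral_succ]
  exact (S.contDiff_momentumIntegral _).continuous

/-- On connected sets of states on which the integrals are constant, the spatial momentum is
constant. -/
lemma spaceMomentum_eq_of_isPreconnected {C : Set SupportState} (hC : IsPreconnected C)
    (hP : C ⊆ phaseSpace) {j : Fin 4} {c : Option {i : Fin 4 // i ≠ j} → ℝ}
    (hc : ∀ x ∈ C, ∀ o, S.dynamicIntegrals j o x = c o) {x y : SupportState} (hx : x ∈ C)
    (hy : y ∈ C) : S.spaceMomentum y = S.spaceMomentum x := by
  have h1 : ∀ i : Fin 4, i ≠ j → ∀ z ∈ C, S.momentumIntegral i z = S.momentumIntegral i x :=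
    fun i hi z hz => (hc z hz (some ⟨i, hi⟩)).trans (hc x hx (some ⟨i, hi⟩)).symm
  have h2 : ∀ l : Fin 3, l.succ ≠ j → ∀ z ∈ C, S.spaceMomentum z l = S.spaceMomentum x l := by
    intro l hl z hz
    simpa only [momentumIntegral_succ] using h1 l.succ hl z hz
  ext l
  by_cases hl : l.succ = j
  -- The omitted component is determined up to sign by (K, K) and the other two; connectedness fixes
  -- the sign.
  · have h3 : ∀ z ∈ C, S.spaceMomentum z l ^ 2 = S.spaceMomentum x l ^ 2 := by
      intro z hz
      have h4 := h1 0 (by rw [← hl]; exact (Fin.succ_ne_zero l).symm) z hz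
      rw [momentumIntegral_zero S (hP hz), momentumIntegral_zero S (hP hx)] at h4
      have h5 : ∀ m : Fin 3, m ≠ l → S.spaceMomentum z m = S.spaceMomentum x m := fun m hm =>
        h2 m (fun h => hm (Fin.succ_injective _ (h.trans hl.symm))) z hz
      simp only [dotProduct] at h4
      rw [← Finset.add_sum_erase _ _ (Finset.mem_univ l),
        ← Finset.add_sum_erase Finset.univ (fun i => S.spaceMomentum x i * S.spaceMomentum x i)
          (Finset.mem_univ l), Finset.sum_congr rfl fun m hm => by
          rw [h5 m (Finset.ne_of_mem_erase hm)], add_left_inj] at h4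
      rw [sq, sq, h4]
    exact hC.eq_of_sq_eq_sq (continuous_spaceMomentum l).continuousOn h3 hx hy
  · exact h2 l hl y hy

lemma fst_ne_zero_of_cross {x : SupportState} (h : (S.inertia *ᵥ x.1) ⨯₃ x.1 ≠ 0) : x.1 ≠ 0 := by
  intro h0
  rw [h0, map_zero] at h
  exact h rfl

lemma IsLevelForm.perm {r δ c₀ : ℝ} {F T H : Matrix (Fin 3) (Fin 3) ℝ} {a τ k : Vec3}
    (h : S.IsLevelForm r δ F a T H τ k c₀) (σ ρ : Equiv.Perm (Fin 3)) :
    S.IsLevelForm r δ (F.submatrix σ id) (a ∘ σ) T (H.submatrix ρ id) (τ ∘ ρ) k c₀ where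
  toIsNormalForm := h.toIsNormalForm.perm σ
  pos := h.pos
  orthogonal' := (diagonal_perm h.orthogonal' τ ρ).1
  tensor_eq := by
    rw [h.tensor_eq, (diagonal_perm h.orthogonal' τ ρ).2]

/-- Coupled vectors are not eigenvectors, if the vector product of `ℐ Ω` and `Ω` does not vanish. -/
lemma IsLevelForm.mul_ne_smul {r δ c₀ : ℝ} {F T H : Matrix (Fin 3) (Fin 3) ℝ} {a τ k : Vec3}
    (h : S.IsLevelForm r δ F a T H τ k c₀) {u : Vec3} {O : Matrix (Fin 3) (Fin 3) ℝ}
    (hu : u ≠ 0) (hc : (S.inertia *ᵥ (coupledState F H a u O).1) ⨯₃ (coupledState F H a u O).1 ≠ 0)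
    (r' : ℝ) : a * u ≠ r' • u := by
  intro hr
  have h0 : r' ≠ 0 := by
    rintro rfl
    refine hu (funext fun i => ?_)
    have := congrFun hr i
    simpa [h.ne_zero i] using this
  have h1 : (coupledState F H a u O).1 = Fᵀ *ᵥ (a * u) := rfl
  have h2 : Fᵀ *ᵥ u = r'⁻¹ • (Fᵀ *ᵥ (a * u)) := by
    rw [hr, Matrix.mulVec_smul, smul_smul, inv_mul_cancel₀ h0, one_smul]
  rw [h1, h.inertia_mulVec, h2, ← add_smul, map_smul, LinearMap.smul_apply, cross_self,
    smul_zero] at hc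
  exact hc rfl

/-- The states of a regular level correspond to coupled pairs, with arranged eigenvalues. -/
lemma exists_isLevelForm
    (hB : ∀ e : Fin 3 → Vec3, IsOrthonormalFrame e → 0 < (S.totalInertia e).det) {x₀ : SupportState}
    (hx₀ : x₀ ∈ phaseSpace)
    (hreg : ∀ x ∈ phaseSpace, S.spaceMomentum x = S.spaceMomentum x₀ → S.energy x = S.energy x₀ →
      (S.inertia *ᵥ x.1) ⨯₃ x.1 ≠ 0) :
    ∃ r δ F a T H τ, S.IsLevelForm r δ F a T H τ (S.spaceMomentum x₀)
      (S.spaceMomentum x₀ ⬝ᵥ (T *ᵥ S.spaceMomentum x₀) - 2 * S.energy x₀) ∧ Arranged a τ := by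
  obtain ⟨r, δ, F, a, T, hn, i₀, hi₀⟩ := S.exists_isNormalForm hB
  have hn' := hn.perm (Tuple.sort a)
  have ha := Tuple.monotone_sort a
  -- `exists_arranged` needs the bound with the smallest entry itself, so δ must be the first one
  -- after sorting.
  have hδ : (a ∘ Tuple.sort a) 0 = δ := by
    refine le_antisymm ?_ (hn'.le 0)
    rw [hi₀, ← Equiv.apply_symm_apply (Tuple.sort a) i₀]
    exact ha (Fin.zero_le _)
  generalize a ∘ Tuple.sort a = a' at *
  generalize F.submatrix (Tuple.sort a) id = F' at *
  obtain ⟨k, hk⟩ : ∃ k, k = S.spaceMomentum x₀ := ⟨_, rfl⟩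
  obtain ⟨c₀, hc₀⟩ : ∃ c₀, c₀ = k ⬝ᵥ (T *ᵥ k) - 2 * S.energy x₀ := ⟨_, rfl⟩
  have hpos : 0 < c₀ := by
    rw [hc₀, hk]
    exact hn'.sub_energy_pos hx₀ (fst_ne_zero_of_cross (hreg x₀ hx₀ rfl rfl))
  obtain ⟨H, τ, hH, hT, hτ⟩ := exists_orthogonal_diagonal
    (B := -(T - c₀⁻¹ • Matrix.vecMulVec (T *ᵥ k) (T *ᵥ k))) (by
      rw [Matrix.transpose_neg, Matrix.transpose_sub, Matrix.transpose_smul, hn'.symm,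
        Matrix.transpose_vecMulVec])
  have hlf : S.IsLevelForm r δ F' a' T H τ k c₀ := ⟨hn', hpos, hH, hT⟩
  have hlt := hlf.lt'
  rw [← hδ] at hlt
  -- Every coupled pair comes from a state with the same momentum and energy. There ℐΩ × Ω ≠ 0, so
  -- the vector is no eigenvector.
  obtain ⟨σ, ρ, harr⟩ := exists_arranged ha hτ hpos hlt (hlf.isCoupled hx₀ hk.symm hc₀.symm) (by
    intro u O r' hu
    obtain ⟨h1, h2, h3⟩ := hlf.coupledState_spec hu
    exact hlf.mul_ne_smul (O := O) (hu.ne_zero hpos) (hreg _ h1 (h2.trans hk) (by linarith)) r')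
  have := hlf.perm σ ρ
  rw [hk] at hc₀ this
  rw [hc₀] at this
  exact ⟨_, _, _, _, _, _, _, this, harr⟩

lemma hasDerivAt_stateVec (F : Matrix (Fin 3) (Fin 3) ℝ) (a : Vec3) {y : ℝ → SupportState}
    {y' : SupportState} {t : ℝ} (hy : HasDerivAt y y' t) :
    HasDerivAt (fun s => stateVec F a (y s)) (stateVec F a y') t := by
  have h1 : HasDerivAt (fun s => (y s).1) y'.1 t := hy.fst
  rw [hasDerivAt_pi]
  intro i
  simp only [stateVec, Matrix.mulVec, dotProduct]
  exact (HasDerivAt.fun_sum fun l _ => (hasDerivAt_pi.1 h1 l).const_mul (F i l)).div_const _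

lemma hasMatDerivAt_stateMat (F H : Matrix (Fin 3) (Fin 3) ℝ) {y : ℝ → SupportState}
    {y' : SupportState} {t : ℝ} (hy : HasDerivAt y y' t) :
    HasMatDerivAt (fun s => stateMat F H (y s)) (stateMat F H y') t := by
  have h1 : HasDerivAt (fun s => (y s).2) y'.2 t := hy.snd
  have h2 : HasMatDerivAt (fun s => Matrix.of (y s).2) (Matrix.of y'.2) t := fun i j =>
    hasDerivAt_pi.1 (hasDerivAt_pi.1 h1 i) j
  have := ((HasMatDerivAt.const H).mul h2).mul (HasMatDerivAt.const Fᵀ)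
  simpa [stateMat] using this

lemma continuous_stateVec (F : Matrix (Fin 3) (Fin 3) ℝ) (a : Vec3) (i : Fin 3) :
    Continuous fun x => stateVec F a x i := by
  simp only [stateVec, Matrix.mulVec, dotProduct]
  fun_prop

lemma continuous_stateMat (F H : Matrix (Fin 3) (Fin 3) ℝ) (i l : Fin 3) :
    Continuous fun x => stateMat F H x i l := by
  simp only [stateMat, Matrix.mul_apply, Matrix.of_apply]
  fun_prop

lemma contDiff_coupledState (F H : Matrix (Fin 3) (Fin 3) ℝ) (a : Vec3) {E : Type*}
    [NormedAddCommGroup E] [NormedSpace ℝ E] {u : E → Vec3} {O : E → Fin 3 → Vec3}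
    (hu : ContDiff ℝ ∞ u) (hO : ContDiff ℝ ∞ O) :
    ContDiff ℝ ∞ fun s => coupledState F H a (u s) (Matrix.of (O s)) := by
  refine ContDiff.prodMk (contDiff_mulVec _ (contDiff_const.mul hu)) ?_
  rw [contDiff_pi]
  intro i
  rw [contDiff_pi]
  intro l
  have h1 : ∀ p q, ContDiff ℝ ∞ fun s => O s p q := fun p q =>
    contDiff_pi.1 (contDiff_pi.1 hO p) q
  change ContDiff ℝ ∞ fun s => (Hᵀ * Matrix.of (O s) * F) i l
  simp only [Matrix.mul_apply, Matrix.of_apply]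
  exact ContDiff.sum fun p _ => (ContDiff.sum fun q _ => contDiff_const.mul (h1 q p)).mul
    contDiff_const

lemma field_ne_zero {x : SupportState} (hx : x ∈ S.domain)
    (h : (S.inertia *ᵥ x.1) ⨯₃ x.1 ≠ 0) : S.field x ≠ 0 := by
  intro h0
  rw [← S.totalInertia_mulVec_field hx, h0] at h
  exact h (Matrix.mulVec_zero _)

/-- Along the flow, the derivative of the matrix of the coupled pair annihilates the velocity. -/
lemma IsLevelForm.stateMat_field_mulVec {r δ c₀ : ℝ} {F T H : Matrix (Fin 3) (Fin 3) ℝ}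
    {a τ k : Vec3} (h : S.IsLevelForm r δ F a T H τ k c₀) (x : SupportState) :
    stateMat F H (S.field x) *ᵥ (a * stateVec F a x) = 0 := by
  rw [stateMat, ← Matrix.mulVec_mulVec, h.mul_stateVec, ← Matrix.mulVec_mulVec]
  have : Matrix.of (S.field x).2 *ᵥ x.1 = 0 := by
    ext i
    change (x.2 i ⨯₃ x.1) ⬝ᵥ x.1 = 0
    rw [dotProduct_comm, dot_cross_self]
  rw [this, Matrix.mulVec_zero]

/-- The connected components of the regular levels are invariant tori. -/
theorem isInvariantTorus_connectedComponentIn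
    (hB : ∀ e : Fin 3 → Vec3, IsOrthonormalFrame e → 0 < (S.totalInertia e).det) {j : Fin 4}
    {c : Option {i : Fin 4 // i ≠ j} → ℝ} (hEJ : S.EulerJacobiLevel j c) {x₀ : SupportState}
    (hx₀ : x₀ ∈ S.invariantLevel j c) :
    IsInvariantTorus S.field (connectedComponentIn (S.invariantLevel j c) x₀) := by
  obtain ⟨hP₀, hd₀⟩ := (mem_invariantLevel_iff hB).1 hx₀
  have hcross : ∀ x ∈ S.invariantLevel j c, (S.inertia *ᵥ x.1) ⨯₃ x.1 ≠ 0 := fun x hx =>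
    S.cross_ne_zero_of_linearIndependent ((mem_invariantLevel_iff hB).1 hx).1 j (hEJ.independent x hx)
  have hlevel : ∀ x ∈ phaseSpace, S.spaceMomentum x = S.spaceMomentum x₀ →
      S.energy x = S.energy x₀ → x ∈ S.invariantLevel j c := fun x hx h1 h2 =>
    (mem_invariantLevel_iff hB).2 ⟨hx, fun o =>
      (dynamicIntegrals_eq_of_eq hx hP₀ h1 h2 j o).trans (hd₀ o)⟩
  obtain ⟨r, δ, F, a, T, H, τ, hlf, harr⟩ := exists_isLevelForm hB hP₀
    fun x hx h1 h2 => hcross x (hlevel x hx h1 h2)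
  obtain ⟨k, hk⟩ : ∃ k, k = S.spaceMomentum x₀ := ⟨_, rfl⟩
  obtain ⟨c₀, hc₀⟩ : ∃ c₀, c₀ = k ⬝ᵥ (T *ᵥ k) - 2 * S.energy x₀ := ⟨_, rfl⟩
  rw [← hk, ← hc₀] at hlf
  have hcp₀ := hlf.isCoupled hP₀ hk.symm hc₀.symm
  obtain ⟨u, O, A₀, A₁, ht⟩ := exists_isCoupledTorus harr hlf.pos hlf.le hlf.lt' hcp₀
  obtain ⟨φ, hφdef⟩ : ∃ φ : (Fin 2 → ℝ) → SupportState,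
    ∀ s, φ s = coupledState F H a (u s) (Matrix.of (O s)) := ⟨_, fun _ => rfl⟩
  have hφ : ContDiff ℝ ∞ φ := by
    rw [funext hφdef]
    exact contDiff_coupledState F H a ht.contDiff_u ht.contDiff_O
  have hvec : ∀ s, stateVec F a (φ s) = u s := fun s => by
    rw [hφdef, hlf.stateVec_coupledState]
  have hmat : ∀ s, stateMat F H (φ s) = Matrix.of (O s) := fun s => by
    rw [hφdef, hlf.stateMat_coupledState]
  have hmem : ∀ s, φ s ∈ S.invariantLevel j c := by
    intro s
    obtain ⟨h1, h2, h3⟩ := hlf.coupledState_spec (ht.isCoupled s)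
    rw [← hφdef] at h1 h2 h3
    exact hlevel _ h1 (h2.trans hk) (by linarith)
  have hu₀ : stateVec F a x₀ 0 ≠ 0 := left_ne_zero_of_mul (ht.left_pos 0).ne'
  have hz₀ : (stateMat F H x₀ *ᵥ stateVec F a x₀) 0 ≠ 0 := left_ne_zero_of_mul (ht.right_pos 0).ne'
  obtain ⟨s₀, hs₀, hs₀'⟩ := ht.surjective _ _ hcp₀ (mul_self_pos.2 hu₀) (mul_self_pos.2 hz₀) rfl
  have hφs₀ : φ s₀ = x₀ := by
    rw [hφdef, hs₀, hs₀', hlf.coupledState_stateVec]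
  have hline : ∀ s v, HasDerivAt (fun x : ℝ => φ (s + x • v)) (fderiv ℝ φ s v) 0 := fun s v =>
    Arranged.hasDerivAt_line hφ s v
  have hlineO : ∀ s v, HasDerivAt (fun x : ℝ => O (s + x • v))
      (Matrix.of.symm (stateMat F H (fderiv ℝ φ s v))) 0 := by
    intro s v
    rw [hasDerivAt_pi]
    intro i
    rw [hasDerivAt_pi]
    intro l
    have := hasMatDerivAt_stateMat F H (hline s v) i l
    simp only [hmat] at this
    exact this
  have hinj : ∀ s, Function.Injective (fderiv ℝ φ s) := by
    intro s
    rw [injective_iff_map_eq_zero]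
    intro v hv
    have h1 := hasDerivAt_stateVec F a (hline s v)
    have h2 := hlineO s v
    simp only [hvec, hv] at h1 h2
    refine ht.immersion s v (h1.congr_deriv ?_) (h2.congr_deriv ?_)
    · ext i
      simp [stateVec]
    · ext i l
      simp [stateMat]
  have hper : IsBiperiodic φ := by
    intro s n
    rw [hφdef, hφdef, ht.periodic_u s n, ht.periodic_O s n]
  have hpar : IsTorusParametrization φ (connectedComponentIn (S.invariantLevel j c) x₀) := by
    refine ⟨hφ, hinj, Set.Subset.antisymm ?_ ?_, fun s t => ⟨fun hst => ?_, ?_⟩⟩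
    · exact (isPreconnected_range hφ.continuous).subset_connectedComponentIn ⟨s₀, hφs₀⟩
        (Set.range_subset_iff.2 hmem)
    · obtain ⟨C, hCdef⟩ : ∃ C, C = connectedComponentIn (S.invariantLevel j c) x₀ := ⟨_, rfl⟩
      have hC : IsPreconnected C := hCdef ▸ isPreconnected_connectedComponentIn
      have hCx : x₀ ∈ C := hCdef ▸ mem_connectedComponentIn hx₀
      have hCl : ∀ x ∈ C, x ∈ phaseSpace ∧ ∀ o, S.dynamicIntegrals j o x = c o := fun x hx =>
        (mem_invariantLevel_iff hB).1 (connectedComponentIn_subset _ _ (hCdef ▸ hx))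
      rw [← hCdef]
      intro x hx
      have hcp : ∀ y ∈ C,
          IsCoupled a τ (H *ᵥ (T *ᵥ k)) c₀ (stateVec F a y) (stateMat F H y) := by
        intro y hy
        refine hlf.isCoupled (hCl y hy).1 ?_ ?_
        · rw [hk]
          exact spaceMomentum_eq_of_isPreconnected hC (fun z hz => (hCl z hz).1)
            (fun z hz => (hCl z hz).2) hCx hy
        · rw [hc₀, show S.energy y = S.energy x₀ from
            ((hCl y hy).2 none).trans (hd₀ none).symm]
      have hne : ∀ y ∈ C, stateVec F a y 0 ≠ 0 ∧ (stateMat F H y *ᵥ stateVec F a y) 0 ≠ 0 := by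
        intro y hy
        obtain ⟨h1, h2, h3⟩ := (hcp y hy).dot_eq
        obtain ⟨h4, h5, -⟩ := harr.exists_angles ((hcp y hy).ne_zero hlf.pos) h1 h2 h3
        exact ⟨h4, h5⟩
      have hcv := continuous_stateVec F a
      have hcm := continuous_stateMat F H
      have hcz : Continuous fun y => (stateMat F H y *ᵥ stateVec F a y) 0 := by
        simp only [Matrix.mulVec, dotProduct]
        exact continuous_finsetSum _ fun l _ => (hcm 0 l).mul (hcv l)
      have hcd : Continuous fun y => (stateMat F H y).det := by
        simp only [Matrix.det_fin_three]
        fun_prop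
      -- The three discrete invariants of `surjective`, two signs and the determinant, are constant
      -- on the component, since the two coordinates never vanish and the determinant is ±1.
      have h1 := hC.pos_of_pos (f := fun y => stateVec F a x₀ 0 * stateVec F a y 0)
        (continuous_const.mul (hcv 0)).continuousOn (fun y hy => mul_ne_zero hu₀ (hne y hy).1)
        hCx hx (mul_self_pos.2 hu₀)
      have h2 := hC.pos_of_pos (f := fun y => (stateMat F H x₀ *ᵥ stateVec F a x₀) 0 *
          (stateMat F H y *ᵥ stateVec F a y) 0)
        (continuous_const.mul hcz).continuousOn (fun y hy => mul_ne_zero hz₀ (hne y hy).2)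
        hCx hx (mul_self_pos.2 hz₀)
      have h3 := hC.eq_of_sq_eq_sq hcd.continuousOn (fun y hy => by
        rw [det_sq_of_mul_transpose (hcp y hy).orthogonal,
          det_sq_of_mul_transpose hcp₀.orthogonal]) hCx hx
      obtain ⟨s, hs, hs'⟩ := ht.surjective _ _ (hcp x hx) h1 h2 h3
      exact ⟨s, by rw [hφdef, hs, hs', hlf.coupledState_stateVec]⟩
    · refine ht.injective s t ?_ ?_
      · rw [← hvec, hst, hvec]
      · have := hmat s
        rw [hst, hmat] at this
        exact this.symm
    · rintro ⟨n, hn⟩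
      rw [show s = fun i => t i + 2 * Real.pi * n i from funext hn, hper t n]
  -- Both f and the image of dφ lie in the common kernel of the ten differentials, which by
  -- regularity has dimension 2.
  have htangent : ∀ s, ∃ v, fderiv ℝ φ s v = S.field (φ s) := by
    intro s
    refine exists_apply_eq_of_linearIndependent (hEJ.independent _ (hmem s)) hEJ.card (hinj s) ?_
      fun o => (hEJ.integrals o).2 _ (hmem s).1
    intro o v
    have h1 : HasFDerivAt (S.integrals j o) (fderiv ℝ (S.integrals j o) (φ s)) (φ s) :=
      ((S.contDiff_integrals j o).differentiable (by simp) _).hasFDerivAt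
    have h2 := h1.comp s (hφ.differentiable (by simp) s).hasFDerivAt
    have h3 : S.integrals j o ∘ φ = fun _ => constants j c o := funext fun t => (hmem t).2 o
    rw [h3] at h2
    have h4 := h2.unique (hasFDerivAt_const _ _)
    exact congrArg (fun A : (Fin 2 → ℝ) →L[ℝ] ℝ => A v) h4
  choose g hg using htangent
  have hfφ : ContDiff ℝ ∞ fun s => S.field (φ s) :=
    contDiffOn_univ.1 (S.contDiffOn_field.comp hφ.contDiffOn fun s _ => (hmem s).1)
  have hgs : ContDiff ℝ ∞ g := contDiff_of_fderiv_apply hφ hinj hfφ hg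
  have hgper : IsBiperiodic g := by
    intro s n
    refine hinj s ?_
    have h1 : fderiv ℝ φ (fun i => s i + 2 * Real.pi * n i) = fderiv ℝ φ s := by
      have h2 : (fun t : Fin 2 → ℝ => φ (t + fun i => 2 * Real.pi * n i)) = φ :=
        funext fun t => hper t n
      conv_rhs => rw [← h2]
      exact (fderiv_comp_add_right (f := φ) (x := s) (fun i => 2 * Real.pi * n i)).symm
    rw [← h1, hg, h1, hg, hper s n]
  have hg0 : ∀ s, g s ≠ 0 := by
    intro s h0
    have := hg s
    rw [h0, map_zero] at this
    exact field_ne_zero (hmem s).1 (hcross _ (hmem s)) this.symm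
  obtain ⟨Φ, hΦ, hΦ'⟩ := exists_density hgs hgper hg0 ht.contDiff_A₀ ht.contDiff_A₁ ht.periodic_A₀
    ht.periodic_A₁ ht.ne_zero fun s => by
      refine ht.flow s (g s) _ (hlineO s (g s)) ?_
      rw [hg, Equiv.apply_symm_apply, ← hvec]
      exact hlf.stateMat_field_mulVec _
  exact ⟨φ, g, Φ, hpar, hgs, hgper, hg0, hg, hΦ, hΦ'⟩

/-- Solutions stay in the connected components of the levels. -/
theorem mem_connectedComponentIn_of_isMotionAt {j : Fin 4} {c : Option {i : Fin 4 // i ≠ j} → ℝ}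
    {x₀ : SupportState} (hx₀ : x₀ ∈ S.invariantLevel j c) {a b t₀ : ℝ} {x : ℝ → SupportState}
    (ht₀ : t₀ ∈ Set.Ioo a b) (hxt₀ : x t₀ = x₀)
    (hx : ∀ t ∈ Set.Ioo a b, x t ∈ S.domain ∧ S.IsMotionAt x t) {t : ℝ} (ht : t ∈ Set.Ioo a b) :
    x t ∈ connectedComponentIn (S.invariantLevel j c) x₀ := by
  have hcont : ContinuousOn x (Set.Ioo a b) := fun t ht =>
    ((S.isMotionAt_iff x t (hx t ht).1).1 (hx t ht).2).continuousAt.continuousWithinAt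
  have hconst : ∀ o, ∀ s ∈ Set.Ioo a b, S.integrals j o (x s) = constants j c o := by
    intro o s hs
    rw [← hx₀.2 o, ← hxt₀]
    exact isOpen_Ioo.is_const_of_deriv_eq_zero isPreconnected_Ioo
      (fun t ht => (S.hasDerivAt_integrals_of_isMotionAt (hx t ht).1 (hx t ht).2 j
        o).differentiableAt.differentiableWithinAt)
      (fun t ht => (S.hasDerivAt_integrals_of_isMotionAt (hx t ht).1 (hx t ht).2 j o).deriv) hs ht₀
  exact (isPreconnected_Ioo.image x hcont).subset_connectedComponentIn ⟨t₀, ht₀, hxt₀⟩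
    (by rintro _ ⟨s, hs, rfl⟩; exact ⟨(hx s hs).1, fun o => hconst o s hs⟩) ⟨t, ht, rfl⟩

end SphericalSupport

/-! ### Regular levels -/

open Filter Topology in
-- The second difference at Ω₀ in the direction v isolates v · Qv; polarization does the rest.
lemma Matrix.eq_zero_of_eventually_quadratic {Q : Matrix (Fin 3) (Fin 3) ℝ} (hQ : Qᵀ = Q) {Ω₀ : Vec3}
    (h : ∀ᶠ Ω in 𝓝 Ω₀, Ω ⬝ᵥ (Q *ᵥ Ω) = 0) : Q = 0 := by
  have h1 : ∀ v : Vec3, v ⬝ᵥ (Q *ᵥ v) = 0 := by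
    intro v
    have hc : ∀ s : ℝ, Tendsto (fun t : ℝ => Ω₀ + (s * t) • v) (𝓝 0) (𝓝 Ω₀) := by
      intro s
      have : Continuous fun t : ℝ => Ω₀ + (s * t) • v := by fun_prop
      simpa using this.tendsto 0
    have h2 := ((hc 1).eventually h).and ((hc (-1)).eventually h)
    obtain ⟨t, ⟨h3, h4⟩, ht⟩ :=
      ((h2.filter_mono nhdsWithin_le_nhds).and (self_mem_nhdsWithin : Set.Ioi (0 : ℝ) ∈ 𝓝[>] 0)).exists
    have h5 := h.self_of_nhds
    simp only [Matrix.mulVec_add, Matrix.mulVec_smul, dotProduct_add, add_dotProduct, smul_dotProduct,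
      dotProduct_smul, smul_eq_mul, h5] at h3 h4
    have h6 : t ^ 2 * (v ⬝ᵥ (Q *ᵥ v)) = 0 := by linear_combination (h3 + h4) / 2
    exact (mul_eq_zero.1 h6).resolve_left (pow_ne_zero _ (ne_of_gt ht))
  have h2 : ∀ u v : Vec3, u ⬝ᵥ (Q *ᵥ v) = 0 := by
    intro u v
    have h3 := h1 (u + v)
    have h4 : v ⬝ᵥ (Q *ᵥ u) = u ⬝ᵥ (Q *ᵥ v) := by
      rw [Matrix.dotProduct_mulVec, ← Matrix.mulVec_transpose, hQ, dotProduct_comm]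
    simp only [Matrix.mulVec_add, dotProduct_add, add_dotProduct, h1] at h3
    linarith
  ext i l
  simpa using h2 (Pi.single i 1) (Pi.single l 1)

/-- The rotation by the angle `t` in the plane of the first two coordinates. -/
def rotationFst (t : ℝ) : Matrix (Fin 3) (Fin 3) ℝ :=
  !![Real.cos t, -Real.sin t, 0; Real.sin t, Real.cos t, 0; 0, 0, 1]

/-- The rotation by the angle `t` in the plane of the last two coordinates. -/
def rotationSnd (t : ℝ) : Matrix (Fin 3) (Fin 3) ℝ :=
  !![1, 0, 0; 0, Real.cos t, -Real.sin t; 0, Real.sin t, Real.cos t]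

lemma rotationFst_orthogonal (t : ℝ) : rotationFst t * (rotationFst t)ᵀ = 1 := by
  have h := Real.sin_sq_add_cos_sq t
  ext i l
  fin_cases i <;> fin_cases l <;> simp [rotationFst, Matrix.mul_apply, Fin.sum_univ_three] <;>
    first | ring1 | linear_combination h

lemma rotationSnd_orthogonal (t : ℝ) : rotationSnd t * (rotationSnd t)ᵀ = 1 := by
  have h := Real.sin_sq_add_cos_sq t
  ext i l
  fin_cases i <;> fin_cases l <;> simp [rotationSnd, Matrix.mul_apply, Fin.sum_univ_three] <;>
    first | ring1 | linear_combination h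

/-- Only multiples of the identity commute with two plane rotations in different planes. -/
lemma eq_smul_one_of_commute_rotation {X : Matrix (Fin 3) (Fin 3) ℝ} (hX : Xᵀ = X) {s t : ℝ}
    (hs : Real.sin s ≠ 0) (ht : Real.sin t ≠ 0) (h1 : X * rotationFst s = rotationFst s * X)
    (h2 : X * rotationSnd t = rotationSnd t * X) : X = X 0 0 • 1 := by
  have e1 := fun i l => congrFun (congrFun h1 i) l
  have e2 := fun i l => congrFun (congrFun h2 i) l
  have e : ∀ i l, X i l = X l i := fun i l => congrFun (congrFun hX l) i
  simp only [Matrix.mul_apply, Fin.sum_univ_three, rotationFst, rotationSnd] at e1 e2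
  have a00 := e1 0 0
  have a01 := e1 0 1
  have b11 := e2 1 1
  have b12 := e2 1 2
  have b01 := e2 0 1
  have b02 := e2 0 2
  simp at a00 a01 b11 b12 b01 b02
  have c01 : X 0 1 = 0 := by
    have : Real.sin s * X 0 1 = 0 := by linear_combination a00 / 2 + Real.sin s / 2 * e 0 1
    exact (mul_eq_zero.1 this).resolve_left hs
  have c12 : X 1 2 = 0 := by
    have : Real.sin t * X 1 2 = 0 := by linear_combination b11 / 2 + Real.sin t / 2 * e 1 2
    exact (mul_eq_zero.1 this).resolve_left ht
  have c02 : X 0 2 = 0 := by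
    rw [c01] at b01
    have : Real.sin t * X 0 2 = 0 := by linear_combination b01
    exact (mul_eq_zero.1 this).resolve_left ht
  have d01 : X 1 1 = X 0 0 := by
    have : Real.sin s * (X 1 1 - X 0 0) = 0 := by linear_combination a01
    exact sub_eq_zero.1 ((mul_eq_zero.1 this).resolve_left hs)
  have d12 : X 2 2 = X 1 1 := by
    have : Real.sin t * (X 2 2 - X 1 1) = 0 := by linear_combination b12
    exact sub_eq_zero.1 ((mul_eq_zero.1 this).resolve_left ht)
  ext i l
  fin_cases i <;> fin_cases l <;> simp [c01, c12, c02, d01, d12, e 1 0, e 2 0, e 2 1]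

namespace SphericalSupport

variable {N : ℕ} {S : SphericalSupport N}

lemma inertia_ne_smul_one (hJ : ∀ r : ℝ, S.J ≠ r • (1 : Matrix (Fin 3) (Fin 3) ℝ)) (r : ℝ) :
    S.inertia ≠ r • (1 : Matrix (Fin 3) (Fin 3) ℝ) := by
  intro h
  refine hJ (r + ∑ k, S.D k / S.ρ k ^ 2) ?_
  rw [add_smul, ← h, inertia, sub_add_cancel]

open Filter Topology in
/-- If the energy is a fixed quadratic form of the spatial momentum for all angular velocities in an
open set, then this form is the inverse of the total inertia. -/
lemma inertia_eq_of_eventually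
    (hB : ∀ e : Fin 3 → Vec3, IsOrthonormalFrame e → 0 < (S.totalInertia e).det)
    {R C : Matrix (Fin 3) (Fin 3) ℝ} (hR : Rᵀ = R) (hRC : R * C = 1) {e : Fin 3 → Vec3}
    (he : IsOrthonormalFrame e) {Ω₀ : Vec3}
    (h : ∀ᶠ Ω in 𝓝 Ω₀, 2 * S.energy (Ω, e) =
      S.spaceMomentum (Ω, e) ⬝ᵥ (R *ᵥ S.spaceMomentum (Ω, e))) :
    S.inertia = (Matrix.of e)ᵀ * (C - S.spaceTensor) * Matrix.of e := by
  set A := S.totalInertia e with hA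
  set M := Matrix.of e with hM
  have hAt : Aᵀ = A := S.totalInertia_transpose e
  have hMM : M * Mᵀ = 1 := (isOrthonormalFrame_iff _).1 he
  -- 2E = Ω · AΩ and k = MAΩ, so the hypothesis says that a quadratic form in Ω vanishes near Ω₀.
  -- Cancelling A gives A⁻¹ = MᵀRM.
  have h0 : A - A * (Mᵀ * R * M) * A = 0 := by
    refine Matrix.eq_zero_of_eventually_quadratic (Ω₀ := Ω₀) ?_ ?_
    · simp only [Matrix.transpose_sub, Matrix.transpose_mul, Matrix.transpose_transpose, hAt, hR,
        Matrix.mul_assoc]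
    · filter_upwards [h] with Ω hΩ
      have h1 : 2 * S.energy (Ω, e) = Ω ⬝ᵥ (A *ᵥ Ω) := by
        simp only [energy, angMomentum, hA]
        ring
      have h2 : S.spaceMomentum (Ω, e) = M *ᵥ (A *ᵥ Ω) := rfl
      have h3 : (M *ᵥ (A *ᵥ Ω)) ⬝ᵥ (R *ᵥ (M *ᵥ (A *ᵥ Ω))) = Ω ⬝ᵥ ((A * (Mᵀ * R * M) * A) *ᵥ Ω) := by
        have h4 : (A * (Mᵀ * R * M) * A) *ᵥ Ω = (Aᵀ * (Mᵀ * (R * (M * A)))) *ᵥ Ω := by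
          simp only [hAt, Matrix.mul_assoc]
        rw [h4, ← Matrix.mulVec_mulVec, ← Matrix.mulVec_mulVec, Matrix.dotProduct_mulVec Ω,
          Matrix.vecMul_transpose, Matrix.dotProduct_mulVec (A *ᵥ Ω), Matrix.vecMul_transpose]
        simp only [Matrix.mulVec_mulVec]
      rw [h1, h2, h3] at hΩ
      rw [Matrix.sub_mulVec, dotProduct_sub, hΩ, sub_self]
  have hu : IsUnit A.det := (ne_of_gt (hB e he)).isUnit
  have h1 : (Mᵀ * R * M) * A = 1 := by
    calc _ = A⁻¹ * (A * (Mᵀ * R * M) * A) := by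
          rw [Matrix.mul_assoc A, ← Matrix.mul_assoc A⁻¹, Matrix.nonsing_inv_mul _ hu, one_mul]
      _ = 1 := by rw [← sub_eq_zero.1 h0, Matrix.nonsing_inv_mul _ hu]
  have h2 : (Mᵀ * C * M) * (Mᵀ * R * M) = 1 := by
    calc _ = Mᵀ * (C * (M * Mᵀ) * R) * M := by simp only [Matrix.mul_assoc]
      _ = 1 := by rw [hMM, mul_one, mul_eq_one_comm.1 hRC, mul_one, mul_eq_one_comm.1 hMM]
  have h3 : A = Mᵀ * C * M := by
    calc A = ((Mᵀ * C * M) * (Mᵀ * R * M)) * A := by rw [h2, one_mul]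
      _ = _ := by rw [Matrix.mul_assoc, h1, mul_one]
  rw [Matrix.mul_sub, Matrix.sub_mul, ← h3, hA, totalInertia, gammaTensor_eq, add_sub_cancel_right]

open Filter Topology in
-- If equality held near one state, then ℐ = Mᵀ(C - G)M for all nearby frames M. So C - G would
-- commute with small rotations in two planes and be scalar, and ℐ and J with it.
lemma dense_two_energy_ne (hJ : ∀ r : ℝ, S.J ≠ r • (1 : Matrix (Fin 3) (Fin 3) ℝ))
    (hB : ∀ e : Fin 3 → Vec3, IsOrthonormalFrame e → 0 < (S.totalInertia e).det)
    {R C : Matrix (Fin 3) (Fin 3) ℝ} (hR : Rᵀ = R) (hRC : R * C = 1) :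
    Dense {x : phaseSpace | 2 * S.energy x ≠ S.spaceMomentum x ⬝ᵥ (R *ᵥ S.spaceMomentum x)} := by
  rintro ⟨⟨Ω₀, e₀⟩, he₀⟩
  by_contra h
  rw [mem_closure_iff_frequently, not_frequently] at h
  simp only [Set.mem_ofPred_eq, not_not] at h
  set M := Matrix.of e₀ with hM
  have hMM : M * Mᵀ = 1 := (isOrthonormalFrame_iff _).1 he₀
  -- Moves the frame along a path of orthogonal matrices while Ω stays free, which is what
  -- `inertia_eq_of_eventually` needs at each nearby frame.
  have key : ∀ P : ℝ → Matrix (Fin 3) (Fin 3) ℝ, Continuous P → P 0 = 1 →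
      (∀ t, P t * (P t)ᵀ = 1) → ∀ᶠ t in 𝓝 (0 : ℝ),
        S.inertia = (P t * M)ᵀ * (C - S.spaceTensor) * (P t * M) := by
    intro P hP hP0 hPP
    have hO : ∀ t, IsOrthonormalFrame (Matrix.of.symm (P t * M)) := by
      intro t
      rw [isOrthonormalFrame_iff, Equiv.apply_symm_apply]
      calc _ = P t * (M * Mᵀ) * (P t)ᵀ := by simp only [Matrix.transpose_mul, Matrix.mul_assoc]
        _ = 1 := by rw [hMM, mul_one, hPP]
    let Φ : ℝ × Vec3 → phaseSpace := fun p => ⟨(p.2, Matrix.of.symm (P p.1 * M)), hO p.1⟩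
    have hΦ : Continuous Φ := by
      refine Continuous.subtype_mk ?_ _
      refine continuous_snd.prodMk ?_
      exact (hP.comp continuous_fst).matrix_mul continuous_const
    have hΦ0 : Φ (0, Ω₀) = ⟨(Ω₀, e₀), he₀⟩ := by
      refine Subtype.ext ?_
      change (Ω₀, Matrix.of.symm (P 0 * M)) = _
      rw [hP0, one_mul]
      rfl
    have h1 : ∀ᶠ p in 𝓝 ((0 : ℝ), Ω₀), _ := (hΦ.tendsto' _ _ hΦ0).eventually h
    filter_upwards [h1.curry_nhds] with t ht
    have := inertia_eq_of_eventually hB hR hRC (hO t) ht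
    rwa [Equiv.apply_symm_apply] at this
  have hc : Continuous rotationFst := by
    refine continuous_matrix fun i l => ?_
    fin_cases i <;> fin_cases l <;> simp [rotationFst] <;> fun_prop
  have hd : Continuous rotationSnd := by
    refine continuous_matrix fun i l => ?_
    fin_cases i <;> fin_cases l <;> simp [rotationSnd] <;> fun_prop
  have hc0 : rotationFst 0 = 1 := by
    ext i l
    fin_cases i <;> fin_cases l <;> simp [rotationFst]
  have hd0 : rotationSnd 0 = 1 := by
    ext i l
    fin_cases i <;> fin_cases l <;> simp [rotationSnd]
  set X := C - S.spaceTensor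
  have h0 : S.inertia = Mᵀ * X * M := by
    have := (key _ hc hc0 rotationFst_orthogonal).self_of_nhds
    rwa [hc0, one_mul] at this
  have comm : ∀ P : Matrix (Fin 3) (Fin 3) ℝ, P * Pᵀ = 1 →
      S.inertia = (P * M)ᵀ * X * (P * M) → X * P = P * X := by
    intro P hP h1
    have h2 : X = Pᵀ * X * P := by
      calc X = (M * Mᵀ) * X * (M * Mᵀ) := by rw [hMM, one_mul, mul_one]
        _ = M * (Mᵀ * X * M) * Mᵀ := by simp only [Matrix.mul_assoc]
        _ = M * ((P * M)ᵀ * X * (P * M)) * Mᵀ := by rw [← h0, ← h1]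
        _ = (M * Mᵀ) * (Pᵀ * X * P) * (M * Mᵀ) := by
          simp only [Matrix.mul_assoc, Matrix.transpose_mul]
        _ = _ := by rw [hMM, one_mul, mul_one]
    calc X * P = (P * Pᵀ) * X * P := by rw [hP, one_mul]
      _ = P * (Pᵀ * X * P) := by simp only [Matrix.mul_assoc]
      _ = P * X := by rw [← h2]
  have hX : Xᵀ = X := by
    have h1 : X = M * S.inertia * Mᵀ := by
      calc X = (M * Mᵀ) * X * (M * Mᵀ) := by rw [hMM, one_mul, mul_one]
        _ = _ := by rw [h0]; simp only [Matrix.mul_assoc]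
    rw [h1]
    simp only [Matrix.transpose_mul, Matrix.transpose_transpose, inertia_transpose, Matrix.mul_assoc]
  have hπ : Set.Ioo 0 Real.pi ∈ 𝓝[>] (0 : ℝ) := Ioo_mem_nhdsGT Real.pi_pos
  obtain ⟨s, hs, hs'⟩ := (((key _ hc hc0 rotationFst_orthogonal).filter_mono
    nhdsWithin_le_nhds).and hπ).exists
  obtain ⟨t, ht, ht'⟩ := (((key _ hd hd0 rotationSnd_orthogonal).filter_mono
    nhdsWithin_le_nhds).and hπ).exists
  have h2 := eq_smul_one_of_commute_rotation hX (Real.sin_pos_of_mem_Ioo hs').ne'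
    (Real.sin_pos_of_mem_Ioo ht').ne' (comm _ (rotationFst_orthogonal s) hs)
    (comm _ (rotationSnd_orthogonal t) ht)
  refine inertia_ne_smul_one hJ (X 0 0) ?_
  rw [h0, h2, Matrix.mul_smul, Matrix.smul_mul, mul_one, mul_eq_one_comm.1 hMM]
  simp

open Filter Topology in
-- Moving Ω in the direction (ℐ + Γ)⁻¹e_l changes k_l at unit rate.
lemma dense_spaceMomentum_ne_zero
    (hB : ∀ e : Fin 3 → Vec3, IsOrthonormalFrame e → 0 < (S.totalInertia e).det) (l : Fin 3) :
    Dense {x : phaseSpace | S.spaceMomentum x l ≠ 0} := by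
  rintro ⟨⟨Ω₀, e₀⟩, he₀⟩
  by_contra h
  rw [mem_closure_iff_frequently, not_frequently] at h
  simp only [Set.mem_ofPred_eq, not_not] at h
  have hu : IsUnit (S.totalInertia e₀).det := (ne_of_gt (hB e₀ he₀)).isUnit
  let v : Vec3 := (S.totalInertia e₀)⁻¹ *ᵥ e₀ l
  let Φ : ℝ → phaseSpace := fun t => ⟨(Ω₀ + t • v, e₀), he₀⟩
  have hΦ : Continuous Φ := by
    refine Continuous.subtype_mk ?_ _
    fun_prop
  have hΦ0 : Φ 0 = ⟨(Ω₀, e₀), he₀⟩ := by simp [Φ]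
  obtain ⟨t, h1, ht⟩ := ((((hΦ.tendsto' _ _ hΦ0).eventually h).filter_mono
    nhdsWithin_le_nhds).and (self_mem_nhdsWithin : Set.Ioi (0 : ℝ) ∈ 𝓝[>] 0)).exists
  have h0 := h.self_of_nhds
  simp only [spaceMomentum_apply, angMomentum, Φ, Matrix.mulVec_add, Matrix.mulVec_smul,
    dotProduct_add, dotProduct_smul, v, Matrix.mulVec_mulVec, Matrix.mul_nonsing_inv _ hu,
    Matrix.one_mulVec, smul_eq_mul] at h0 h1
  rw [h0, he₀ l l, if_pos rfl] at h1
  simp at h1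
  exact (ne_of_gt ht) h1

/-- At the critical points the energy is one of three quadratic forms of the spatial momentum. -/
lemma exists_critical_forms
    (hB : ∀ e : Fin 3 → Vec3, IsOrthonormalFrame e → 0 < (S.totalInertia e).det) :
    ∃ R C : Fin 3 → Matrix (Fin 3) (Fin 3) ℝ, (∀ i, (R i)ᵀ = R i) ∧ (∀ i, R i * C i = 1) ∧
      ∀ x ∈ phaseSpace, (S.inertia *ᵥ x.1) ⨯₃ x.1 = 0 →
        ∃ i, 2 * S.energy x = S.spaceMomentum x ⬝ᵥ (R i *ᵥ S.spaceMomentum x) := by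
  obtain ⟨F, a, hF, hI, -⟩ := exists_orthogonal_diagonal S.inertia_transpose
  obtain ⟨H, γ, hH, hG, -⟩ := exists_orthogonal_diagonal (B := -S.spaceTensor)
    (by rw [Matrix.transpose_neg, spaceTensor_transpose])
  -- A permutation with σ i = l makes a_i - γ_l a factor of a positive product. Hence every G + a_i
  -- is invertible.
  have hne : ∀ i l, a i ≠ γ l := by
    intro i l hil
    have h1 := ne_of_gt (S.prod_sub_pos hF hH hI hG hB (Equiv.swap i l))
    rw [Finset.prod_ne_zero_iff] at h1
    refine h1 i (Finset.mem_univ _) ?_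
    rw [Equiv.swap_apply_left, hil, sub_self]
  have hHH := mul_eq_one_comm.1 hH
  have hRC : ∀ i, (Hᵀ * Matrix.diagonal (fun l => (a i - γ l)⁻¹) * H) *
      (S.spaceTensor + a i • (1 : Matrix (Fin 3) (Fin 3) ℝ)) = 1 := by
    intro i
    have h1 : S.spaceTensor + a i • (1 : Matrix (Fin 3) (Fin 3) ℝ) =
        Hᵀ * Matrix.diagonal (fun l => a i - γ l) * H := by
      have h2 : Matrix.diagonal (fun l => a i - γ l) =
          a i • (1 : Matrix (Fin 3) (Fin 3) ℝ) - Matrix.diagonal γ := by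
        rw [Matrix.smul_one_eq_diagonal, Matrix.diagonal_sub]
      rw [h2, Matrix.mul_sub, Matrix.sub_mul, ← hG, Matrix.mul_smul, Matrix.smul_mul, mul_one, hHH]
      abel
    calc _ = Hᵀ * (Matrix.diagonal (fun l => (a i - γ l)⁻¹) * (H * Hᵀ) *
          Matrix.diagonal (fun l => a i - γ l)) * H := by
          rw [h1]; simp only [Matrix.mul_assoc]
      _ = 1 := by
        rw [hH, mul_one, Matrix.diagonal_mul_diagonal]
        have : (fun l => (a i - γ l)⁻¹ * (a i - γ l)) = fun _ => 1 :=
          funext fun l => inv_mul_cancel₀ (sub_ne_zero.2 (hne i l))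
        rw [this, Matrix.diagonal_one, mul_one, hHH]
  refine ⟨_, _, fun i => ?_, hRC, fun x hx hc => ?_⟩
  · simp only [Matrix.transpose_mul, Matrix.transpose_transpose, Matrix.diagonal_transpose,
      Matrix.mul_assoc]
  · rw [energy_eq S hx]
    obtain ⟨i, hi⟩ : ∃ i, S.inertia *ᵥ x.1 = a i • x.1 := by
      by_cases h0 : x.1 = 0
      · exact ⟨0, by simp [h0]⟩
      obtain ⟨l, hl⟩ : ∃ l, (F *ᵥ x.1) l ≠ 0 := by
        by_contra! h
        refine h0 ?_
        have h2 : F *ᵥ x.1 = 0 := funext h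
        rw [← Matrix.one_mulVec x.1, ← mul_eq_one_comm.1 hF, ← Matrix.mulVec_mulVec, h2,
          Matrix.mulVec_zero]
      have hFu : IsUnit F.det := Matrix.isUnit_det_of_right_inverse hF
      have h1 := (mulVec_cross_eq_zero_iff hFu).2 hc
      have h2 : F *ᵥ (S.inertia *ᵥ x.1) = Matrix.diagonal a *ᵥ (F *ᵥ x.1) := by
        rw [hI, Matrix.mulVec_mulVec, Matrix.mulVec_mulVec, ← Matrix.mul_assoc, ← Matrix.mul_assoc, hF,
          one_mul]
      rw [h2, cross_eq_zero_iff_forall] at h1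
      have h3 : F *ᵥ (S.inertia *ᵥ x.1) = F *ᵥ (a l • x.1) := by
        rw [h2, Matrix.mulVec_smul]
        ext m
        have := h1 m l
        simp only [Matrix.mulVec_diagonal] at this
        simp only [Matrix.mulVec_diagonal, Pi.smul_apply, smul_eq_mul]
        exact mul_right_cancel₀ hl (by linear_combination this)
      refine ⟨l, ?_⟩
      have h4 := congrArg (fun v => Fᵀ *ᵥ v) h3
      simpa only [Matrix.mulVec_mulVec, mul_eq_one_comm.1 hF, Matrix.one_mulVec, ← Matrix.mul_assoc,
        one_mul] using h4
    refine ⟨i, ?_⟩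
    have h1 : S.spaceMomentum x =
        (S.spaceTensor + a i • (1 : Matrix (Fin 3) (Fin 3) ℝ)) *ᵥ spaceVelocity x := by
      rw [spaceMomentum_eq S hx, spaceInertia, hi, Matrix.mulVec_smul, Matrix.add_mulVec, add_comm,
        Matrix.smul_mulVec, Matrix.one_mulVec]
      rfl
    have h2 : (Hᵀ * Matrix.diagonal (fun l => (a i - γ l)⁻¹) * H) *ᵥ S.spaceMomentum x =
        spaceVelocity x := by
      rw [h1, Matrix.mulVec_mulVec, hRC, Matrix.one_mulVec]
    rw [h2, dotProduct_comm]
    ring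

lemma eulerJacobiLevel_of_forall {j : Fin 4} {c : Option {i : Fin 4 // i ≠ j} → ℝ}
    (hB : ∀ e : Fin 3 → Vec3, IsOrthonormalFrame e → 0 < (S.totalInertia e).det)
    (h : ∀ x ∈ phaseSpace, (∀ o, S.dynamicIntegrals j o x = c o) →
      (S.inertia *ᵥ x.1) ⨯₃ x.1 ≠ 0 ∧ ∀ l : Fin 3, l.succ = j → S.spaceMomentum x l ≠ 0) :
    S.EulerJacobiLevel j c where
  isOpen := S.isOpen_domain
  smooth := S.contDiffOn_field
  density := S.isInvariantDensityOn_density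
  integrals := S.isFirstIntegralOn_integrals j
  card := by
    have h1 : Fintype.card {p : Fin 3 × Fin 3 // p.1 ≤ p.2} = 6 := by decide
    have h2 : Fintype.card {i : Fin 4 // i ≠ j} = 3 := by
      rw [Fintype.card_subtype_compl]
      simp
    simp [Fintype.card_sum, Fintype.card_option, h1, h2, Module.finrank_prod, Module.finrank_pi_fintype]
  independent := by
    intro x hx
    obtain ⟨h1, h2⟩ := (mem_invariantLevel_iff hB).1 hx
    exact S.linearIndependent_of_cross_ne_zero h1 (mem_domain_of_phaseSpace hB h1) j (h x h1 h2).1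
      (h x h1 h2).2

lemma dotProduct_mulVec_of_sign {R : Matrix (Fin 3) (Fin 3) ℝ} {k k' s : Vec3}
    (h : ∀ i, k' i = s i * k i) :
    k' ⬝ᵥ (R *ᵥ k') = k ⬝ᵥ ((Matrix.diagonal s * R * Matrix.diagonal s) *ᵥ k) := by
  have h1 : k' = Matrix.diagonal s *ᵥ k := by
    ext i
    rw [Matrix.mulVec_diagonal, h]
  rw [h1, ← Matrix.mulVec_mulVec, ← Matrix.mulVec_mulVec, Matrix.dotProduct_mulVec k,
    ← Matrix.mulVec_transpose, Matrix.diagonal_transpose]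

lemma sq_spaceMomentum_eq {x y : SupportState} (hx : x ∈ phaseSpace) (hy : y ∈ phaseSpace) {j : Fin 4}
    (h : ∀ o, S.dynamicIntegrals j o y = S.dynamicIntegrals j o x) (l : Fin 3) :
    S.spaceMomentum y l ^ 2 = S.spaceMomentum x l ^ 2 := by
  have h1 : ∀ i, i ≠ j → S.momentumIntegral i y = S.momentumIntegral i x := fun i hi => h (some ⟨i, hi⟩)
  have h2 : ∀ i : Fin 3, i.succ ≠ j → S.spaceMomentum y i = S.spaceMomentum x i := by
    intro i hi
    rw [← momentumIntegral_succ, ← momentumIntegral_succ, h1 _ hi]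
  by_cases hl : l.succ = j
  · have h0 := h1 0 (hl ▸ (Fin.succ_ne_zero l).symm)
    rw [momentumIntegral_zero S hx, momentumIntegral_zero S hy] at h0
    simp only [dotProduct] at h0
    rw [← Finset.add_sum_erase _ _ (Finset.mem_univ l), ← Finset.add_sum_erase _ _ (Finset.mem_univ l),
      Finset.sum_congr rfl fun i hi => by
        rw [h2 i fun h3 => (Finset.ne_of_mem_erase hi) (Fin.succ_injective _ (h3.trans hl.symm))]] at h0
    linear_combination h0
  · rw [h2 l hl]

/-- The Euler-Jacobi theorem applies on the levels of generic points of the phase space. -/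
lemma exists_isOpen_eulerJacobiLevel (hJ : ∀ r : ℝ, S.J ≠ r • (1 : Matrix (Fin 3) (Fin 3) ℝ))
    (hB : ∀ e : Fin 3 → Vec3, IsOrthonormalFrame e → 0 < (S.totalInertia e).det) (j : Fin 4) :
    ∃ W : Set SupportState, IsOpen W ∧ phaseSpace ⊆ closure (W ∩ phaseSpace) ∧
      ∀ x ∈ W ∩ phaseSpace, S.EulerJacobiLevel j fun o => S.dynamicIntegrals j o x := by
  obtain ⟨R, C, hR, hRC, hcrit⟩ := exists_critical_forms hB
  -- The level of x also contains states whose omitted momentum component has the opposite sign. All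
  -- sign patterns are excluded at once, which avoids a distinction by j.
  let D : (Fin 3 → ℤˣ) → Matrix (Fin 3) (Fin 3) ℝ := fun s => Matrix.diagonal fun l => ((s l : ℤ) : ℝ)
  have hD : ∀ s, D s * D s = 1 := by
    intro s
    rw [Matrix.diagonal_mul_diagonal, ← Matrix.diagonal_one]
    congr 1
    ext l
    rw [← Int.cast_mul, ← Units.val_mul, Int.units_mul_self]
    simp
  let V : Fin 3 × (Fin 3 → ℤˣ) → Set SupportState := fun p =>
    {x | 2 * S.energy x ≠ S.spaceMomentum x ⬝ᵥ ((D p.2 * R p.1 * D p.2) *ᵥ S.spaceMomentum x)}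
  let V' : Fin 3 → Set SupportState := fun l => {x | S.spaceMomentum x l ≠ 0}
  have hk : Continuous S.spaceMomentum := continuous_pi continuous_spaceMomentum
  have hV : ∀ p, IsOpen (V p) := fun p => isOpen_ne_fun
    (continuous_const.mul S.contDiff_energy.continuous)
    (hk.dotProduct (continuous_const.matrix_mulVec hk))
  have hV' : ∀ l, IsOpen (V' l) := fun l => isOpen_ne_fun (continuous_spaceMomentum l) continuous_const
  have hVd : ∀ p, Dense ((↑) ⁻¹' V p : Set phaseSpace) := by
    intro p
    refine dense_two_energy_ne hJ hB (C := D p.2 * C p.1 * D p.2) ?_ ?_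
    · simp only [D, Matrix.transpose_mul, Matrix.diagonal_transpose, hR, Matrix.mul_assoc]
    · calc _ = D p.2 * (R p.1 * (D p.2 * D p.2) * C p.1) * D p.2 := by simp only [Matrix.mul_assoc]
        _ = 1 := by rw [hD, mul_one, hRC, mul_one, hD]
  have hVd' : ∀ l, Dense ((↑) ⁻¹' V' l : Set phaseSpace) := dense_spaceMomentum_ne_zero hB
  have hP : IsClosed phaseSpace := by
    simp only [phaseSpace, IsOrthonormalFrame, Set.ofPred_forall]
    refine isClosed_iInter fun i => isClosed_iInter fun l => isClosed_eq ?_ continuous_const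
    fun_prop
  have : CompleteSpace phaseSpace := hP.completeSpace_coe
  refine ⟨(⋂ p, V p) ∩ ⋂ l, V' l, (isOpen_iInter_of_finite hV).inter (isOpen_iInter_of_finite hV'), ?_,
    ?_⟩
  · have h1 : Dense ((⋂ p, (↑) ⁻¹' V p) ∩ ⋂ l, (↑) ⁻¹' V' l : Set phaseSpace) :=
      (dense_iInter_of_isOpen (fun p => (hV p).preimage continuous_subtype_val) hVd).inter_of_isOpen_left
        (dense_iInter_of_isOpen (fun p => (hV' p).preimage continuous_subtype_val) hVd')
        (isOpen_iInter_of_finite fun p => (hV p).preimage continuous_subtype_val)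
    rw [← Set.preimage_iInter, ← Set.preimage_iInter, ← Set.preimage_inter, Subtype.dense_iff] at h1
    refine h1.trans (closure_mono ?_)
    rw [Subtype.image_preimage_coe, Set.inter_comm]
  · rintro x ⟨⟨hxV, hxV'⟩, hx⟩
    rw [Set.mem_iInter] at hxV hxV'
    refine eulerJacobiLevel_of_forall hB fun y hy hyx => ?_
    have h1 := sq_spaceMomentum_eq hx hy hyx
    refine ⟨fun hc => ?_, fun l _ h0 => hxV' l ?_⟩
    · obtain ⟨i, hi⟩ := hcrit y hy hc
      have h2 : ∀ l, ∃ s : ℤˣ, S.spaceMomentum y l = ((s : ℤ) : ℝ) * S.spaceMomentum x l := by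
        intro l
        rcases sq_eq_sq_iff_eq_or_eq_neg.1 (h1 l) with h | h
        · exact ⟨1, by simp [h]⟩
        · exact ⟨-1, by simp [h]⟩
      choose s hs using h2
      refine hxV (i, s) ?_
      have h3 : S.energy y = S.energy x := hyx none
      rw [← h3, hi]
      exact dotProduct_mulVec_of_sign hs
    · have h2 := h1 l
      rw [h0] at h2
      exact pow_eq_zero_iff two_ne_zero |>.1 (by simpa using h2.symm)

/-! ### Almost every value of the constants is regular -/

section AlmostEverywhere

variable {j : Fin 4}

/-- The constants of the momentum integrals; the one that is left out is replaced by zero. -/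
def momentumConstant (c : Option {i : Fin 4 // i ≠ j} → ℝ) (i : Fin 4) : ℝ :=
  if h : i ≠ j then c (some ⟨i, h⟩) else 0

/-- The square of the component of the spatial momentum that is left out. -/
def missingSquare (c : Option {i : Fin 4 // i ≠ j} → ℝ) : ℝ :=
  momentumConstant c 0 - ∑ l : Fin 3, momentumConstant c l.succ ^ 2

/-- The spatial momentum on a level, where `s` is the sign of the component that is left out. -/
def levelMomentum (s : ℤˣ) (c : Option {i : Fin 4 // i ≠ j} → ℝ) (l : Fin 3) : ℝ :=
  if l.succ = j then ((s : ℤ) : ℝ) * √(missingSquare c) else momentumConstant c l.succ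

lemma continuous_momentumConstant (i : Fin 4) :
    Continuous fun c : Option {i : Fin 4 // i ≠ j} → ℝ => momentumConstant c i := by
  unfold momentumConstant
  split_ifs with h
  · exact continuous_apply _
  · exact continuous_const

lemma continuous_missingSquare :
    Continuous fun c : Option {i : Fin 4 // i ≠ j} → ℝ => missingSquare c :=
  (continuous_momentumConstant 0).sub
    (continuous_finsetSum _ fun l _ => (continuous_momentumConstant l.succ).pow 2)

lemma continuous_levelMomentum (s : ℤˣ) :
    Continuous fun c : Option {i : Fin 4 // i ≠ j} → ℝ => levelMomentum s c := by
  refine continuous_pi fun l => ?_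
  unfold levelMomentum
  split_ifs with h
  · exact continuous_const.mul continuous_missingSquare.sqrt
  · exact continuous_momentumConstant _

lemma momentumConstant_update_none (c : Option {i : Fin 4 // i ≠ j} → ℝ) (t : ℝ) (i : Fin 4) :
    momentumConstant (Function.update c none t) i = momentumConstant c i := by
  unfold momentumConstant
  split_ifs with h
  · exact Function.update_of_ne (by simp) _ _
  · rfl

lemma levelMomentum_update_none (s : ℤˣ) (c : Option {i : Fin 4 // i ≠ j} → ℝ) (t : ℝ) :
    levelMomentum s (Function.update c none t) = levelMomentum s c := by
  funext l
  simp only [levelMomentum, missingSquare, momentumConstant_update_none]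

/-- Almost no point lies on the graph of a given function of the other coordinates. -/
lemma ae_ne_of_update_eq {ι : Type*} [Fintype ι] [DecidableEq ι] (o : ι) {f : (ι → ℝ) → ℝ}
    (hf : Measurable f) (h : ∀ c t, f (Function.update c o t) = f c) : ∀ᵐ c : ι → ℝ, c o ≠ f c := by
  -- Fubini along the direction o: each line in this direction meets the graph in one point.
  refine ae_mem_of_ae_add_linearMap_mem (s := {c : ι → ℝ | c o ≠ f c})
    (LinearMap.single ℝ (fun _ : ι => ℝ) o) (volume : Measure ℝ) volume
    (measurableSet_eq_fun (measurable_pi_apply o) hf).compl fun y => ?_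
  filter_upwards [(measure_singleton (f y - y o) : volume {f y - y o} = 0) |>
    compl_mem_ae_iff.2] with t ht
  have h1 : y + (Pi.single o t : ι → ℝ) = Function.update y o (y o + t) := by
    ext i
    by_cases hi : i = o
    · subst hi
      simp
    · simp [hi]
  change (y + (Pi.single o t : ι → ℝ)) o ≠ f (y + (Pi.single o t : ι → ℝ))
  rw [h1, h, Function.update_self]
  intro h2
  exact ht (by rw [Set.mem_singleton_iff, ← h2]; ring)

lemma momentumConstant_eq {c : Option {i : Fin 4 // i ≠ j} → ℝ} {x : SupportState}
    (h : ∀ o, S.dynamicIntegrals j o x = c o) {i : Fin 4} (hi : i ≠ j) :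
    momentumConstant c i = S.momentumIntegral i x := by
  rw [momentumConstant, dif_pos hi, ← h]
  rfl

lemma momentumConstant_self (c : Option {i : Fin 4 // i ≠ j} → ℝ) : momentumConstant c j = 0 :=
  dif_neg (not_not.2 rfl)

lemma missingSquare_eq {c : Option {i : Fin 4 // i ≠ j} → ℝ} {x : SupportState} (hx : x ∈ phaseSpace)
    (h : ∀ o, S.dynamicIntegrals j o x = c o) {l : Fin 3} (hl : l.succ = j) :
    missingSquare c = S.spaceMomentum x l ^ 2 := by
  have h1 : ∑ i ∈ Finset.univ.erase l, momentumConstant c i.succ ^ 2 =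
      ∑ i ∈ Finset.univ.erase l, S.spaceMomentum x i * S.spaceMomentum x i :=
    Finset.sum_congr rfl fun i hi => by
      rw [momentumConstant_eq h fun h3 =>
        (Finset.ne_of_mem_erase hi) (Fin.succ_injective _ (h3.trans hl.symm)), momentumIntegral_succ, sq]
  rw [missingSquare, momentumConstant_eq h (hl ▸ (Fin.succ_ne_zero l).symm), momentumIntegral_zero S hx,
    dotProduct, ← Finset.add_sum_erase _ _ (Finset.mem_univ l), ← Finset.add_sum_erase _
    (fun l : Fin 3 => momentumConstant c l.succ ^ 2) (Finset.mem_univ l), hl, momentumConstant_self, h1]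
  ring

lemma exists_levelMomentum_eq {c : Option {i : Fin 4 // i ≠ j} → ℝ} {x : SupportState}
    (hx : x ∈ phaseSpace) (h : ∀ o, S.dynamicIntegrals j o x = c o) :
    ∃ s, levelMomentum s c = S.spaceMomentum x := by
  have h1 : ∀ l : Fin 3, l.succ ≠ j → momentumConstant c l.succ = S.spaceMomentum x l := fun l hl => by
    rw [momentumConstant_eq h hl, momentumIntegral_succ]
  by_cases hj : ∃ l : Fin 3, l.succ = j
  · obtain ⟨l, hl⟩ := hj
    have h2 : ∃ s : ℤˣ, ((s : ℤ) : ℝ) * √(missingSquare c) = S.spaceMomentum x l := by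
      rw [missingSquare_eq hx h hl, Real.sqrt_sq_eq_abs]
      rcases abs_choice (S.spaceMomentum x l) with h3 | h3
      · exact ⟨1, by simp [h3]⟩
      · exact ⟨-1, by simp [h3]⟩
    obtain ⟨s, hs⟩ := h2
    refine ⟨s, funext fun i => ?_⟩
    by_cases hi : i.succ = j
    · rw [levelMomentum, if_pos hi, hs, Fin.succ_injective _ (hi.trans hl.symm)]
    · rw [levelMomentum, if_neg hi, h1 i hi]
  · refine ⟨1, funext fun i => ?_⟩
    rw [levelMomentum, if_neg fun hi => hj ⟨i, hi⟩, h1 i fun hi => hj ⟨i, hi⟩]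

/-- The exceptional set is a graph over the remaining constants: the value of (K, K) is the sum of
the squares of the two known components. -/
lemma ae_missingSquare_ne_zero (hj : j ≠ 0) :
    ∀ᵐ c : Option {i : Fin 4 // i ≠ j} → ℝ, missingSquare c ≠ 0 := by
  have h1 := ae_ne_of_update_eq (some (⟨0, hj.symm⟩ : {i : Fin 4 // i ≠ j}))
    (f := fun c => ∑ l : Fin 3, momentumConstant c l.succ ^ 2)
    (continuous_finsetSum _ fun l _ => (continuous_momentumConstant l.succ).pow 2).measurable
    fun c t => Finset.sum_congr rfl fun l _ => rfl
  filter_upwards [h1] with c hc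
  rw [missingSquare, momentumConstant, dif_pos hj.symm]
  exact sub_ne_zero.2 hc

end AlmostEverywhere

/-- The Euler-Jacobi theorem applies on almost all levels. -/
lemma ae_eulerJacobiLevel
    (hB : ∀ e : Fin 3 → Vec3, IsOrthonormalFrame e → 0 < (S.totalInertia e).det) (j : Fin 4) :
    ∀ᵐ c : Option {i : Fin 4 // i ≠ j} → ℝ, S.EulerJacobiLevel j c := by
  obtain ⟨R, C, hR, hRC, hcrit⟩ := exists_critical_forms hB
  -- Levels with ℐΩ × Ω = 0 somewhere lie on six graphs of the energy over the other constants: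
  -- three critical forms and two signs of the omitted component.
  have h1 : ∀ᵐ c : Option {i : Fin 4 // i ≠ j} → ℝ, ∀ p : Fin 3 × ℤˣ,
      c none ≠ 1 / 2 * (levelMomentum p.2 c ⬝ᵥ (R p.1 *ᵥ levelMomentum p.2 c)) := by
    refine ae_all_iff.2 fun p => ae_ne_of_update_eq none
      (f := fun c => 1 / 2 * (levelMomentum p.2 c ⬝ᵥ (R p.1 *ᵥ levelMomentum p.2 c))) ?_ fun c t => ?_
    · have hk := continuous_levelMomentum (j := j) p.2
      exact (continuous_const.mul
        (hk.dotProduct (continuous_const.matrix_mulVec hk))).measurable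
    · simp only [levelMomentum_update_none]
  have h2 : ∀ᵐ c : Option {i : Fin 4 // i ≠ j} → ℝ, j ≠ 0 → missingSquare c ≠ 0 := by
    by_cases hj : j = 0
    · exact Filter.Eventually.of_forall fun c h => absurd hj h
    · filter_upwards [ae_missingSquare_ne_zero hj] with c hc _ using hc
  filter_upwards [h1, h2] with c hc1 hc2
  refine eulerJacobiLevel_of_forall hB fun x hx hxc => ⟨fun h0 => ?_, fun l hl h0 => ?_⟩
  · obtain ⟨i, hi⟩ := hcrit x hx h0
    obtain ⟨s, hs⟩ := exists_levelMomentum_eq hx hxc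
    refine hc1 (i, s) ?_
    rw [hs, ← hi, ← hxc]
    change S.energy x = _
    ring
  · refine hc2 (hl ▸ Fin.succ_ne_zero l) ?_
    rw [missingSquare_eq hx hxc hl, h0]
    simp

end SphericalSupport

end

theorem mainTheorem7 {N : ℕ} (S : SphericalSupport N)
    (hJ : ∀ r : ℝ, S.J ≠ r • (1 : Matrix (Fin 3) (Fin 3) ℝ))
    (hB : ∀ e : Fin 3 → Vec3, IsOrthonormalFrame e → 0 < (S.totalInertia e).det) :
    -- the vector equations are a closed system, given by the vector field
    (∀ (x : ℝ → SupportState) (t : ℝ), x t ∈ S.domain →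
      (S.IsMotionAt x t ↔ HasDerivAt x (S.field (x t)) t)) ∧
    -- the L+R system for `(Ω, Γ)` is equivalent to the system for `(Ω, α, β, γ)`
    (∀ (a b t₀ : ℝ), t₀ ∈ Set.Ioo a b →
      ∀ (Ω : ℝ → Vec3) (Γ : ℝ → Matrix (Fin 3) (Fin 3) ℝ) (e₀ : Fin 3 → Vec3),
        IsOrthonormalFrame e₀ → Γ t₀ = S.gammaTensor e₀ →
        ((∀ t ∈ Set.Ioo a b, S.IsLRSolutionAt Ω Γ t) ↔
          ∃ e : ℝ → Fin 3 → Vec3, e t₀ = e₀ ∧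
            ∀ t ∈ Set.Ioo a b, IsOrthonormalFrame (e t) ∧ Γ t = S.gammaTensor (e t) ∧
              S.IsMotionAt (fun τ => (Ω τ, e τ)) t)) ∧
    -- whichever of `(K,K)`, `(K,α)`, `(K,β)`, `(K,γ)` is left out:
    ∀ j : Fin 4,
      -- the Euler-Jacobi theorem applies for almost all values of the constants
      (∀ᵐ c : Option {i : Fin 4 // i ≠ j} → ℝ, S.EulerJacobiLevel j c) ∧
      -- and on the levels of an open dense set of points of the phase space
      (∃ W : Set SupportState, IsOpen W ∧ phaseSpace ⊆ closure (W ∩ phaseSpace) ∧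
        ∀ x ∈ W ∩ phaseSpace, S.EulerJacobiLevel j fun o => S.dynamicIntegrals j o x) ∧
      -- the connected components of these levels are invariant two-dimensional tori
      (∀ c : Option {i : Fin 4 // i ≠ j} → ℝ, S.EulerJacobiLevel j c →
        ∀ x₀ ∈ S.invariantLevel j c,
          IsInvariantTorus S.field (connectedComponentIn (S.invariantLevel j c) x₀) ∧
          ∀ (a b t₀ : ℝ) (x : ℝ → SupportState), t₀ ∈ Set.Ioo a b → x t₀ = x₀ →
            (∀ t ∈ Set.Ioo a b, x t ∈ S.domain ∧ S.IsMotionAt x t) →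
            ∀ t ∈ Set.Ioo a b, x t ∈ connectedComponentIn (S.invariantLevel j c) x₀) := by
  refine ⟨S.isMotionAt_iff, fun a b t₀ ht₀ Ω Γ e₀ he₀ hΓ => S.isLRSolution_iff a b t₀ ht₀ Ω Γ e₀ he₀ hΓ,
    fun j => ⟨SphericalSupport.ae_eulerJacobiLevel hB j,
      ?_, fun c hc x₀ hx₀ => ⟨SphericalSupport.isInvariantTorus_connectedComponentIn hB hc hx₀,
        fun a b t₀ x ht₀ hxt₀ hx t ht =>
          SphericalSupport.mem_connectedComponentIn_of_isMotionAt hx₀ ht₀ hxt₀ hx ht⟩⟩⟩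
  exact SphericalSupport.exists_isOpen_eulerJacobiLevel hJ hB j
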